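/- Let $r\ge 3$, $k=r-2$, let $A\in\mathbb C$ be a primitive $4r$-th root of unity and $d=-A^2-A^{-2}$. Let $\mathrm{TL}_d$ be the Temperley--Lieb category: its objects are the natural numbers $n$ ($n$ marked points on an interval), and $\mathrm{Mor}(m,n)$ is spanned over $\mathbb C$ by the multicurves in a rectangle with $m$ endpoints on the bottom and $n$ endpoints on the top, modulo isotopy and the rule that a closed loop is deleted at the cost of a factor $d$; composition is stacking from bottom to top, and $\otimes$ denotes horizontal juxtaposition. Let $\Delta_0=1$, $\Delta_1=d$, $\Delta_{n+1}=d\,\Delta_n-\Delta_{n-1}$, and let $p_0,\dots,p_{r-1}$ be the Jones--Wenzl projectors, $p_0=1_0$, $p_1=1_1$, $p_{n+1}=p_n\otimes 1-\frac{\Delta_{n-1}}{\Delta_n}(p_n\otimes 1)U_n(p_n\otimes 1)$, where $U_n$ is the turn-back on the last two of $n+1$ strands. The rectangular Temperley--Lieb--Jones category $\Lambda$ is the quotient of $\mathrm{TL}_d$ by the ideal (closed under linear combinations, composition and $\otimes$) generated by $p_{r-1}$. A representation of $\Lambda$ is a $\mathbb C$-linear functor from $\Lambda$ to finite dimensional complex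 vector spaces. It is irreducible if it is nonzero and is not the direct sum of two nonzero representations. For $0\le i\le k$ let $W_{A,i}$ be the family of spaces $W_{A,i}^t=p_i\cdot\mathrm{Mor}(i,t)$, spanned by the diagrams with $p_i$ at the bottom and object $t$ at the top, on which $\Lambda$ acts from above by stacking. **Theorem.** 1. Each $W_{A,i}$, $0\le i\le k$, is an irreducible representation of $\Lambda$; it even has no nonzero proper invariant family of subspaces. 2. $W_{A,0},\dots,W_{A,k}$ are pairwise non-isomorphic, and every irreducible representation of $\Lambda$ is isomorphic to one of them; so there are exactly $k+1$ isomorphism classes of irreducible representations. 3. Every representation of $\Lambda$ is isomorphic to a finite direct sum $\bigoplus_i W_{A,i}^{\oplus m_i}$. 4. The duality involution $\hat{\ }$ on the labels $\{0,\dots,k\}$ is the identity. Here the tensor product of representations is the one induced by juxtaposition: $(\rho\otimes\sigma)(t)$ is $\bigoplus_{a,b}\rho(a)\otimes\sigma(b)\otimes\mathrm{Mor}(a+b,t)$ modulo the relations $xf\otimes yg\otimes h=x\otimes y\otimes (f\otimes g)h$. The unit is $\mathbf 1=W_{A,0}$. A representation $V$ is called a dual of $U$ if there is a linear isomorphism $\mathrm{Hom}(\mathbf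 1,U\otimes W)\cong\mathrm{Hom}(V,W)$ natural in the representation $W$, and $\hat i=j$ means that $W_{A,j}$ is a dual of $W_{A,i}$. The claim is that, for $0\le i,j\le k$, $W_{A,j}$ is a dual of $W_{A,i}$ if and only if $j=i$. -/

import Mathlib

open CategoryTheory CategoryTheory.Limits
open scoped TensorProduct DirectSum

namespace RectTLJ

/-! ### Pictures in a rectangle -/

/-- `Picture m n`: a multicurve in general position in the rectangle, with `m` marked points on the
bottom side and `n` marked points on the top side. It is read from bottom to top and is recorded by
the sequence of its critical points (for the height function):
* `strands` is `m` vertical strands;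
* `cup i P` puts on top of `P` a level which contains a single local minimum, with `i` strands to
  the left of it;
* `cap i P` puts on top of `P` a level which contains a single local maximum, which joins the two
  strands that have `i` strands to the left of them.
Closed components are allowed. -/
inductive Picture (m : ℕ) : ℕ → Type
  | strands : Picture m m
  | cup {n n' : ℕ} (i : ℕ) (hi : i ≤ n) (hn : n' = n + 2) (P : Picture m n) : Picture m n'
  | cap {n n' : ℕ} (i : ℕ) (hi : i ≤ n') (hn : n = n' + 2) (P : Picture m n) : Picture m n'

namespace Picture

/-- Vertical stacking: `P` below, `Q` above. -/
def stack {l m n : ℕ} (P : Picture l m) : Picture m n → Picture l n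
  | strands => P
  | cup i hi hn Q => cup i hi hn (stack P Q)
  | cap i hi hn Q => cap i hi hn (stack P Q)

theorem strands_stack {m n : ℕ} (Q : Picture m n) : stack strands Q = Q := by
  induction Q with
  | strands => rfl
  | cup i hi hn Q ih => simp [stack, ih]
  | cap i hi hn Q ih => simp [stack, ih]

theorem stack_assoc {k l m n : ℕ} (P : Picture k l) (Q : Picture l m) (R : Picture m n) :
    stack (stack P Q) R = stack P (stack Q R) := by
  induction R with
  | strands => rfl
  | cup i hi hn R ih => simp [stack, ih]
  | cap i hi hn R ih => simp [stack, ih]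

/-- Juxtaposition with `a` vertical strands on the left. -/
def addLeft (a : ℕ) {m n : ℕ} : Picture m n → Picture (a + m) (a + n)
  | strands => strands
  | cup i hi hn P => cup (a + i) (by omega) (by omega) (addLeft a P)
  | cap i hi hn P => cap (a + i) (by omega) (by omega) (addLeft a P)

/-- Juxtaposition with `b` vertical strands on the right. -/
def addRight (b : ℕ) {m n : ℕ} : Picture m n → Picture (m + b) (n + b)
  | strands => strands
  | cup i hi hn P => cup i (by omega) (by omega) (addRight b P)
  | cap i hi hn P => cap i (by omega) (by omega) (addRight b P)

end Picture

/-- The objects: `n` marked points on an interval, `n = 0, 1, 2, …`. -/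
def Points : Type := ℕ

instance : Category Points where
  Hom m n := Picture m n
  id _ := Picture.strands
  comp P Q := Picture.stack P Q
  id_comp := Picture.strands_stack
  comp_id _ := rfl
  assoc := Picture.stack_assoc

/-- The linear category of formal pictures: finite formal `ℂ`-linear combinations of pictures, with
bilinear stacking. -/
abbrev Formal : Type := Free ℂ Points

/-- `n` marked points, as an object of the category of formal pictures. -/
def fpt (n : ℕ) : Formal := n

/-- A picture as a formal picture. -/
noncomputable def pic {m n : ℕ} (P : Picture m n) : fpt m ⟶ fpt n :=
  (Finsupp.single P 1 : Picture m n →₀ ℂ)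

/-- `n` strands, with a local minimum inserted which has `i` strands to its left. -/
noncomputable def cup (n i : ℕ) (hi : i ≤ n) : fpt n ⟶ fpt (n + 2) :=
  pic (.cup i hi rfl .strands)

/-- `n + 2` strands, two of which are joined by a local maximum which has `i` strands to its
left. -/
noncomputable def cap (n i : ℕ) (hi : i ≤ n) : fpt (n + 2) ⟶ fpt n :=
  pic (.cap i hi rfl .strands)

/-- Juxtaposition of formal pictures with `a` vertical strands on the left. -/
noncomputable def fLeft (a : ℕ) {m n : ℕ} (f : fpt m ⟶ fpt n) : fpt (a + m) ⟶ fpt (a + n) :=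
  (Finsupp.mapDomain (Picture.addLeft a) (f : Picture m n →₀ ℂ) : Picture (a + m) (a + n) →₀ ℂ)

/-- Juxtaposition of formal pictures with `b` vertical strands on the right. -/
noncomputable def fRight (b : ℕ) {m n : ℕ} (f : fpt m ⟶ fpt n) : fpt (m + b) ⟶ fpt (n + b) :=
  (Finsupp.mapDomain (Picture.addRight b) (f : Picture m n →₀ ℂ) : Picture (m + b) (n + b) →₀ ℂ)

/-- The value at `d` of the Chebyshev polynomial `Δ_n`, where `Δ_0 = 1`, `Δ_1 = x` and
`Δ_{n+1} = x Δ_n - Δ_{n-1}`. -/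
noncomputable def chebyshev (d : ℂ) : ℕ → ℂ
  | 0 => 1
  | 1 => d
  | n + 2 => d * chebyshev d (n + 1) - chebyshev d n

/-- The Jones–Wenzl projectors: `p_0` and `p_1` are identities, and
`p_{n+1} = p_n ⊗ 1 - (Δ_{n-1} / Δ_n) (p_n ⊗ 1) U_n (p_n ⊗ 1)`, where `U_n` is a local maximum followed
by a local minimum on the last two of `n + 1` strands. -/
noncomputable def jonesWenzl (d : ℂ) : (n : ℕ) → (fpt n ⟶ fpt n)
  | 0 => 𝟙 (fpt 0)
  | 1 => 𝟙 (fpt 1)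
  | n + 2 =>
    fRight 1 (jonesWenzl d (n + 1)) -
      (chebyshev d n / chebyshev d (n + 1)) •
        (fRight 1 (jonesWenzl d (n + 1)) ≫ (cap n n le_rfl ≫ cup n n le_rfl) ≫
          fRight 1 (jonesWenzl d (n + 1)))

/-! ### The rectangular Temperley–Lieb–Jones category -/

/-- The local relations. Isotopy of multicurves: a zigzag can be straightened, and two critical
points, one to the left of the other, can exchange their heights. A closed loop is deleted at
the cost of a factor `d`. The Jones–Wenzl projector `p_{r-1}` is `0`. -/
inductive LocalRel (d : ℂ) (r : ℕ) : ∀ {m n : ℕ}, (fpt m ⟶ fpt n) → (fpt m ⟶ fpt n) → Prop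
  | zigzag_right (n i : ℕ) (hi : i ≤ n) :
      LocalRel d r (cup (n + 1) i (by omega) ≫ cap (n + 1) (i + 1) (by omega)) (𝟙 _)
  | zigzag_left (n i : ℕ) (hi : i ≤ n) :
      LocalRel d r (cup (n + 1) (i + 1) (by omega) ≫ cap (n + 1) i (by omega)) (𝟙 _)
  | cup_cup (n i j : ℕ) (hij : i ≤ j) (hj : j ≤ n) :
      LocalRel d r (cup n i (by omega) ≫ cup (n + 2) (j + 2) (by omega))
        (cup n j hj ≫ cup (n + 2) i (by omega))
  | cap_cap (n i j : ℕ) (hij : i ≤ j) (hj : j ≤ n) :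
      LocalRel d r (cap (n + 2) (j + 2) (by omega) ≫ cap n i (by omega))
        (cap (n + 2) i (by omega) ≫ cap n j hj)
  | cup_cap (n i j : ℕ) (hij : i ≤ j) (hj : j ≤ n) :
      LocalRel d r (cup (n + 2) i (by omega) ≫ cap (n + 2) (j + 2) (by omega))
        (cap n j hj ≫ cup n i (by omega))
  | cap_cup (n i j : ℕ) (hij : i ≤ j) (hj : j ≤ n) :
      LocalRel d r (cup (n + 2) (j + 2) (by omega) ≫ cap (n + 2) i (by omega))
        (cap n i (by omega) ≫ cup n j hj)
  | loop (n i : ℕ) (hi : i ≤ n) : LocalRel d r (cup n i hi ≫ cap n i hi) (d • 𝟙 _)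
  | projector : LocalRel d r (jonesWenzl d (r - 1)) 0

/-- The consequences of the local relations: the smallest linear equivalence relation on formal
pictures that contains them and is stable under stacking and juxtaposition. -/
inductive SkeinRel (d : ℂ) (r : ℕ) : ∀ {m n : ℕ}, (fpt m ⟶ fpt n) → (fpt m ⟶ fpt n) → Prop
  | of {m n : ℕ} {f g : fpt m ⟶ fpt n} : LocalRel d r f g → SkeinRel d r f g
  | refl {m n : ℕ} (f : fpt m ⟶ fpt n) : SkeinRel d r f f
  | symm {m n : ℕ} {f g : fpt m ⟶ fpt n} : SkeinRel d r f g → SkeinRel d r g f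
  | trans {m n : ℕ} {f g h : fpt m ⟶ fpt n} :
      SkeinRel d r f g → SkeinRel d r g h → SkeinRel d r f h
  | add {m n : ℕ} {f f' g g' : fpt m ⟶ fpt n} :
      SkeinRel d r f f' → SkeinRel d r g g' → SkeinRel d r (f + g) (f' + g')
  | smul {m n : ℕ} (c : ℂ) {f f' : fpt m ⟶ fpt n} :
      SkeinRel d r f f' → SkeinRel d r (c • f) (c • f')
  | comp_left {l m n : ℕ} (f : fpt l ⟶ fpt m) {g g' : fpt m ⟶ fpt n} :
      SkeinRel d r g g' → SkeinRel d r (f ≫ g) (f ≫ g')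
  | comp_right {l m n : ℕ} {f f' : fpt l ⟶ fpt m} (g : fpt m ⟶ fpt n) :
      SkeinRel d r f f' → SkeinRel d r (f ≫ g) (f' ≫ g)
  | left {m n : ℕ} (a : ℕ) {f f' : fpt m ⟶ fpt n} :
      SkeinRel d r f f' → SkeinRel d r (fLeft a f) (fLeft a f')
  | right {m n : ℕ} (b : ℕ) {f f' : fpt m ⟶ fpt n} :
      SkeinRel d r f f' → SkeinRel d r (fRight b f) (fRight b f')

/-- `SkeinRel` as a relation on the morphisms of `Formal`. -/
def homRel (d : ℂ) (r : ℕ) : HomRel Formal :=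
  fun m n f g => SkeinRel d r (m := m) (n := n) f g

instance (d : ℂ) (r : ℕ) : Congruence (homRel d r) where
  equivalence := ⟨fun f => .refl f, fun h => .symm h, fun h h' => .trans h h'⟩
  comp_left f _ _ h := SkeinRel.comp_left f h
  comp_right g h := SkeinRel.comp_right g h

/-- The rectangular Temperley–Lieb–Jones category: the Temperley–Lieb category with loop value `d`
modulo the ideal (for stacking and juxtaposition) generated by `p_{r-1}`. -/
abbrev TLJ (d : ℂ) (r : ℕ) : Type := Quotient (homRel d r)

noncomputable instance (d : ℂ) (r : ℕ) : Preadditive (TLJ d r) :=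
  Quotient.preadditive (homRel d r) fun _ _ _ _ _ _ h h' => SkeinRel.add h h'

instance (d : ℂ) (r : ℕ) : (Quotient.functor (homRel d r)).Additive :=
  Quotient.functor_additive (homRel d r) fun _ _ _ _ _ _ h h' => SkeinRel.add h h'

noncomputable instance (d : ℂ) (r : ℕ) : Linear ℂ (TLJ d r) :=
  Quotient.linear ℂ (homRel d r) fun c _ _ _ _ h => SkeinRel.smul c h

variable {d : ℂ} {r : ℕ}

/-- `n` marked points, as an object of the Temperley–Lieb–Jones category. -/
noncomputable def pt (d : ℂ) (r : ℕ) (n : ℕ) : TLJ d r := ⟨fpt n⟩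

/-- The morphism represented by a formal picture. -/
noncomputable def mk {m n : ℕ} (f : fpt m ⟶ fpt n) : pt d r m ⟶ pt d r n :=
  (Quotient.functor (homRel d r)).map f

theorem mk_surjective {m n : ℕ} (f : pt d r m ⟶ pt d r n) : ∃ g, mk g = f :=
  (Quotient.functor (homRel d r)).map_surjective f

theorem mk_eq_iff {m n : ℕ} (f g : fpt m ⟶ fpt n) :
    (mk f : pt d r m ⟶ pt d r n) = mk g ↔ SkeinRel d r f g :=
  Quotient.functor_map_eq_iff (homRel d r) f g

/-- The Jones–Wenzl projector `p_i` as a morphism of the Temperley–Lieb–Jones category. -/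
noncomputable def proj (d : ℂ) (r : ℕ) (i : ℕ) : pt d r i ⟶ pt d r i := mk (jonesWenzl d i)

/-- `1_a ⊗ f`: juxtaposition with `a` vertical strands on the left. -/
noncomputable def addLeft (a : ℕ) {m n : ℕ} (f : pt d r m ⟶ pt d r n) :
    pt d r (a + m) ⟶ pt d r (a + n) :=
  Quot.lift (fun g : fpt m ⟶ fpt n => mk (fLeft a g))
    (fun g g' h => (mk_eq_iff _ _).2 (SkeinRel.left a
      ((HomRel.compClosure_iff_self (homRel d r) g g').1 h))) f

/-- `f ⊗ 1_b`: juxtaposition with `b` vertical strands on the right. -/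
noncomputable def addRight (b : ℕ) {m n : ℕ} (f : pt d r m ⟶ pt d r n) :
    pt d r (m + b) ⟶ pt d r (n + b) :=
  Quot.lift (fun g : fpt m ⟶ fpt n => mk (fRight b g))
    (fun g g' h => (mk_eq_iff _ _).2 (SkeinRel.right b
      ((HomRel.compClosure_iff_self (homRel d r) g g').1 h))) f

theorem addLeft_mk (a : ℕ) {m n : ℕ} (f : fpt m ⟶ fpt n) :
    addLeft a (mk f : pt d r m ⟶ pt d r n) = mk (fLeft a f) := rfl

theorem addRight_mk (b : ℕ) {m n : ℕ} (f : fpt m ⟶ fpt n) :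
    addRight b (mk f : pt d r m ⟶ pt d r n) = mk (fRight b f) := rfl

/-! ### Representations -/

/-- A representation of the Temperley–Lieb–Jones category: a `ℂ`-linear functor to finite
dimensional complex vector spaces. The rectangle acts from above. -/
structure IsRep (ρ : TLJ d r ⥤ ModuleCat.{0} ℂ) : Prop where
  map_add : ∀ {s t : TLJ d r} (f g : s ⟶ t), ρ.map (f + g) = ρ.map f + ρ.map g
  map_smul : ∀ {s t : TLJ d r} (c : ℂ) (f : s ⟶ t), ρ.map (c • f) = c • ρ.map f
  finite : ∀ t : TLJ d r, FiniteDimensional ℂ (ρ.obj t)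

instance : HasFiniteBiproducts (TLJ d r ⥤ ModuleCat.{0} ℂ) := Abelian.hasFiniteBiproducts

/-- The space `W_i^t` spanned by the diagrams with `p_i` near the bottom and object `t` at the top:
the morphisms of the form `p_i` followed by `f`, with `f : i ⟶ t`. -/
noncomputable def irrepSpace (d : ℂ) (r i : ℕ) (t : TLJ d r) : Submodule ℂ (pt d r i ⟶ t) :=
  LinearMap.range (Linear.leftComp ℂ t (proj d r i))

theorem comp_mem_irrepSpace {i : ℕ} {s t : TLJ d r} {x : pt d r i ⟶ s}
    (hx : x ∈ irrepSpace d r i s) (g : s ⟶ t) : x ≫ g ∈ irrepSpace d r i t := by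
  obtain ⟨f, rfl⟩ := hx
  exact ⟨f ≫ g, by simp⟩

/-- The family `W_i = {W_i^t}`, on which the Temperley–Lieb–Jones category acts from above. -/
noncomputable def irrep (d : ℂ) (r i : ℕ) : TLJ d r ⥤ ModuleCat.{0} ℂ where
  obj t := ModuleCat.of ℂ (irrepSpace d r i t)
  map {s t} g := ModuleCat.ofHom
    (((Linear.rightComp ℂ (pt d r i) g).domRestrict (irrepSpace d r i s)).codRestrict
      (irrepSpace d r i t) fun x => comp_mem_irrepSpace x.2 g)
  map_id t := by
    refine ModuleCat.hom_ext (LinearMap.ext fun x => Subtype.ext ?_)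
    exact Category.comp_id x.1
  map_comp f g := by
    refine ModuleCat.hom_ext (LinearMap.ext fun x => Subtype.ext ?_)
    exact (Category.assoc x.1 f g).symm

/-! ### Tensor product and duality of representations -/

section Tensor

variable (ρ σ : TLJ d r ⥤ ModuleCat.{0} ℂ)

/-- The sum over all `a`, `b` of `ρ(a) ⊗ σ(b) ⊗ Mor(a + b, t)`. -/
abbrev PreTensor (t : TLJ d r) : Type :=
  ⨁ ab : ℕ × ℕ, ρ.obj (pt d r ab.1) ⊗[ℂ] (σ.obj (pt d r ab.2) ⊗[ℂ] (pt d r (ab.1 + ab.2) ⟶ t))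

variable {ρ σ} in
/-- The element `x ⊗ y ⊗ h` of the sum. -/
noncomputable def preTmul {a b : ℕ} {t : TLJ d r} (x : ρ.obj (pt d r a)) (y : σ.obj (pt d r b))
    (h : pt d r (a + b) ⟶ t) : PreTensor ρ σ t :=
  DirectSum.lof ℂ (ℕ × ℕ)
    (fun ab => ρ.obj (pt d r ab.1) ⊗[ℂ] (σ.obj (pt d r ab.2) ⊗[ℂ] (pt d r (ab.1 + ab.2) ⟶ t)))
    (a, b) (x ⊗ₜ[ℂ] (y ⊗ₜ[ℂ] h))

/-- The relations `x f ⊗ y ⊗ h = x ⊗ y ⊗ (f ⊗ 1) h` and `x ⊗ y g ⊗ h = x ⊗ y ⊗ (1 ⊗ g) h`. -/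
noncomputable def tensorRel (t : TLJ d r) : Submodule ℂ (PreTensor ρ σ t) :=
  Submodule.span ℂ
    ({z | ∃ (a a' b : ℕ) (f : pt d r a ⟶ pt d r a') (x : ρ.obj (pt d r a)) (y : σ.obj (pt d r b))
        (h : pt d r (a' + b) ⟶ t),
        z = preTmul (ρ.map f x) y h - preTmul x y (addRight b f ≫ h)} ∪
     {z | ∃ (a b b' : ℕ) (g : pt d r b ⟶ pt d r b') (x : ρ.obj (pt d r a)) (y : σ.obj (pt d r b))
        (h : pt d r (a + b') ⟶ t),
        z = preTmul x (σ.map g y) h - preTmul x y (addLeft a g ≫ h)})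

/-- The map of the sums induced by `h ↦ h ≫ k` and by `φ : σ ⟶ σ'`. -/
noncomputable def preMap {σ σ' : TLJ d r ⥤ ModuleCat.{0} ℂ} (φ : σ ⟶ σ') {s t : TLJ d r}
    (k : s ⟶ t) : PreTensor ρ σ s →ₗ[ℂ] PreTensor ρ σ' t :=
  DirectSum.lmap fun ab : ℕ × ℕ =>
    TensorProduct.map LinearMap.id
      (TensorProduct.map (φ.app (pt d r ab.2)).hom (Linear.rightComp ℂ (pt d r (ab.1 + ab.2)) k))

theorem preMap_preTmul {σ σ' : TLJ d r ⥤ ModuleCat.{0} ℂ} (φ : σ ⟶ σ') {s t : TLJ d r} (k : s ⟶ t)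
    {a b : ℕ} (x : ρ.obj (pt d r a)) (y : σ.obj (pt d r b)) (h : pt d r (a + b) ⟶ s) :
    preMap ρ φ k (preTmul x y h) = preTmul x (φ.app _ y) (h ≫ k) := by
  simp [preMap, preTmul, DirectSum.lmap_lof]

theorem tensorRel_le {σ σ' : TLJ d r ⥤ ModuleCat.{0} ℂ} (φ : σ ⟶ σ') {s t : TLJ d r} (k : s ⟶ t) :
    tensorRel ρ σ s ≤ (tensorRel ρ σ' t).comap (preMap ρ φ k) := by
  refine Submodule.span_le.2 ?_
  rintro z (⟨a, a', b, f, x, y, h, rfl⟩ | ⟨a, b, b', g, x, y, h, rfl⟩)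
  · refine Submodule.subset_span (Or.inl ⟨a, a', b, f, x, φ.app _ y, h ≫ k, ?_⟩)
    simp only [map_sub, preMap_preTmul, Category.assoc]
  · refine Submodule.subset_span (Or.inr ⟨a, b, b', g, x, φ.app _ y, h ≫ k, ?_⟩)
    have hφ : φ.app _ (σ.map g y) = σ'.map g (φ.app _ y) :=
      congrArg (fun u => u.hom y) (φ.naturality g)
    simp only [map_sub, preMap_preTmul, Category.assoc, hφ]

theorem preMap_id (t : TLJ d r) : preMap ρ (𝟙 σ) (𝟙 t) = LinearMap.id := by
  refine DirectSum.linearMap_ext _ fun ab => TensorProduct.ext' fun x z => ?_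
  induction z with
  | zero => simp
  | add z z' h h' => simp only [TensorProduct.tmul_add, map_add, h, h']
  | tmul y h =>
    refine (preMap_preTmul ρ (𝟙 σ) (𝟙 t) x y h).trans ?_
    rw [Category.comp_id]
    rfl

theorem preMap_comp {σ σ' σ'' : TLJ d r ⥤ ModuleCat.{0} ℂ} (φ : σ ⟶ σ') (φ' : σ' ⟶ σ'')
    {s t u : TLJ d r} (k : s ⟶ t) (l : t ⟶ u) :
    preMap ρ (φ ≫ φ') (k ≫ l) = (preMap ρ φ' l).comp (preMap ρ φ k) := by
  refine DirectSum.linearMap_ext _ fun ab => TensorProduct.ext' fun x z => ?_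
  induction z with
  | zero => simp
  | add z z' h h' => simp only [TensorProduct.tmul_add, map_add, h, h']
  | tmul y h =>
    refine (preMap_preTmul ρ (φ ≫ φ') (k ≫ l) x y h).trans ?_
    change _ = preMap ρ φ' l (preMap ρ φ k (preTmul x y h))
    rw [preMap_preTmul, preMap_preTmul, Category.assoc]
    rfl

/-- The tensor product of representations that is induced by juxtaposition: `(ρ ⊗ σ)(t)` is the sum
over all `a`, `b` of `ρ(a) ⊗ σ(b) ⊗ Mor(a + b, t)`, modulo the relations
`x f ⊗ y g ⊗ h = x ⊗ y ⊗ (f ⊗ g) h`; it is acted upon from above. -/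
noncomputable def tensor : TLJ d r ⥤ ModuleCat.{0} ℂ where
  obj t := ModuleCat.of ℂ (PreTensor ρ σ t ⧸ tensorRel ρ σ t)
  map k := ModuleCat.ofHom (Submodule.mapQ _ _ (preMap ρ (𝟙 σ) k) (tensorRel_le ρ (𝟙 σ) k))
  map_id t := by
    refine ModuleCat.hom_ext (LinearMap.ext fun x => ?_)
    obtain ⟨x, rfl⟩ := Submodule.Quotient.mk_surjective _ x
    simp [preMap_id]
  map_comp k l := by
    refine ModuleCat.hom_ext (LinearMap.ext fun x => ?_)
    obtain ⟨x, rfl⟩ := Submodule.Quotient.mk_surjective _ x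
    have := preMap_comp ρ (𝟙 σ) (𝟙 σ) k l
    rw [Category.comp_id] at this
    simp [this]

/-- The map `ρ ⊗ σ ⟶ ρ ⊗ σ'` induced by `φ : σ ⟶ σ'`. -/
noncomputable def tensorMap {σ σ' : TLJ d r ⥤ ModuleCat.{0} ℂ} (φ : σ ⟶ σ') :
    tensor ρ σ ⟶ tensor ρ σ' where
  app t := ModuleCat.ofHom (Submodule.mapQ _ _ (preMap ρ φ (𝟙 t)) (tensorRel_le ρ φ (𝟙 t)))
  naturality s t k := by
    refine ModuleCat.hom_ext (LinearMap.ext fun x => ?_)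
    obtain ⟨x, rfl⟩ := Submodule.Quotient.mk_surjective _ x
    have h₁ := preMap_comp ρ (𝟙 σ) φ k (𝟙 t)
    have h₂ := preMap_comp ρ φ (𝟙 σ') (𝟙 s) k
    rw [Category.comp_id, Category.id_comp] at h₁ h₂
    have h := congrArg (fun u => u x) (h₁.symm.trans h₂)
    exact congrArg (Submodule.Quotient.mk (p := tensorRel ρ σ' t)) h

end Tensor

/-- `V` is a dual of the representation `U`: there is an isomorphism
`Hom(1, U ⊗ W) ≅ Hom(V, W)`, natural in the representation `W`. The unit `1` is `W_0`, i.e. `t ↦ Mor(0, t)`. The involution `i ↦ î`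
on the labels is given by `î = j` when `W_j` is a dual of `W_i`. -/
def IsDual (U V : TLJ d r ⥤ ModuleCat.{0} ℂ) : Prop :=
  ∃ e : ∀ W : TLJ d r ⥤ ModuleCat.{0} ℂ, IsRep W → ((irrep d r 0 ⟶ tensor U W) ≃ₗ[ℂ] (V ⟶ W)),
    ∀ (W W' : TLJ d r ⥤ ModuleCat.{0} ℂ) (hW : IsRep W) (hW' : IsRep W') (φ : W ⟶ W')
      (x : irrep d r 0 ⟶ tensor U W), e W' hW' (x ≫ tensorMap U φ) = e W hW x ≫ φ

end RectTLJ

/-!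
The category is semisimple: the projectors `p_0, …, p_k` are its simple objects, pairwise
orthogonal, and the representations `W_i` are the functors that they represent.

* `A` primitive of order `4 r` means that `Δ_0, …, Δ_k` are nonzero and `Δ_{k+1} = 0`
  (`isLevel_of_isPrimitiveRoot`). Hence the Jones–Wenzl recursion is regular up to `p_{k+1}`, and
  `p_n` is an idempotent which is annihilated by local minima from below and by local maxima from
  above (`TLRelations.ringJW_props`, stated in any algebra with Temperley–Lieb generators).
* A morphism which starts with `p_m` is a combination of local minima on top of `p_m`, because local
  maxima can be pushed down to `p_m`. So `p_m ≫ f ≫ p_n` is a multiple of `p_m` if `m = n` and is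
  `0` otherwise (`exists_smul_proj`, `proj_comp_comp_proj`). As `1 - p_n` is a combination of
  morphisms ending with a local minimum, and `p_{k+1} = 0`, every identity is a combination of
  morphisms which factor through `p_0, …, p_k` (`id_mem_projSpan`).
* That the quotient is not zero, and more precisely that `p_i ≠ 0` for `i ≤ k`, needs a model. This
  is the path model: diagrams act on functions of walks on the Dynkin diagram with vertices
  `0, …, k`, with weights given by the `Δ_x`. The projector `p_{k+1}` acts by zero, since its image
  consists of functions that are antisymmetric, up to weights, under the flips of local extrema of
  the first `k + 1` steps. If such a function were nonzero at a walk, flips would lead to a walk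
  which goes up and then down, and to one which goes down and then up, both with the same ends. The
  top of the former is at least `k + 1` above the bottom of the latter, and there is no room for
  this between `0` and `k` (`IsLevel.mem_vanishing`, `proj_ne_zero`).
* By the Yoneda lemma, `Hom(W_i, ρ)` is the space `ρ(i) p_i` (`yonedaEquiv`). Together with the
  orthogonality of the `p_i` this yields the classification of the representations
  (`simple_irrep`, `irrep_hom_eq_zero`, `exists_decomposition`, `exists_iso_irrep`).
* For the duality, `Hom(W_0, W_i ⊗ W)` is `(W_i ⊗ W)(0)`. Bending the `i` left strands of a
  diagram to the top identifies this space with `W(i) p_i = Hom(W_i, W)`, naturally in `W`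
  (`pairingEquiv`, `dualEquiv`); the essential point is that the half turn of `p_i` is `p_i`
  (`bend_proj`). The dual is unique, as there are no nonzero morphisms between different `W_i`.
-/

namespace RectTLJ

variable {d : ℂ} {r : ℕ}

/-! ### Generators and relations of the Temperley–Lieb–Jones category -/

theorem pic_comp {l m n : ℕ} (P : Picture l m) (Q : Picture m n) :
    pic P ≫ pic Q = pic (P.stack Q) := by
  refine
    (Free.single_comp_single (R := ℂ) (C := Points) (X := l) (Y := m) (Z := n) P Q 1 1).trans ?_
  rw [one_mul]
  rfl

theorem pic_strands (n : ℕ) : pic (.strands : Picture n n) = 𝟙 (fpt n) := rfl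

/-- Formal pictures are spanned by pictures. -/
theorem formal_induction {m n : ℕ} {motive : (fpt m ⟶ fpt n) → Prop} (zero : motive 0)
    (add : ∀ f g, motive f → motive g → motive (f + g))
    (smul : ∀ (c : ℂ) f, motive f → motive (c • f))
    (pic : ∀ P : Picture m n, motive (pic P)) (f : fpt m ⟶ fpt n) : motive f := by
  refine Finsupp.induction_linear (motive := motive) f zero add fun (P : Picture m n) c => ?_
  have h : (Finsupp.single P c : Picture m n →₀ ℂ) = c • Finsupp.single P 1 := by simp
  exact h ▸ smul c _ (pic P)

theorem fLeft_pic (a : ℕ) {m n : ℕ} (P : Picture m n) : fLeft a (pic P) = pic (P.addLeft a) :=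
  Finsupp.mapDomain_single

theorem fRight_pic (b : ℕ) {m n : ℕ} (P : Picture m n) : fRight b (pic P) = pic (P.addRight b) :=
  Finsupp.mapDomain_single

theorem fLeft_add (a : ℕ) {m n : ℕ} (f g : fpt m ⟶ fpt n) :
    fLeft a (f + g) = fLeft a f + fLeft a g := Finsupp.mapDomain_add

theorem fRight_add (b : ℕ) {m n : ℕ} (f g : fpt m ⟶ fpt n) :
    fRight b (f + g) = fRight b f + fRight b g := Finsupp.mapDomain_add

theorem fLeft_smul (a : ℕ) {m n : ℕ} (c : ℂ) (f : fpt m ⟶ fpt n) :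
    fLeft a (c • f) = c • fLeft a f := Finsupp.mapDomain_smul c _

theorem fRight_smul (b : ℕ) {m n : ℕ} (c : ℂ) (f : fpt m ⟶ fpt n) :
    fRight b (c • f) = c • fRight b f := Finsupp.mapDomain_smul c _

theorem mk_comp {l m n : ℕ} (f : fpt l ⟶ fpt m) (g : fpt m ⟶ fpt n) :
    (mk (f ≫ g) : pt d r l ⟶ pt d r n) = mk f ≫ mk g := rfl

theorem mk_id (n : ℕ) : (mk (𝟙 (fpt n)) : pt d r n ⟶ pt d r n) = 𝟙 _ := rfl

theorem mk_add {m n : ℕ} (f g : fpt m ⟶ fpt n) :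
    (mk (f + g) : pt d r m ⟶ pt d r n) = mk f + mk g := rfl

theorem mk_smul {m n : ℕ} (c : ℂ) (f : fpt m ⟶ fpt n) :
    (mk (c • f) : pt d r m ⟶ pt d r n) = c • mk f := rfl

theorem mk_sub {m n : ℕ} (f g : fpt m ⟶ fpt n) :
    (mk (f - g) : pt d r m ⟶ pt d r n) = mk f - mk g :=
  (Quotient.functor (homRel d r)).map_sub

theorem mk_zero (m n : ℕ) : (mk (0 : fpt m ⟶ fpt n) : pt d r m ⟶ pt d r n) = 0 := rfl

theorem mk_eq_of_localRel {m n : ℕ} {f g : fpt m ⟶ fpt n} (h : LocalRel d r f g) :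
    (mk f : pt d r m ⟶ pt d r n) = mk g := (mk_eq_iff f g).2 (.of h)

/-- A local minimum with `i` strands to its left. The numbers of strands below and above are linked
by a propositional equation, so that no casts between objects are needed. -/
noncomputable def cupM {n n' : ℕ} (i : ℕ) (hi : i ≤ n) (hn : n' = n + 2) : pt d r n ⟶ pt d r n' :=
  mk (pic (.cup i hi hn .strands))

/-- A local maximum with `i` strands to its left, with the same convention as for `cupM`. -/
noncomputable def capM {n n' : ℕ} (i : ℕ) (hi : i ≤ n') (hn : n = n' + 2) :
    pt d r n ⟶ pt d r n' :=
  mk (pic (.cap i hi hn .strands))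

theorem exists_eq_pt (t : TLJ d r) : ∃ n, t = pt d r n := ⟨t.as, rfl⟩

/-- The morphisms are generated, under stacking and linear combinations, by local minima and
maxima. -/
theorem hom_induction {m : ℕ} {motive : ∀ n, (pt d r m ⟶ pt d r n) → Prop}
    (id : motive m (𝟙 _))
    (cup : ∀ n n' i hi hn f, motive n f → motive n' (f ≫ cupM i hi hn))
    (cap : ∀ n n' i hi hn f, motive n f → motive n' (f ≫ capM i hi hn))
    (zero : ∀ n, motive n 0) (add : ∀ n f g, motive n f → motive n g → motive n (f + g))
    (smul : ∀ n (c : ℂ) f, motive n f → motive n (c • f)) {n : ℕ} (f : pt d r m ⟶ pt d r n) :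
    motive n f := by
  obtain ⟨f, rfl⟩ := mk_surjective f
  refine formal_induction (zero n) (fun f g => add n (mk f) (mk g))
    (fun c f => smul n c (mk f)) (fun P => ?_) f
  clear f
  induction P with
  | strands => exact id
  | cup i hi hn P ih =>
    have := cup _ _ i hi hn _ ih
    rwa [cupM, ← mk_comp, pic_comp] at this
  | cap i hi hn P ih =>
    have := cap _ _ i hi hn _ ih
    rwa [capM, ← mk_comp, pic_comp] at this

theorem addLeft_add (a : ℕ) {m n : ℕ} (f g : pt d r m ⟶ pt d r n) :
    addLeft a (f + g) = addLeft a f + addLeft a g := by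
  obtain ⟨f, rfl⟩ := mk_surjective f
  obtain ⟨g, rfl⟩ := mk_surjective g
  rw [← mk_add, addLeft_mk, fLeft_add]
  rfl

theorem addRight_add (a : ℕ) {m n : ℕ} (f g : pt d r m ⟶ pt d r n) :
    addRight a (f + g) = addRight a f + addRight a g := by
  obtain ⟨f, rfl⟩ := mk_surjective f
  obtain ⟨g, rfl⟩ := mk_surjective g
  rw [← mk_add, addRight_mk, fRight_add]
  rfl

theorem addLeft_smul (a : ℕ) {m n : ℕ} (c : ℂ) (f : pt d r m ⟶ pt d r n) :
    addLeft a (c • f) = c • addLeft a f := by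
  obtain ⟨f, rfl⟩ := mk_surjective f
  rw [← mk_smul, addLeft_mk, fLeft_smul]
  rfl

theorem addRight_smul (a : ℕ) {m n : ℕ} (c : ℂ) (f : pt d r m ⟶ pt d r n) :
    addRight a (c • f) = c • addRight a f := by
  obtain ⟨f, rfl⟩ := mk_surjective f
  rw [← mk_smul, addRight_mk, fRight_smul]
  rfl

theorem addLeft_zero (a m n : ℕ) : addLeft a (0 : pt d r m ⟶ pt d r n) = 0 := by
  simpa using addLeft_smul a 0 (0 : pt d r m ⟶ pt d r n)

theorem addRight_zero (a m n : ℕ) : addRight a (0 : pt d r m ⟶ pt d r n) = 0 := by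
  simpa using addRight_smul a 0 (0 : pt d r m ⟶ pt d r n)

theorem addLeft_id (a n : ℕ) : addLeft a (𝟙 (pt d r n)) = 𝟙 (pt d r (a + n)) := by
  rw [← mk_id, addLeft_mk, ← pic_strands, fLeft_pic]
  rfl

theorem addRight_id (a n : ℕ) : addRight a (𝟙 (pt d r n)) = 𝟙 (pt d r (n + a)) := by
  rw [← mk_id, addRight_mk, ← pic_strands, fRight_pic]
  rfl

theorem addLeft_cupM (a : ℕ) {n n' i : ℕ} (hi : i ≤ n) (hn : n' = n + 2) :
    addLeft a (cupM i hi hn : pt d r n ⟶ pt d r n') = cupM (a + i) (by omega) (by omega) := by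
  rw [cupM, addLeft_mk, fLeft_pic]
  rfl

theorem addRight_cupM (a : ℕ) {n n' i : ℕ} (hi : i ≤ n) (hn : n' = n + 2) :
    addRight a (cupM i hi hn : pt d r n ⟶ pt d r n') = cupM i (by omega) (by omega) := by
  rw [cupM, addRight_mk, fRight_pic]
  rfl

theorem addLeft_capM (a : ℕ) {n n' i : ℕ} (hi : i ≤ n') (hn : n = n' + 2) :
    addLeft a (capM i hi hn : pt d r n ⟶ pt d r n') = capM (a + i) (by omega) (by omega) := by
  rw [capM, addLeft_mk, fLeft_pic]
  rfl

theorem addRight_capM (a : ℕ) {n n' i : ℕ} (hi : i ≤ n') (hn : n = n' + 2) :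
    addRight a (capM i hi hn : pt d r n ⟶ pt d r n') = capM i (by omega) (by omega) := by
  rw [capM, addRight_mk, fRight_pic]
  rfl

theorem addLeft_comp_pic (a : ℕ) {l m n : ℕ} (f : pt d r l ⟶ pt d r m) (P : Picture m n) :
    addLeft a (f ≫ mk (pic P)) = addLeft a f ≫ addLeft a (mk (pic P)) := by
  obtain ⟨f, rfl⟩ := mk_surjective f
  rw [← mk_comp, addLeft_mk, addLeft_mk, addLeft_mk, ← mk_comp]
  congr 1
  refine formal_induction (motive := fun f => fLeft a (f ≫ pic P) = fLeft a f ≫ fLeft a (pic P))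
    ?_ ?_ ?_ ?_ f
  · rw [Limits.zero_comp]
    exact (Limits.zero_comp (C := Formal)).symm
  · intro f g hf hg
    rw [Preadditive.add_comp, fLeft_add, fLeft_add, Preadditive.add_comp, hf, hg]
  · intro c f hf
    rw [Linear.smul_comp, fLeft_smul, fLeft_smul, Linear.smul_comp, hf]
  · intro Q
    rw [pic_comp, fLeft_pic, fLeft_pic, fLeft_pic, pic_comp]
    congr 1
    induction P with
    | strands => rfl
    | cup i hi hn P ih => simp [Picture.stack, Picture.addLeft, ih]
    | cap i hi hn P ih => simp [Picture.stack, Picture.addLeft, ih]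

theorem addRight_comp_pic (a : ℕ) {l m n : ℕ} (f : pt d r l ⟶ pt d r m) (P : Picture m n) :
    addRight a (f ≫ mk (pic P)) = addRight a f ≫ addRight a (mk (pic P)) := by
  obtain ⟨f, rfl⟩ := mk_surjective f
  rw [← mk_comp, addRight_mk, addRight_mk, addRight_mk, ← mk_comp]
  congr 1
  refine formal_induction
    (motive := fun f => fRight a (f ≫ pic P) = fRight a f ≫ fRight a (pic P)) ?_ ?_ ?_ ?_ f
  · rw [Limits.zero_comp]
    exact (Limits.zero_comp (C := Formal)).symm
  · intro f g hf hg
    rw [Preadditive.add_comp, fRight_add, fRight_add, Preadditive.add_comp, hf, hg]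
  · intro c f hf
    rw [Linear.smul_comp, fRight_smul, fRight_smul, Linear.smul_comp, hf]
  · intro Q
    rw [pic_comp, fRight_pic, fRight_pic, fRight_pic, pic_comp]
    congr 1
    induction P with
    | strands => rfl
    | cup i hi hn P ih => simp [Picture.stack, Picture.addRight, ih]
    | cap i hi hn P ih => simp [Picture.stack, Picture.addRight, ih]

theorem addLeft_comp (a : ℕ) {l m n : ℕ} (f : pt d r l ⟶ pt d r m) (g : pt d r m ⟶ pt d r n) :
    addLeft a (f ≫ g) = addLeft a f ≫ addLeft a g := by
  obtain ⟨g, rfl⟩ := mk_surjective g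
  refine formal_induction (motive := fun g => addLeft a (f ≫ mk g) = addLeft a f ≫ addLeft a (mk g))
    ?_ ?_ ?_ (addLeft_comp_pic a f) g
  · rw [mk_zero, Limits.comp_zero, addLeft_zero, addLeft_zero, Limits.comp_zero]
  · intro g h hg hh
    rw [mk_add, Preadditive.comp_add, addLeft_add, addLeft_add, Preadditive.comp_add, hg, hh]
  · intro c g hg
    rw [mk_smul, Linear.comp_smul, addLeft_smul, addLeft_smul, Linear.comp_smul, hg]

theorem addRight_comp (a : ℕ) {l m n : ℕ} (f : pt d r l ⟶ pt d r m) (g : pt d r m ⟶ pt d r n) :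
    addRight a (f ≫ g) = addRight a f ≫ addRight a g := by
  obtain ⟨g, rfl⟩ := mk_surjective g
  refine formal_induction
    (motive := fun g => addRight a (f ≫ mk g) = addRight a f ≫ addRight a (mk g))
    ?_ ?_ ?_ (addRight_comp_pic a f) g
  · rw [mk_zero, Limits.comp_zero, addRight_zero, addRight_zero, Limits.comp_zero]
  · intro g h hg hh
    rw [mk_add, Preadditive.comp_add, addRight_add, addRight_add, Preadditive.comp_add, hg, hh]
  · intro c g hg
    rw [mk_smul, Linear.comp_smul, addRight_smul, addRight_smul, Linear.comp_smul, hg]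

theorem addRight_sub (a : ℕ) {m n : ℕ} (f g : pt d r m ⟶ pt d r n) :
    addRight a (f - g) = addRight a f - addRight a g := by
  rw [eq_sub_iff_add_eq, ← addRight_add, sub_add_cancel]

section Relations

variable {n n₁ n₁' n₂ : ℕ}

/-- A zigzag, of either kind, can be straightened. -/
theorem zigzag {i j : ℕ} (hij : j = i + 1 ∨ i = j + 1) (hi : i ≤ n) (hj : j ≤ n) (hn : n₁ = n + 2) :
    (cupM i hi hn : pt d r n ⟶ pt d r n₁) ≫ capM j hj hn = 𝟙 (pt d r n) := by
  subst hn
  rcases hij with rfl | rfl <;> obtain ⟨n, rfl⟩ : ∃ k, n = k + 1 := ⟨n - 1, by omega⟩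
  · exact mk_eq_of_localRel (.zigzag_right n i (by omega))
  · exact mk_eq_of_localRel (.zigzag_left n j (by omega))

theorem loop (i : ℕ) (hi : i ≤ n) (hn : n₁ = n + 2) :
    (cupM i hi hn : pt d r n ⟶ pt d r n₁) ≫ capM i hi hn = d • 𝟙 (pt d r n) := by
  subst hn
  exact mk_eq_of_localRel (.loop n i hi)

theorem cupM_cupM {i j j' : ℕ} (hij : i ≤ j) (hj' : j' = j + 2) (hj : j ≤ n) (hn₁ : n₁ = n + 2)
    (hn₁' : n₁' = n + 2) (hn₂ : n₂ = n₁ + 2) :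
    (cupM i (hij.trans hj) hn₁ : pt d r n ⟶ pt d r n₁) ≫
        (cupM j' (by omega) hn₂ : _ ⟶ pt d r n₂) =
      (cupM j hj hn₁' : pt d r n ⟶ pt d r n₁') ≫ cupM i (by omega) (by omega) := by
  subst hn₁ hn₁' hn₂ hj'
  exact mk_eq_of_localRel (.cup_cup n i j hij hj)

theorem capM_capM {i j j' : ℕ} (hij : i ≤ j) (hj' : j' = j + 2) (hj : j ≤ n) (hn₁ : n₁ = n + 2)
    (hn₁' : n₁' = n + 2) (hn₂ : n₂ = n₁ + 2) :
    (capM j' (by omega) hn₂ : pt d r n₂ ⟶ pt d r n₁) ≫ capM i (hij.trans hj) hn₁ =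
      (capM i (by omega) (by omega) : pt d r n₂ ⟶ pt d r n₁') ≫ capM j hj hn₁' := by
  subst hn₁ hn₁' hn₂ hj'
  exact mk_eq_of_localRel (.cap_cap n i j hij hj)

/-- A local minimum followed by a local maximum to the right of it. -/
theorem cupM_capM {i j j' : ℕ} (hij : i ≤ j) (hj' : j' = j + 2) (hj : j ≤ n) (hn₁ : n₁ = n + 2)
    (hn₁' : n₁' = n + 2) (hn₂ : n₂ = n₁ + 2) :
    (cupM i (by omega) hn₂ : pt d r n₁ ⟶ pt d r n₂) ≫
        (capM j' (by omega) (by omega) : _ ⟶ pt d r n₁') =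
      capM j hj hn₁ ≫ cupM i (hij.trans hj) hn₁' := by
  subst hn₁ hn₁' hn₂ hj'
  exact mk_eq_of_localRel (.cup_cap n i j hij hj)

/-- A local minimum followed by a local maximum to the left of it. -/
theorem cupM_capM' {i j j' : ℕ} (hij : i ≤ j) (hj' : j' = j + 2) (hj : j ≤ n) (hn₁ : n₁ = n + 2)
    (hn₁' : n₁' = n + 2) (hn₂ : n₂ = n₁ + 2) :
    (cupM j' (by omega) hn₂ : pt d r n₁ ⟶ pt d r n₂) ≫
        (capM i (by omega) (by omega) : _ ⟶ pt d r n₁') =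
      capM i (hij.trans hj) hn₁ ≫ cupM j hj hn₁' := by
  subst hn₁ hn₁' hn₂ hj'
  exact mk_eq_of_localRel (.cap_cup n i j hij hj)

end Relations

/-! ### Jones–Wenzl elements of a ring with Temperley–Lieb generators -/

section Ring

variable {R : Type*} [Ring R] [Algebra ℂ R]

/-- The relations of the Temperley–Lieb algebra on `N` strands, for elements `U i` of an algebra;
only the `U i` with `i + 2 ≤ N` matter. -/
structure TLRelations (d : ℂ) (N : ℕ) (U : ℕ → R) : Prop where
  mul_self : ∀ i, i + 2 ≤ N → U i * U i = d • U i
  braid : ∀ i, i + 3 ≤ N → U i * U (i + 1) * U i = U i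
  braid' : ∀ i, i + 3 ≤ N → U (i + 1) * U i * U (i + 1) = U (i + 1)
  comm : ∀ i j, i + 2 ≤ j → j + 2 ≤ N → Commute (U i) (U j)

/-- The Jones–Wenzl recursion in an arbitrary algebra. -/
noncomputable def ringJW (d : ℂ) (U : ℕ → R) : ℕ → R
  | 0 => 1
  | 1 => 1
  | n + 2 => ringJW d U (n + 1) -
      (chebyshev d n / chebyshev d (n + 1)) • (ringJW d U (n + 1) * U n * ringJW d U (n + 1))

variable {N : ℕ} {U : ℕ → R}

theorem TLRelations.commute_ringJW (h : TLRelations d N U) :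
    ∀ n j, n ≤ j → j + 2 ≤ N → Commute (ringJW d U n) (U j)
  | 0, _, _, _ => Commute.one_left _
  | 1, _, _, _ => Commute.one_left _
  | n + 2, j, hn, hj => by
    have h₁ := h.commute_ringJW (n + 1) j (by omega) hj
    exact h₁.sub_left (((h₁.mul_left (h.comm n j hn hj)).mul_left h₁).smul_left _)

/-- The algebraic form of the partial trace formula for the Jones–Wenzl projectors. -/
theorem TLRelations.sandwich (h : TLRelations d N U) :
    ∀ n, n + 2 ≤ N → (∀ j ≤ n, chebyshev d j ≠ 0) → ringJW d U n * ringJW d U n = ringJW d U n →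
      U n * ringJW d U (n + 1) * U n =
        (chebyshev d (n + 1) / chebyshev d n) • (ringJW d U n * U n)
  | 0, hn, _, _ => by simp [ringJW, chebyshev, h.mul_self 0 hn]
  | n + 1, hn, hΔ, hf => by
    have hc := h.commute_ringJW (n + 1) (n + 1) le_rfl hn
    have h₁ := hΔ (n + 1) le_rfl
    set f := ringJW d U (n + 1) with hf_def
    have e₁ : U (n + 1) * f * U (n + 1) = d • (f * U (n + 1)) := by
      rw [← hc.eq, mul_assoc, h.mul_self _ hn, mul_smul_comm]
    have e₂ : U (n + 1) * (f * U n * f) * U (n + 1) = f * U (n + 1) := by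
      calc U (n + 1) * (f * U n * f) * U (n + 1)
          = (U (n + 1) * f) * U n * (f * U (n + 1)) := by noncomm_ring
        _ = (f * U (n + 1)) * U n * (U (n + 1) * f) := by rw [hc.eq]
        _ = f * (U (n + 1) * U n * U (n + 1)) * f := by noncomm_ring
        _ = f * U (n + 1) := by
          rw [h.braid' n hn, mul_assoc, ← hc.eq, ← mul_assoc, hf]
    rw [ringJW, ← hf_def, mul_sub, sub_mul, mul_smul_comm, smul_mul_assoc, e₁, e₂, ← sub_smul]
    congr 1
    rw [chebyshev]
    field_simp

/-- The Jones–Wenzl elements are idempotent and are annihilated by the generators. -/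
theorem TLRelations.ringJW_props (h : TLRelations d N U) :
    ∀ n, n ≤ N → (∀ j < n, chebyshev d j ≠ 0) → ringJW d U n * ringJW d U n = ringJW d U n ∧
      ∀ i, i + 2 ≤ n → U i * ringJW d U n = 0 ∧ ringJW d U n * U i = 0
  | 0, _, _ => ⟨one_mul _, fun i hi => by omega⟩
  | 1, _, _ => ⟨one_mul _, fun i hi => by omega⟩
  | n + 2, hn, hΔ => by
    obtain ⟨hf, hkill⟩ := h.ringJW_props (n + 1) (by omega) fun j hj => hΔ j (by omega)
    obtain ⟨hg, -⟩ := h.ringJW_props n (by omega) fun j hj => hΔ j (by omega)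
    have hs := h.sandwich n hn (fun j hj => hΔ j (by omega)) hg
    have h₀ := hΔ n (by omega)
    have h₁ := hΔ (n + 1) (by omega)
    have hgf : ringJW d U n * ringJW d U (n + 1) = ringJW d U (n + 1) ∧
        ringJW d U (n + 1) * ringJW d U n = ringJW d U (n + 1) := by
      cases n with
      | zero => exact ⟨one_mul _, mul_one _⟩
      | succ n =>
        rw [ringJW]
        simp only [mul_sub, sub_mul, mul_smul_comm, smul_mul_assoc, ← mul_assoc, hg]
        simp only [mul_assoc, hg, and_self]
    have hgU := h.commute_ringJW n n le_rfl hn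
    rw [ringJW]
    set f := ringJW d U (n + 1)
    set g := ringJW d U n
    set c := chebyshev d n / chebyshev d (n + 1) with hc
    have hcc : c * (chebyshev d (n + 1) / chebyshev d n) = 1 := by rw [hc]; field_simp
    -- The coefficient in the recursion is chosen to make this true.
    have hUfU : c • (U n * f * U n) = g * U n := by rw [hs, smul_smul, hcc, one_smul]
    have hz : c • (f * U n * f * (f * U n * f)) = f * U n * f := by
      calc c • (f * U n * f * (f * U n * f)) = c • (f * U n * (f * f) * U n * f) := by noncomm_ring
        _ = f * (c • (U n * f * U n)) * f := by
          rw [hf, mul_smul_comm, smul_mul_assoc]; noncomm_ring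
        _ = f * U n * f := by rw [hUfU, ← mul_assoc, hgf.2]
    refine ⟨?_, fun i hi => ?_⟩
    · rw [sub_mul, mul_sub, mul_sub, hf, smul_mul_smul_comm, mul_smul, hz, mul_smul_comm,
        smul_mul_assoc]
      rw [show f * (f * U n * f) = f * U n * f by rw [mul_assoc f, ← mul_assoc, hf]]
      rw [show f * U n * f * f = f * U n * f by rw [mul_assoc, hf], sub_self, sub_zero]
    · rcases Nat.lt_or_ge i n with hin | hin
      · obtain ⟨k₁, k₂⟩ := hkill i (by omega)
        refine ⟨?_, ?_⟩
        · rw [mul_sub, mul_smul_comm, mul_assoc f, ← mul_assoc, k₁]; simp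
        · rw [sub_mul, smul_mul_assoc, mul_assoc, k₂]; simp
      · obtain rfl : i = n := by omega
        refine ⟨?_, ?_⟩
        · rw [mul_sub, mul_smul_comm, ← mul_assoc, ← mul_assoc, ← smul_mul_assoc, hUfU, hgU.eq,
            mul_assoc, hgf.1, sub_self]
        · have e : c • (f * U i * f * U i) = f * (c • (U i * f * U i)) := by
            rw [mul_smul_comm]; noncomm_ring
          rw [sub_mul, smul_mul_assoc, e, hUfU, ← mul_assoc, hgf.2, sub_self]

theorem map_ringJW {S : Type*} [Ring S] [Algebra ℂ S] (φ : R →ₐ[ℂ] S) {V : ℕ → S} :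
    ∀ n, (∀ i, i + 2 ≤ n → φ (U i) = V i) → φ (ringJW d U n) = ringJW d V n
  | 0, _ => map_one φ
  | 1, _ => map_one φ
  | n + 2, h => by
    have := map_ringJW φ (n + 1) fun i hi => h i (by omega)
    simp only [ringJW, map_sub, map_smul, map_mul, this, h n le_rfl]

end Ring

/-! ### Chebyshev values at a root of unity -/

/-- The values `Δ_n` are the quantum integers `[n + 1]` at `q`. -/
theorem chebyshev_mul {q : ℂ} (hq : q ≠ 0) (hd : d = q + q⁻¹) :
    ∀ n : ℕ, chebyshev d n * (q - q⁻¹) = q ^ (n + 1) - q⁻¹ ^ (n + 1)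
  | 0 => by simp [chebyshev]
  | 1 => by rw [chebyshev, hd]; ring
  | n + 2 => by
    rw [chebyshev, sub_mul, mul_assoc, chebyshev_mul hq hd n, chebyshev_mul hq hd (n + 1), hd]
    linear_combination (q ^ (n + 1) - q⁻¹ ^ (n + 1)) * mul_inv_cancel₀ hq

/-! ### The Jones–Wenzl projectors -/

/-- `r = k + 2` and the loop value `d` is such that `Δ_0, …, Δ_k` are nonzero and `Δ_{k+1} = 0`. -/
structure IsLevel (d : ℂ) (r k : ℕ) : Prop where
  eq : r = k + 2
  one_le : 1 ≤ k
  ne_zero : ∀ j ≤ k, chebyshev d j ≠ 0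
  eq_zero : chebyshev d (k + 1) = 0

variable {k : ℕ}

theorem isLevel_of_isPrimitiveRoot (hr : 3 ≤ r) (hk : k + 2 = r) {A : ℂ}
    (hA : IsPrimitiveRoot A (4 * r)) (hd : d = -A ^ 2 - (A⁻¹) ^ 2) : IsLevel d r k := by
  have hA0 : A ≠ 0 := hA.ne_zero (by omega)
  have hA2 : A ^ 2 ≠ 0 := pow_ne_zero 2 hA0
  have hq : -A ^ 2 ≠ 0 := neg_ne_zero.2 hA2
  have hd' : d = -A ^ 2 + (-A ^ 2)⁻¹ := by rw [hd, inv_neg, inv_pow]; ring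
  -- Up to the factor `q - q⁻¹`, the value `Δ_n` vanishes exactly when `q ^ (2 (n + 1)) = 1`.
  have key : ∀ n, chebyshev d n * (-A ^ 2 - (-A ^ 2)⁻¹) = 0 ↔ r ∣ n + 1 := by
    intro n
    have h4 : (-A ^ 2) ^ (n + 1) * (-A ^ 2) ^ (n + 1) = A ^ (4 * (n + 1)) := by
      rw [← mul_pow, neg_mul_neg, ← pow_add, ← pow_mul]
    rw [chebyshev_mul hq hd', sub_eq_zero, inv_pow,
      ← div_eq_one_iff_eq (inv_ne_zero (pow_ne_zero _ hq)), div_inv_eq_mul, h4,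
      hA.pow_eq_one_iff_dvd, Nat.mul_dvd_mul_iff_left (by norm_num)]
  have h0 : -A ^ 2 - (-A ^ 2)⁻¹ ≠ 0 := by
    intro h
    have := Nat.le_of_dvd (by norm_num) ((key 0).1 (by rw [h, mul_zero]))
    omega
  refine ⟨hk.symm, by omega, fun j hj h => ?_, ?_⟩
  · have := Nat.le_of_dvd (by omega) ((key j).1 (by rw [h, zero_mul]))
    omega
  · exact (mul_eq_zero.1 ((key (k + 1)).2 ⟨1, by omega⟩)).resolve_right h0

theorem IsLevel.loop_ne_zero (h : IsLevel d r k) : d ≠ 0 := h.ne_zero 1 h.one_le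

/-- Juxtaposition with one strand on the right, as a homomorphism of endomorphism algebras. -/
noncomputable def addRightAlgHom (n : ℕ) : End (pt d r n) →ₐ[ℂ] End (pt d r (n + 1)) :=
  AlgHom.ofLinearMap
    { toFun := fun f => addRight 1 f
      map_add' := addRight_add 1
      map_smul' := fun c f => addRight_smul 1 c f }
    (addRight_id 1 n) fun f g => addRight_comp 1 g f

/-- The turn-back with `i` strands to its left, as an endomorphism of `n` points (and `0` if there
is no room for it). -/
noncomputable def turnBack (d : ℂ) (r n i : ℕ) : End (pt d r n) :=
  if h : i + 2 ≤ n then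
    (capM i (by omega) (by omega) : pt d r n ⟶ pt d r (n - 2)) ≫ cupM i (by omega) (by omega)
  else 0

theorem turnBack_eq {n n' i : ℕ} (hi : i ≤ n') (hn : n = n' + 2) :
    turnBack d r n i = (capM i hi hn : pt d r n ⟶ pt d r n') ≫ cupM i hi hn := by
  subst hn
  rw [turnBack, dif_pos (by omega)]

theorem addRight_turnBack {n i : ℕ} (hi : i + 2 ≤ n) :
    addRightAlgHom n (turnBack d r n i) = turnBack d r (n + 1) i := by
  obtain ⟨n, rfl⟩ : ∃ m, n = m + 2 := ⟨n - 2, by omega⟩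
  rw [turnBack_eq (by omega) rfl, turnBack_eq (n := n + 2 + 1) (n' := n + 1) (by omega) (by omega)]
  have := addRight_comp 1 (capM i (by omega) rfl : pt d r (n + 2) ⟶ pt d r n)
    (cupM i (by omega) rfl)
  rwa [addRight_cupM, addRight_capM] at this

theorem turnBack_relations (n : ℕ) : TLRelations d n (turnBack d r n) where
  mul_self i hi := by
    obtain ⟨n, rfl⟩ : ∃ m, n = m + 2 := ⟨n - 2, by omega⟩
    rw [turnBack_eq (by omega) rfl]
    change (_ ≫ _) ≫ _ ≫ _ = d • (_ ≫ _)
    simp only [Category.assoc]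
    rw [← Category.assoc (cupM _ _ _) (capM _ _ _), loop]
    simp
  braid i hi := by
    obtain ⟨n, rfl⟩ : ∃ m, n = m + 2 := ⟨n - 2, by omega⟩
    rw [turnBack_eq (i := i) (by omega) rfl, turnBack_eq (i := i + 1) (by omega) rfl]
    change (_ ≫ _) ≫ (_ ≫ _) ≫ (_ ≫ _) = _ ≫ _
    simp only [Category.assoc]
    rw [← Category.assoc (cupM _ _ _) (capM _ _ _), zigzag (.inl rfl), Category.id_comp,
      ← Category.assoc (cupM _ _ _) (capM _ _ _), zigzag (.inr rfl), Category.id_comp]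
  braid' i hi := by
    obtain ⟨n, rfl⟩ : ∃ m, n = m + 2 := ⟨n - 2, by omega⟩
    rw [turnBack_eq (i := i) (by omega) rfl, turnBack_eq (i := i + 1) (by omega) rfl]
    change (_ ≫ _) ≫ (_ ≫ _) ≫ (_ ≫ _) = _ ≫ _
    simp only [Category.assoc]
    rw [← Category.assoc (cupM _ _ _) (capM _ _ _), zigzag (.inr rfl), Category.id_comp,
      ← Category.assoc (cupM _ _ _) (capM _ _ _), zigzag (.inl rfl), Category.id_comp]
  comm i j hij hj := by
    obtain ⟨n, rfl⟩ : ∃ m, n = m + 4 := ⟨n - 4, by omega⟩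
    obtain ⟨j, rfl⟩ : ∃ m, j = m + 2 := ⟨j - 2, by omega⟩
    rw [turnBack_eq (n' := n + 2) (by omega) rfl,
      turnBack_eq (i := j + 2) (n' := n + 2) (by omega) rfl]
    change (_ ≫ _) ≫ (_ ≫ _) = (_ ≫ _) ≫ (_ ≫ _)
    simp only [Category.assoc]
    rw [← Category.assoc (cupM _ _ _) (capM _ _ _),
      ← Category.assoc (cupM _ _ _) (capM _ _ _),
      cupM_capM (n := n) (n₁ := n + 2) (n₁' := n + 2) (by omega : i ≤ j) rfl (by omega) rfl rfl rfl,
      cupM_capM' (n := n) (n₁ := n + 2) (n₁' := n + 2) (by omega : i ≤ j) rfl (by omega) rfl rfl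
        rfl]
    simp only [Category.assoc]
    rw [← cupM_cupM (n := n) (n₁ := n + 2) (n₁' := n + 2) (by omega : i ≤ j) rfl (by omega) rfl rfl
      rfl, ← Category.assoc, ← Category.assoc (capM i _ _) (capM j _ _),
      capM_capM (n := n) (n₁ := n + 2) (n₁' := n + 2) (by omega : i ≤ j) rfl (by omega) rfl rfl rfl]

theorem proj_zero : proj d r 0 = 𝟙 (pt d r 0) := rfl

theorem proj_one : proj d r 1 = 𝟙 (pt d r 1) := rfl

theorem proj_add_two (n : ℕ) : proj d r (n + 2) = addRight 1 (proj d r (n + 1)) -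
    (chebyshev d n / chebyshev d (n + 1)) • (addRight 1 (proj d r (n + 1)) ≫
      (capM n le_rfl rfl ≫ cupM n le_rfl rfl) ≫ addRight 1 (proj d r (n + 1))) := by
  rw [proj, jonesWenzl, mk_sub, mk_smul, mk_comp, mk_comp, mk_comp, ← addRight_mk]
  rfl

theorem proj_eq_ringJW : ∀ n, (proj d r n : End (pt d r n)) = ringJW d (turnBack d r n) n
  | 0 => proj_zero
  | 1 => proj_one
  | n + 2 => by
    have h : addRight 1 (proj d r (n + 1)) = ringJW d (turnBack d r (n + 2)) (n + 1) := by
      have := map_ringJW (d := d) (addRightAlgHom (d := d) (r := r) (n + 1))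
        (U := turnBack d r (n + 1)) (V := turnBack d r (n + 2)) (n + 1)
        fun i hi => addRight_turnBack hi
      rw [← this, ← proj_eq_ringJW (n + 1)]
      rfl
    rw [proj_add_two, ringJW, ← h, turnBack_eq le_rfl rfl]
    rfl

theorem proj_last (h : IsLevel d r k) : proj d r (k + 1) = 0 := by
  have := mk_eq_of_localRel (LocalRel.projector (d := d) (r := r))
  have hr : r - 1 = k + 1 := by rw [h.eq]; rfl
  rw [hr, mk_zero] at this
  exact this

theorem proj_comp_proj (h : IsLevel d r k) {n : ℕ} (hn : n ≤ k + 1) :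
    proj d r n ≫ proj d r n = proj d r n := by
  have := ((turnBack_relations (d := d) (r := r) n).ringJW_props n le_rfl
    fun j hj => h.ne_zero j (by omega)).1
  rw [← proj_eq_ringJW] at this
  exact this

theorem turnBack_comp_proj (h : IsLevel d r k) {n i : ℕ} (hn : n ≤ k + 1) (hi : i + 2 ≤ n) :
    turnBack d r n i ≫ proj d r n = 0 ∧ proj d r n ≫ turnBack d r n i = 0 := by
  have := ((turnBack_relations (d := d) (r := r) n).ringJW_props n le_rfl
    fun j hj => h.ne_zero j (by omega)).2 i hi
  rw [← proj_eq_ringJW] at this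
  exact ⟨this.2, this.1⟩

/-- A local minimum under `p_n` gives zero: up to the nonzero factor `d`, it is a local minimum
followed by a turn-back. -/
theorem cupM_comp_proj (h : IsLevel d r k) {n n' i : ℕ} (hn : n ≤ k + 1) (hi : i ≤ n')
    (hn' : n = n' + 2) : cupM i hi hn' ≫ proj d r n = 0 := by
  have := (turnBack_comp_proj h hn (i := i) (by omega)).1
  rw [turnBack_eq hi hn'] at this
  have h' := congrArg (fun f => cupM i hi hn' ≫ f) this
  simp only [Limits.comp_zero] at h'
  rw [← Category.assoc, ← Category.assoc, loop] at h'
  simpa [h.loop_ne_zero] using h'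

theorem proj_comp_capM (h : IsLevel d r k) {n n' i : ℕ} (hn : n ≤ k + 1) (hi : i ≤ n')
    (hn' : n = n' + 2) : proj d r n ≫ capM i hi hn' = 0 := by
  have := (turnBack_comp_proj h hn (i := i) (by omega)).2
  rw [turnBack_eq hi hn'] at this
  have h' := congrArg (fun f => f ≫ capM i hi hn') this
  simp only [Limits.zero_comp, Category.assoc] at h'
  rw [loop] at h'
  simpa [h.loop_ne_zero] using h'

/-- The span of the morphisms that end with a local minimum at the top. -/
noncomputable def cupSpan (d : ℂ) (r m n : ℕ) : Submodule ℂ (pt d r m ⟶ pt d r n) :=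
  Submodule.span ℂ {f | ∃ (n' i : ℕ) (hi : i ≤ n') (hn : n = n' + 2) (x : pt d r m ⟶ pt d r n'),
    x ≫ cupM i hi hn = f}

/-- The span of the morphisms that start with a local maximum at the bottom. -/
noncomputable def capSpan (d : ℂ) (r m n : ℕ) : Submodule ℂ (pt d r m ⟶ pt d r n) :=
  Submodule.span ℂ {f | ∃ (m' i : ℕ) (hi : i ≤ m') (hm : m = m' + 2) (x : pt d r m' ⟶ pt d r n),
    capM i hi hm ≫ x = f}

theorem comp_cupM_mem {m n n' i : ℕ} (x : pt d r m ⟶ pt d r n') (hi : i ≤ n') (hn : n = n' + 2) :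
    x ≫ cupM i hi hn ∈ cupSpan d r m n := Submodule.subset_span ⟨n', i, hi, hn, x, rfl⟩

theorem capM_comp_mem {m m' n i : ℕ} (x : pt d r m' ⟶ pt d r n) (hi : i ≤ m') (hm : m = m' + 2) :
    capM i hi hm ≫ x ∈ capSpan d r m n := Submodule.subset_span ⟨m', i, hi, hm, x, rfl⟩

theorem comp_mem_cupSpan {l m n : ℕ} (g : pt d r l ⟶ pt d r m) {f : pt d r m ⟶ pt d r n}
    (hf : f ∈ cupSpan d r m n) : g ≫ f ∈ cupSpan d r l n := by
  induction hf using Submodule.span_induction with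
  | mem f hf =>
    obtain ⟨n', i, hi, hn, x, rfl⟩ := hf
    rw [← Category.assoc]
    exact comp_cupM_mem _ _ _
  | zero => rw [Limits.comp_zero]; exact zero_mem _
  | add f f' _ _ h h' => rw [Preadditive.comp_add]; exact add_mem h h'
  | smul c f _ h => rw [Linear.comp_smul]; exact Submodule.smul_mem _ c h

theorem comp_mem_capSpan {l m n : ℕ} {f : pt d r l ⟶ pt d r m} (g : pt d r m ⟶ pt d r n)
    (hf : f ∈ capSpan d r l m) : f ≫ g ∈ capSpan d r l n := by
  induction hf using Submodule.span_induction with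
  | mem f hf =>
    obtain ⟨n', i, hi, hn, x, rfl⟩ := hf
    rw [Category.assoc]
    exact capM_comp_mem _ _ _
  | zero => rw [Limits.zero_comp]; exact zero_mem _
  | add f f' _ _ h h' => rw [Preadditive.add_comp]; exact add_mem h h'
  | smul c f _ h => rw [Linear.smul_comp]; exact Submodule.smul_mem _ c h

theorem addRight_mem_cupSpan {m n : ℕ} {f : pt d r m ⟶ pt d r n} (hf : f ∈ cupSpan d r m n) :
    addRight 1 f ∈ cupSpan d r (m + 1) (n + 1) := by
  induction hf using Submodule.span_induction with
  | mem f hf =>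
    obtain ⟨n', i, hi, hn, x, rfl⟩ := hf
    rw [addRight_comp, addRight_cupM]
    exact comp_cupM_mem _ _ _
  | zero => rw [addRight_zero]; exact zero_mem _
  | add f f' _ _ h h' => rw [addRight_add]; exact add_mem h h'
  | smul c f _ h => rw [addRight_smul]; exact Submodule.smul_mem _ c h

theorem addRight_mem_capSpan {m n : ℕ} {f : pt d r m ⟶ pt d r n} (hf : f ∈ capSpan d r m n) :
    addRight 1 f ∈ capSpan d r (m + 1) (n + 1) := by
  induction hf using Submodule.span_induction with
  | mem f hf =>
    obtain ⟨n', i, hi, hn, x, rfl⟩ := hf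
    rw [addRight_comp, addRight_capM]
    exact capM_comp_mem _ _ _
  | zero => rw [addRight_zero]; exact zero_mem _
  | add f f' _ _ h h' => rw [addRight_add]; exact add_mem h h'
  | smul c f _ h => rw [addRight_smul]; exact Submodule.smul_mem _ c h

theorem id_sub_proj_mem_cupSpan : ∀ n, 𝟙 (pt d r n) - proj d r n ∈ cupSpan d r n n
  | 0 => by rw [proj_zero, sub_self]; exact zero_mem _
  | 1 => by rw [proj_one, sub_self]; exact zero_mem _
  | n + 2 => by
    have h := addRight_mem_cupSpan (id_sub_proj_mem_cupSpan (n + 1))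
    rw [addRight_sub, addRight_id] at h
    set R := addRight 1 (proj d r (n + 1)) with hR
    have h' : (capM n le_rfl rfl ≫ cupM n le_rfl rfl) ≫ R ∈ cupSpan d r (n + 2) (n + 2) := by
      have e : (capM n le_rfl rfl ≫ cupM n le_rfl rfl) ≫ R =
          capM n le_rfl rfl ≫ cupM n le_rfl rfl -
            (capM n le_rfl rfl ≫ cupM n le_rfl rfl) ≫ (𝟙 (pt d r (n + 2)) - R) := by
        rw [Preadditive.comp_sub, Category.comp_id, sub_sub_cancel]
      rw [e]
      exact sub_mem (comp_cupM_mem _ _ _) (comp_mem_cupSpan _ h)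
    rw [proj_add_two, ← sub_add]
    exact add_mem h (Submodule.smul_mem _ _ (comp_mem_cupSpan _ h'))

theorem id_sub_proj_mem_capSpan : ∀ n, 𝟙 (pt d r n) - proj d r n ∈ capSpan d r n n
  | 0 => by rw [proj_zero, sub_self]; exact zero_mem _
  | 1 => by rw [proj_one, sub_self]; exact zero_mem _
  | n + 2 => by
    have h := addRight_mem_capSpan (id_sub_proj_mem_capSpan (n + 1))
    rw [addRight_sub, addRight_id] at h
    set R := addRight 1 (proj d r (n + 1)) with hR
    have h' : R ≫ (capM n le_rfl rfl ≫ cupM n le_rfl rfl) ∈ capSpan d r (n + 2) (n + 2) := by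
      have e : R ≫ (capM n le_rfl rfl ≫ cupM n le_rfl rfl) =
          capM n le_rfl rfl ≫ cupM n le_rfl rfl -
            (𝟙 (pt d r (n + 2)) - R) ≫ (capM n le_rfl rfl ≫ cupM n le_rfl rfl) := by
        rw [Preadditive.sub_comp, Category.id_comp, sub_sub_cancel]
      rw [e]
      exact sub_mem (capM_comp_mem _ _ _) (comp_mem_capSpan _ h)
    rw [proj_add_two, ← sub_add, ← Category.assoc]
    exact add_mem h (Submodule.smul_mem _ _ (comp_mem_capSpan _ h'))

/-! ### Semisimplicity of the Temperley–Lieb–Jones category -/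

/-- A sequence of local minima on top of `m` strands. -/
inductive CupChain (d : ℂ) (r m : ℕ) : ∀ n, (pt d r m ⟶ pt d r n) → Prop
  | id : CupChain d r m m (𝟙 _)
  | cup {n n' : ℕ} (i : ℕ) (hi : i ≤ n) (hn : n' = n + 2) (f : pt d r m ⟶ pt d r n)
      (hf : CupChain d r m n f) : CupChain d r m n' (f ≫ cupM i hi hn)

/-- The span of the morphisms `p_m ≫ g`, where `g` consists of local minima only. -/
noncomputable def projChain (d : ℂ) (r m n : ℕ) : Submodule ℂ (pt d r m ⟶ pt d r n) :=
  Submodule.span ℂ {f | ∃ g, CupChain d r m n g ∧ proj d r m ≫ g = f}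

theorem comp_cupM_mem_projChain {m n n' i : ℕ} (hi : i ≤ n) (hn : n' = n + 2)
    {f : pt d r m ⟶ pt d r n} (hf : f ∈ projChain d r m n) :
    f ≫ cupM i hi hn ∈ projChain d r m n' := by
  induction hf using Submodule.span_induction with
  | mem f hf =>
    obtain ⟨g, hg, rfl⟩ := hf
    rw [Category.assoc]
    exact Submodule.subset_span ⟨_, .cup i hi hn g hg, rfl⟩
  | zero => rw [Limits.zero_comp]; exact zero_mem _
  | add f f' _ _ h h' => rw [Preadditive.add_comp]; exact add_mem h h'
  | smul c f _ h => rw [Linear.smul_comp]; exact Submodule.smul_mem _ c h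

/-- A local maximum on top of local minima on top of `p_m` can be pushed down: it disappears, or
reaches `p_m` and gives zero. -/
theorem CupChain.comp_capM_mem (h : IsLevel d r k) {m n n' : ℕ} (hm : m ≤ k + 1)
    {g : pt d r m ⟶ pt d r n} (hg : CupChain d r m n g) {i : ℕ} (hi : i ≤ n') (hn : n = n' + 2) :
    proj d r m ≫ g ≫ capM i hi hn ∈ projChain d r m n' := by
  induction hg generalizing n' i with
  | id => rw [Category.id_comp, proj_comp_capM h hm]; exact zero_mem _
  | @cup n₀ n₁ j hj hn₀ g hg ih =>
    obtain rfl : n₀ = n' := by omega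
    have hg' : proj d r m ≫ g ∈ projChain d r m n₀ := Submodule.subset_span ⟨g, hg, rfl⟩
    rw [Category.assoc]
    rcases (by omega : i = j ∨ (i = j + 1 ∨ j = i + 1) ∨ j + 2 ≤ i ∨ i + 2 ≤ j) with
      rfl | hij | hij | hij
    · rw [loop, Linear.comp_smul, Linear.comp_smul, Category.comp_id]
      exact Submodule.smul_mem _ _ hg'
    · rw [zigzag hij, Category.comp_id]
      exact hg'
    · rw [cupM_capM (n := n₀ - 2) (i := j) (j := i - 2) (n₁' := n₀) (by omega) (by omega) (by omega)
        (by omega) (by omega) hn₀, ← Category.assoc g, ← Category.assoc]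
      exact comp_cupM_mem_projChain _ _ (ih _ _)
    · rw [cupM_capM' (n := n₀ - 2) (i := i) (j := j - 2) (n₁' := n₀) (by omega) (by omega)
        (by omega) (by omega) (by omega) hn₀, ← Category.assoc g, ← Category.assoc]
      exact comp_cupM_mem_projChain _ _ (ih _ _)

theorem proj_comp_mem_projChain (h : IsLevel d r k) {m n : ℕ} (hm : m ≤ k + 1)
    (f : pt d r m ⟶ pt d r n) : proj d r m ≫ f ∈ projChain d r m n := by
  refine hom_induction (motive := fun n f => proj d r m ≫ f ∈ projChain d r m n)
    (Submodule.subset_span ⟨_, .id, rfl⟩) ?_ ?_ ?_ ?_ ?_ f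
  · intro n n' i hi hn f hf
    rw [← Category.assoc]
    exact comp_cupM_mem_projChain hi hn hf
  · intro n n' i hi hn f hf
    rw [← Category.assoc]
    generalize proj d r m ≫ f = g at hf ⊢
    induction hf using Submodule.span_induction with
    | mem f hf =>
      obtain ⟨g, hg, rfl⟩ := hf
      rw [Category.assoc]
      exact hg.comp_capM_mem h hm hi hn
    | zero => rw [Limits.zero_comp]; exact zero_mem _
    | add f f' _ _ h h' => rw [Preadditive.add_comp]; exact add_mem h h'
    | smul c f _ h => rw [Linear.smul_comp]; exact Submodule.smul_mem _ c h
  · intro n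
    rw [Limits.comp_zero]; exact zero_mem _
  · intro n f g hf hg
    rw [Preadditive.comp_add]; exact add_mem hf hg
  · intro n c f hf
    rw [Linear.comp_smul]; exact Submodule.smul_mem _ c hf

/-- Schur's lemma for the Jones–Wenzl projectors, for equal labels. -/
theorem exists_smul_proj (h : IsLevel d r k) {m : ℕ} (hm : m ≤ k + 1) (f : pt d r m ⟶ pt d r m) :
    ∃ c : ℂ, proj d r m ≫ f ≫ proj d r m = c • proj d r m := by
  rw [← Category.assoc]
  have hf := proj_comp_mem_projChain h hm f
  generalize proj d r m ≫ f = g at hf ⊢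
  induction hf using Submodule.span_induction with
  | mem f hf =>
    obtain ⟨g, hg, rfl⟩ := hf
    cases hg with
    | id => exact ⟨1, by rw [Category.comp_id, proj_comp_proj h hm, one_smul]⟩
    | cup i hi hn g hg =>
      exact ⟨0, by rw [Category.assoc, Category.assoc, cupM_comp_proj h hm]; simp⟩
  | zero => exact ⟨0, by simp⟩
  | add f f' _ _ h h' =>
    obtain ⟨c, hc⟩ := h
    obtain ⟨c', hc'⟩ := h'
    exact ⟨c + c', by rw [Preadditive.add_comp, hc, hc', add_smul]⟩
  | smul a f _ h =>
    obtain ⟨c, hc⟩ := h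
    exact ⟨a * c, by rw [Linear.smul_comp, hc, mul_smul]⟩

/-- Schur's lemma for the Jones–Wenzl projectors, for different labels. -/
theorem proj_comp_comp_proj (h : IsLevel d r k) {m n : ℕ} (hm : m ≤ k + 1) (hn : n ≤ k + 1)
    (hmn : m ≠ n) (f : pt d r m ⟶ pt d r n) : proj d r m ≫ f ≫ proj d r n = 0 := by
  rw [← Category.assoc]
  have hf := proj_comp_mem_projChain h hm f
  generalize proj d r m ≫ f = g at hf ⊢
  induction hf using Submodule.span_induction with
  | mem f hf =>
    obtain ⟨g, hg, rfl⟩ := hf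
    cases hg with
    | id => exact absurd rfl hmn
    | cup i hi hn' g hg => rw [Category.assoc, Category.assoc, cupM_comp_proj h hn]; simp
  | zero => simp
  | add f f' _ _ h h' => rw [Preadditive.add_comp, h, h', add_zero]
  | smul a f _ h => rw [Linear.smul_comp, h, smul_zero]

/-- The span of the morphisms that factor through one of the projectors `p_0, …, p_k`. -/
noncomputable def projSpan (d : ℂ) (r k m n : ℕ) : Submodule ℂ (pt d r m ⟶ pt d r n) :=
  Submodule.span ℂ {f | ∃ i ≤ k, ∃ (x : pt d r m ⟶ pt d r i) (y : pt d r i ⟶ pt d r n),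
    x ≫ proj d r i ≫ y = f}

/-- As `p_{k+1} = 0`, the identity of more than `k` points is a combination of morphisms that end
with a local minimum. -/
theorem id_mem_cupSpan (h : IsLevel d r k) {n : ℕ} (hn : k + 1 ≤ n) :
    𝟙 (pt d r n) ∈ cupSpan d r n n := by
  induction n, hn using Nat.le_induction with
  | base => simpa [proj_last h] using id_sub_proj_mem_cupSpan (d := d) (r := r) (k + 1)
  | succ n _ ih => simpa [addRight_id] using addRight_mem_cupSpan ih

/-- Every identity morphism is a combination of morphisms which factor through one of the
projectors `p_0, …, p_k`. -/
theorem id_mem_projSpan (h : IsLevel d r k) (n : ℕ) : 𝟙 (pt d r n) ∈ projSpan d r k n n := by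
  induction n using Nat.strong_induction_on with
  | _ n ih =>
    have hcup : cupSpan d r n n ≤ projSpan d r k n n := by
      refine Submodule.span_le.2 ?_
      rintro _ ⟨n', i, hi, hn, x, rfl⟩
      have hx : ∀ f ∈ projSpan d r k n' n', x ≫ f ≫ cupM i hi hn ∈ projSpan d r k n n := by
        intro f hf
        induction hf using Submodule.span_induction with
        | mem f hf =>
          obtain ⟨j, hj, y, z, rfl⟩ := hf
          exact Submodule.subset_span
            ⟨j, hj, x ≫ y, z ≫ cupM i hi hn, by simp only [Category.assoc]⟩
        | zero => simp
        | add f f' _ _ h h' => rw [Preadditive.add_comp, Preadditive.comp_add]; exact add_mem h h'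
        | smul a f _ h => rw [Linear.smul_comp, Linear.comp_smul]; exact Submodule.smul_mem _ _ h
      simpa using hx _ (ih n' (by omega))
    rcases Nat.lt_or_ge k n with hn | hn
    · exact hcup (id_mem_cupSpan h hn)
    · have := add_mem (hcup (id_sub_proj_mem_cupSpan n))
        (Submodule.subset_span ⟨n, hn, 𝟙 _, 𝟙 _, by simp⟩ : proj d r n ∈ projSpan d r k n n)
      rwa [sub_add_cancel] at this

/-! ### The path model -/

/-- The values `Δ_x`, extended by `0` to the negative integers. -/
noncomputable def weight (d : ℂ) (x : ℤ) : ℂ := if x < 0 then 0 else chebyshev d x.toNat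

theorem weight_succ_add_pred {x : ℤ} (hx : 0 ≤ x) :
    weight d (x + 1) + weight d (x - 1) = d * weight d x := by
  obtain ⟨n, rfl⟩ := Int.eq_ofNat_of_zero_le hx
  cases n with
  | zero => simp [weight, chebyshev]
  | succ n =>
    have h₁ : ¬ ((n + 1 : ℕ) : ℤ) + 1 < 0 := by omega
    have h₂ : ¬ ((n + 1 : ℕ) : ℤ) - 1 < 0 := by omega
    have h₃ : ¬ ((n + 1 : ℕ) : ℤ) < 0 := by omega
    rw [weight, weight, weight, if_neg h₁, if_neg h₂, if_neg h₃,
      show (((n + 1 : ℕ) : ℤ) + 1).toNat = n + 2 by omega,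
      show (((n + 1 : ℕ) : ℤ) - 1).toNat = n by omega,
      show ((n + 1 : ℕ) : ℤ).toNat = n + 1 by omega, chebyshev]
    ring

theorem IsLevel.weight_ne_zero (h : IsLevel d r k) {x : ℤ} (h₀ : 0 ≤ x) (h₁ : x ≤ k) :
    weight d x ≠ 0 := by
  rw [weight, if_neg (by omega)]
  exact h.ne_zero _ (by omega)

theorem IsLevel.weight_eq_zero (h : IsLevel d r k) {x : ℤ} (hx : x = -1 ∨ x = k + 1) :
    weight d x = 0 := by
  rcases hx with rfl | rfl
  · simp [weight]
  · rw [weight, if_neg (by omega), show ((k : ℤ) + 1).toNat = k + 1 by omega, h.eq_zero]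

/-- The infinite walks on the Dynkin diagram with vertices `0, …, k`. Walks are infinite sequences
of integers, whatever the number of strands, so that all pictures act on the same space; a picture
shifts the steps to the right of it without changing them. -/
def IsWalk (k : ℕ) (γ : ℕ → ℤ) : Prop :=
  ∀ j, 0 ≤ γ j ∧ γ j ≤ k ∧ (γ (j + 1) = γ j + 1 ∨ γ (j + 1) = γ j - 1)

/-- Insert a detour `γ i, y, γ i` at position `i`. -/
def insertAt (i : ℕ) (y : ℤ) (γ : ℕ → ℤ) : ℕ → ℤ :=
  fun j => if j ≤ i then γ j else if j = i + 1 then y else γ (j - 2)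

/-- Delete the entries `i + 1` and `i + 2`. -/
def deleteAt (i : ℕ) (γ : ℕ → ℤ) : ℕ → ℤ := fun j => if j ≤ i then γ j else γ (j + 2)

theorem IsWalk.insertAt {γ : ℕ → ℤ} (h : IsWalk k γ) (i : ℕ) {y : ℤ} (hy : 0 ≤ y) (hy' : y ≤ k)
    (hyγ : y = γ i + 1 ∨ y = γ i - 1) : IsWalk k (insertAt i y γ) := by
  intro j
  have h₁ := h j
  have h₂ := h (j - 2)
  simp only [RectTLJ.insertAt]
  rcases (by omega : j + 1 ≤ i ∨ j = i ∨ j = i + 1 ∨ i + 2 ≤ j) with hj | rfl | rfl | hj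
  · simpa [hj, (by omega : j ≤ i)] using h₁
  · simp only [le_refl, if_true, if_neg (by omega : ¬ j + 1 ≤ j)]
    omega
  · simp only [if_neg (by omega : ¬ i + 1 ≤ i), if_neg (by omega : ¬ i + 1 + 1 ≤ i), if_true,
      if_neg (by omega : ¬ i + 1 + 1 = i + 1), (by omega : i + 1 + 1 - 2 = i)]
    omega
  · simp only [if_neg (by omega : ¬ j ≤ i), if_neg (by omega : ¬ j + 1 ≤ i),
      if_neg (by omega : ¬ j = i + 1), if_neg (by omega : ¬ j + 1 = i + 1),
      (by omega : j + 1 - 2 = j - 2 + 1)]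
    exact h₂

theorem IsWalk.deleteAt {γ : ℕ → ℤ} (h : IsWalk k γ) {i : ℕ} (hi : γ i = γ (i + 2)) :
    IsWalk k (deleteAt i γ) := by
  intro j
  have h₁ := h j
  have h₂ := h (j + 2)
  simp only [RectTLJ.deleteAt]
  rcases (by omega : j + 1 ≤ i ∨ j = i ∨ i + 1 ≤ j) with hj | rfl | hj
  · simpa [hj, (by omega : j ≤ i)] using h₁
  · simp only [le_refl, if_true, if_neg (by omega : ¬ j + 1 ≤ j), hi]
    simpa [hi, add_right_comm] using h₂
  · simp only [if_neg (by omega : ¬ j ≤ i), if_neg (by omega : ¬ j + 1 ≤ i),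
      (by omega : j + 1 + 2 = j + 2 + 1)]
    exact h₂

theorem insertAt_insertAt {i j : ℕ} (hij : i ≤ j) (y z : ℤ) (γ : ℕ → ℤ) :
    insertAt (j + 2) z (insertAt i y γ) = insertAt i y (insertAt j z γ) := by
  funext l
  simp only [insertAt]
  split_ifs <;> first | rfl | omega

theorem deleteAt_deleteAt {i j : ℕ} (hij : i ≤ j) (γ : ℕ → ℤ) :
    deleteAt i (deleteAt (j + 2) γ) = deleteAt j (deleteAt i γ) := by
  funext l
  simp only [deleteAt]
  split_ifs <;> first | rfl | omega

theorem deleteAt_insertAt {i j : ℕ} (hij : i ≤ j) (y : ℤ) (γ : ℕ → ℤ) :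
    deleteAt (j + 2) (insertAt i y γ) = insertAt i y (deleteAt j γ) := by
  funext l
  simp only [deleteAt, insertAt]
  split_ifs <;> first | rfl | omega | (congr 1; omega)

theorem deleteAt_insertAt' {i j : ℕ} (hij : i ≤ j) (y : ℤ) {γ : ℕ → ℤ} (hγ : γ i = γ (i + 2)) :
    deleteAt i (insertAt (j + 2) y γ) = insertAt j y (deleteAt i γ) := by
  funext l
  simp only [deleteAt, insertAt]
  by_cases hl : l = i + 2 ∧ i = j
  · obtain ⟨rfl, rfl⟩ := hl
    simp [hγ]
  · split_ifs <;> first | rfl | omega | (congr 1; omega)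

/-- The action of a local minimum with `i` strands to its left on functions of walks: the sum over
the detours at position `i`, with weights `Δ`. The action is contravariant: a picture from `m` to
`n` points pulls functions back. The weights of `cupOp` and `capOp` are normalized asymmetrically,
so that no square roots are needed; a closed loop acts at height `x` by
`(Δ_{x+1} + Δ_{x-1}) / Δ_x = d`. -/
noncomputable def cupOp (d : ℂ) (i : ℕ) : ((ℕ → ℤ) → ℂ) →ₗ[ℂ] ((ℕ → ℤ) → ℂ) where
  toFun φ γ := weight d (γ i + 1) * φ (insertAt i (γ i + 1) γ) +
    weight d (γ i - 1) * φ (insertAt i (γ i - 1) γ)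
  map_add' φ ψ := by funext γ; simp only [Pi.add_apply]; ring
  map_smul' c φ := by funext γ; simp only [Pi.smul_apply, smul_eq_mul, RingHom.id_apply]; ring

/-- The action of a local maximum with `i` strands to its left on functions of walks: it requires
the two steps after position `i` to cancel, and deletes them. -/
noncomputable def capOp (d : ℂ) (i : ℕ) : ((ℕ → ℤ) → ℂ) →ₗ[ℂ] ((ℕ → ℤ) → ℂ) where
  toFun φ γ := if γ i = γ (i + 2) then (weight d (γ i))⁻¹ * φ (deleteAt i γ) else 0
  map_add' φ ψ := by funext γ; simp only [Pi.add_apply]; split_ifs <;> ring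
  map_smul' c φ := by
    funext γ; simp only [Pi.smul_apply, smul_eq_mul, RingHom.id_apply]; split_ifs <;> ring

theorem cupOp_apply (i : ℕ) (φ : (ℕ → ℤ) → ℂ) (γ : ℕ → ℤ) :
    cupOp d i φ γ = weight d (γ i + 1) * φ (insertAt i (γ i + 1) γ) +
      weight d (γ i - 1) * φ (insertAt i (γ i - 1) γ) := rfl

theorem capOp_apply (i : ℕ) (φ : (ℕ → ℤ) → ℂ) (γ : ℕ → ℤ) :
    capOp d i φ γ = if γ i = γ (i + 2) then (weight d (γ i))⁻¹ * φ (deleteAt i γ) else 0 := rfl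

/-- The action of a picture on functions of walks. -/
noncomputable def pictureOp (d : ℂ) {m n : ℕ} : Picture m n → Module.End ℂ ((ℕ → ℤ) → ℂ)
  | .strands => 1
  | .cup i _ _ P => pictureOp d P * cupOp d i
  | .cap i _ _ P => pictureOp d P * capOp d i

theorem pictureOp_stack {l m n : ℕ} (P : Picture l m) (Q : Picture m n) :
    pictureOp d (P.stack Q) = pictureOp d P * pictureOp d Q := by
  induction Q with
  | strands => exact (mul_one _).symm
  | cup i hi hn Q ih => simp only [Picture.stack, pictureOp, ih, mul_assoc]
  | cap i hi hn Q ih => simp only [Picture.stack, pictureOp, ih, mul_assoc]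

theorem pictureOp_addRight (b : ℕ) {m n : ℕ} (P : Picture m n) :
    pictureOp d (P.addRight b) = pictureOp d P := by
  induction P with
  | strands => rfl
  | cup i hi hn Q ih => simp only [Picture.addRight, pictureOp, ih]
  | cap i hi hn Q ih => simp only [Picture.addRight, pictureOp, ih]

/-- Replace a walk from position `a` on. -/
def glue (a : ℕ) (γ δ : ℕ → ℤ) : ℕ → ℤ := fun j => if j < a then γ j else δ (j - a)

theorem insertAt_glue (a i : ℕ) (y : ℤ) (γ δ : ℕ → ℤ) :
    insertAt (a + i) y (glue a γ δ) = glue a γ (insertAt i y δ) := by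
  funext l
  simp only [insertAt, glue]
  split_ifs <;> first | rfl | omega | (congr 1; omega)

theorem deleteAt_glue (a i : ℕ) (γ δ : ℕ → ℤ) :
    deleteAt (a + i) (glue a γ δ) = glue a γ (deleteAt i δ) := by
  funext l
  simp only [deleteAt, glue]
  split_ifs <;> first | rfl | omega | (congr 1; omega)

theorem glue_add (a i : ℕ) (γ δ : ℕ → ℤ) : glue a γ δ (a + i) = δ i := by
  simp [glue]

theorem pictureOp_addLeft (a : ℕ) {m n : ℕ} (P : Picture m n) (φ : (ℕ → ℤ) → ℂ) (γ : ℕ → ℤ) :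
    pictureOp d (P.addLeft a) φ γ = pictureOp d P (fun δ => φ (glue a γ δ)) fun j => γ (a + j) := by
  induction P generalizing φ with
  | strands =>
    change φ γ = φ _
    congr 1
    funext j
    simp only [glue]
    split_ifs <;> first | rfl | (congr 1; omega)
  | cup i hi hn Q ih =>
    simp only [Picture.addLeft, pictureOp, Module.End.mul_apply, ih]
    have e : (fun δ => cupOp d (a + i) φ (glue a γ δ)) = cupOp d i fun δ => φ (glue a γ δ) := by
      funext δ
      simp only [cupOp_apply, glue_add, insertAt_glue]
    rw [e]
  | cap i hi hn Q ih =>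
    simp only [Picture.addLeft, pictureOp, Module.End.mul_apply, ih]
    have e : (fun δ => capOp d (a + i) φ (glue a γ δ)) = capOp d i fun δ => φ (glue a γ δ) := by
      funext δ
      simp only [capOp_apply, add_assoc, glue_add, deleteAt_glue]
    rw [e]

/-- The action of a formal picture on functions of walks. -/
noncomputable def formalOp (d : ℂ) {m n : ℕ} :
    (fpt m ⟶ fpt n) →ₗ[ℂ] Module.End ℂ ((ℕ → ℤ) → ℂ) :=
  (Finsupp.linearCombination ℂ (pictureOp d) : (Picture m n →₀ ℂ) →ₗ[ℂ] _)

theorem formalOp_pic {m n : ℕ} (P : Picture m n) : formalOp d (pic P) = pictureOp d P :=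
  (Finsupp.linearCombination_single ℂ (1 : ℂ) P).trans (one_smul _ _)

theorem formalOp_comp {l m n : ℕ} (f : fpt l ⟶ fpt m) (g : fpt m ⟶ fpt n) :
    formalOp d (f ≫ g) = formalOp d f * formalOp d g := by
  refine formal_induction (motive := fun f => formalOp d (f ≫ g) = formalOp d f * formalOp d g)
    ?_ ?_ ?_ ?_ f
  · rw [Limits.zero_comp, map_zero, map_zero, zero_mul]
  · intro f f' h h'
    rw [Preadditive.add_comp, map_add, map_add, h, h', add_mul]
  · intro c f h
    rw [Linear.smul_comp, map_smul, map_smul, h, smul_mul_assoc]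
  · intro P
    refine formal_induction
      (motive := fun g => formalOp d (pic P ≫ g) = formalOp d (pic P) * formalOp d g) ?_ ?_ ?_ ?_ g
    · rw [Limits.comp_zero, map_zero, map_zero, mul_zero]
    · intro f f' h h'
      rw [Preadditive.comp_add, map_add, map_add, h, h', mul_add]
    · intro c f h
      rw [Linear.comp_smul, map_smul, map_smul, h, mul_smul_comm]
    · intro Q
      rw [pic_comp, formalOp_pic, formalOp_pic, formalOp_pic, pictureOp_stack]

theorem formalOp_id (n : ℕ) : formalOp d (𝟙 (fpt n)) = 1 := formalOp_pic .strands

theorem formalOp_fRight (b : ℕ) {m n : ℕ} (f : fpt m ⟶ fpt n) :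
    formalOp d (fRight b f) = formalOp d f := by
  refine formal_induction (motive := fun f => formalOp d (fRight b f) = formalOp d f)
    ?_ ?_ ?_ ?_ f
  · exact congrArg _ (Finsupp.mapDomain_zero)
  · intro f g hf hg
    rw [fRight_add, map_add, map_add, hf, hg]
  · intro c f hf
    rw [fRight_smul, map_smul, map_smul, hf]
  · intro P
    rw [fRight_pic, formalOp_pic, formalOp_pic, pictureOp_addRight]

theorem formalOp_fLeft (a : ℕ) {m n : ℕ} (f : fpt m ⟶ fpt n) (φ : (ℕ → ℤ) → ℂ) (γ : ℕ → ℤ) :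
    formalOp d (fLeft a f) φ γ =
      formalOp d f (fun δ => φ (glue a γ δ)) fun j => γ (a + j) := by
  refine formal_induction (motive := fun f => formalOp d (fLeft a f) φ γ =
      formalOp d f (fun δ => φ (glue a γ δ)) fun j => γ (a + j)) ?_ ?_ ?_ ?_ f
  · have : fLeft a (0 : fpt m ⟶ fpt n) = 0 := Finsupp.mapDomain_zero
    rw [this, map_zero, map_zero]
    rfl
  · intro f g hf hg
    rw [fLeft_add, map_add, map_add]
    exact congrArg₂ (· + ·) hf hg
  · intro c f hf
    rw [fLeft_smul, map_smul, map_smul]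
    exact congrArg (c • ·) hf
  · intro P
    rw [fLeft_pic, formalOp_pic, formalOp_pic, pictureOp_addLeft]

/-- The functions that vanish on the walks which stay between `0` and `k`. They form an invariant
subspace, because the weights vanish at `-1` and `k + 1`; functions of walks between `0` and `k` are
encoded as the quotient by this subspace. -/
def vanishing (k : ℕ) : Submodule ℂ ((ℕ → ℤ) → ℂ) where
  carrier := {φ | ∀ γ, IsWalk k γ → φ γ = 0}
  add_mem' hφ hψ γ hγ := by rw [Pi.add_apply, hφ γ hγ, hψ γ hγ, add_zero]
  zero_mem' _ _ := rfl
  smul_mem' c φ hφ γ hγ := by rw [Pi.smul_apply, hφ γ hγ, smul_zero]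

theorem IsLevel.cupOp_mem (h : IsLevel d r k) (i : ℕ) {φ : (ℕ → ℤ) → ℂ} (hφ : φ ∈ vanishing k) :
    cupOp d i φ ∈ vanishing k := by
  intro γ hγ
  have hi := hγ i
  have key : ∀ y, y = γ i + 1 ∨ y = γ i - 1 → weight d y * φ (insertAt i y γ) = 0 := by
    intro y hy
    by_cases hy' : 0 ≤ y ∧ y ≤ k
    · rw [hφ _ (hγ.insertAt i hy'.1 hy'.2 hy), mul_zero]
    · rw [h.weight_eq_zero (by omega), zero_mul]
  rw [cupOp_apply, key _ (.inl rfl), key _ (.inr rfl), add_zero]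

theorem capOp_mem (i : ℕ) {φ : (ℕ → ℤ) → ℂ} (hφ : φ ∈ vanishing k) :
    capOp d i φ ∈ vanishing k := by
  intro γ hγ
  rw [capOp_apply]
  split_ifs with hi
  · rw [hφ _ (hγ.deleteAt hi), mul_zero]
  · rfl

theorem IsLevel.formalOp_mem (h : IsLevel d r k) {m n : ℕ} (f : fpt m ⟶ fpt n) :
    vanishing k ≤ (vanishing k).comap (formalOp d f) := by
  refine formal_induction (motive := fun f => vanishing k ≤ (vanishing k).comap (formalOp d f))
    ?_ ?_ ?_ ?_ f
  · rw [map_zero]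
    exact fun φ _ => zero_mem (vanishing k)
  · intro f g hf hg φ hφ
    rw [map_add]
    exact add_mem (S := Submodule ℂ _) (s := vanishing k) (hf hφ) (hg hφ)
  · intro c f hf φ hφ
    rw [map_smul]
    exact Submodule.smul_mem (vanishing k) c (hf hφ)
  · intro P φ hφ
    rw [formalOp_pic]
    clear f
    induction P generalizing φ with
    | strands => exact hφ
    | cup i hi hn P ih => exact ih (h.cupOp_mem i hφ)
    | cap i hi hn P ih => exact ih (capOp_mem i hφ)

/-- The action of a formal picture on functions of walks between `0` and `k`. -/
noncomputable def walkOp (h : IsLevel d r k) {m n : ℕ} (f : fpt m ⟶ fpt n) :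
    Module.End ℂ (((ℕ → ℤ) → ℂ) ⧸ vanishing k) :=
  (vanishing k).mapQ (vanishing k) (formalOp d f) (h.formalOp_mem f)

theorem walkOp_eq_iff (h : IsLevel d r k) {m n m' n' : ℕ} (f : fpt m ⟶ fpt n)
    (g : fpt m' ⟶ fpt n') : walkOp h f = walkOp h g ↔
      ∀ φ γ, IsWalk k γ → formalOp d f φ γ = formalOp d g φ γ := by
  constructor
  · intro hfg φ γ hγ
    have := LinearMap.congr_fun hfg (Submodule.Quotient.mk φ)
    have := (Submodule.Quotient.eq (vanishing k)).1 this
    exact sub_eq_zero.1 (this γ hγ)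
  · intro hfg
    refine LinearMap.ext fun x => ?_
    obtain ⟨φ, rfl⟩ := Submodule.Quotient.mk_surjective _ x
    exact (Submodule.Quotient.eq (vanishing k)).2 fun γ hγ => sub_eq_zero.2 (hfg φ γ hγ)

theorem walkOp_comp (h : IsLevel d r k) {l m n : ℕ} (f : fpt l ⟶ fpt m) (g : fpt m ⟶ fpt n) :
    walkOp h (f ≫ g) = walkOp h f * walkOp h g := by
  refine LinearMap.ext fun x => ?_
  obtain ⟨φ, rfl⟩ := Submodule.Quotient.mk_surjective _ x
  change Submodule.Quotient.mk (formalOp d (f ≫ g) φ) = _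
  rw [formalOp_comp]
  rfl

theorem walkOp_add (h : IsLevel d r k) {m n : ℕ} (f g : fpt m ⟶ fpt n) :
    walkOp h (f + g) = walkOp h f + walkOp h g := by
  refine LinearMap.ext fun x => ?_
  obtain ⟨φ, rfl⟩ := Submodule.Quotient.mk_surjective _ x
  change Submodule.Quotient.mk (formalOp d (f + g) φ) = _
  rw [map_add]
  rfl

theorem walkOp_smul (h : IsLevel d r k) {m n : ℕ} (c : ℂ) (f : fpt m ⟶ fpt n) :
    walkOp h (c • f) = c • walkOp h f := by
  refine LinearMap.ext fun x => ?_
  obtain ⟨φ, rfl⟩ := Submodule.Quotient.mk_surjective _ x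
  change Submodule.Quotient.mk (formalOp d (c • f) φ) = _
  rw [map_smul]
  rfl

theorem walkOp_id (h : IsLevel d r k) (n : ℕ) : walkOp h (𝟙 (fpt n)) = 1 := by
  refine LinearMap.ext fun x => ?_
  obtain ⟨φ, rfl⟩ := Submodule.Quotient.mk_surjective _ x
  change Submodule.Quotient.mk (formalOp d (𝟙 (fpt n)) φ) = _
  rw [formalOp_id]
  rfl

/-- Strands on the right act on later steps, so that they do not change the operator. -/
theorem walkOp_fRight (h : IsLevel d r k) (b : ℕ) {m n : ℕ} (f : fpt m ⟶ fpt n) :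
    walkOp h (fRight b f) = walkOp h f :=
  (walkOp_eq_iff h _ _).2 fun φ γ _ => by rw [formalOp_fRight]

/-! ### The Temperley–Lieb relations in the path model -/

theorem insertAt_le {i j : ℕ} (hij : j ≤ i) (y : ℤ) (γ : ℕ → ℤ) : insertAt i y γ j = γ j :=
  if_pos hij

theorem insertAt_succ (i : ℕ) (y : ℤ) (γ : ℕ → ℤ) : insertAt i y γ (i + 1) = y := by
  simp [insertAt]

theorem insertAt_ge {i j : ℕ} (h : i ≤ j) (y : ℤ) (γ : ℕ → ℤ) :
    insertAt i y γ (j + 2) = γ j := by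
  rw [insertAt, if_neg (by omega), if_neg (by omega), Nat.add_sub_cancel]

theorem deleteAt_le {i j : ℕ} (h : j ≤ i) (γ : ℕ → ℤ) : deleteAt i γ j = γ j := if_pos h

theorem deleteAt_ge {i j : ℕ} (h : i ≤ j) {γ : ℕ → ℤ} (hγ : γ i = γ (i + 2)) :
    deleteAt i γ j = γ (j + 2) := by
  rcases h.eq_or_lt with rfl | h
  · rw [deleteAt_le le_rfl, hγ]
  · exact if_neg (by omega)

theorem deleteAt_insertAt_self (i : ℕ) (y : ℤ) (γ : ℕ → ℤ) : deleteAt i (insertAt i y γ) = γ := by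
  funext l
  simp only [deleteAt, insertAt]
  split_ifs <;> first | rfl | omega

theorem deleteAt_insertAt_right (i : ℕ) (γ : ℕ → ℤ) :
    deleteAt (i + 1) (insertAt i (γ (i + 1)) γ) = γ := by
  funext l
  simp only [deleteAt, insertAt]
  split_ifs <;> first | rfl | omega | (congr 1; omega)

theorem deleteAt_insertAt_left (i : ℕ) (γ : ℕ → ℤ) :
    deleteAt i (insertAt (i + 1) (γ i) γ) = γ := by
  funext l
  simp only [deleteAt, insertAt]
  split_ifs <;> first | rfl | omega

theorem IsLevel.cupOp_capOp_self (h : IsLevel d r k) (i : ℕ) (φ : (ℕ → ℤ) → ℂ) {γ : ℕ → ℤ}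
    (hγ : IsWalk k γ) : cupOp d i (capOp d i φ) γ = d * φ γ := by
  have hw := h.weight_ne_zero (hγ i).1 (hγ i).2.1
  rw [cupOp_apply, capOp_apply, capOp_apply]
  simp only [insertAt_le le_rfl, insertAt_ge le_rfl, if_true, deleteAt_insertAt_self]
  rw [← mul_assoc, ← mul_assoc, ← add_mul, ← add_mul, weight_succ_add_pred (hγ i).1,
    mul_assoc d, mul_inv_cancel₀ hw, mul_one]

theorem IsLevel.cupOp_capOp_succ (h : IsLevel d r k) (i : ℕ) (φ : (ℕ → ℤ) → ℂ) {γ : ℕ → ℤ}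
    (hγ : IsWalk k γ) : cupOp d i (capOp d (i + 1) φ) γ = φ γ := by
  have hw := h.weight_ne_zero (hγ (i + 1)).1 (hγ (i + 1)).2.1
  have e : ∀ y, weight d y * capOp d (i + 1) φ (insertAt i y γ) =
      if y = γ (i + 1) then φ γ else 0 := by
    intro y
    rw [capOp_apply, insertAt_succ, insertAt_ge (Nat.le_succ i)]
    split_ifs with hy
    · rw [hy, deleteAt_insertAt_right, mul_inv_cancel_left₀ hw]
    · rw [mul_zero]
  rw [cupOp_apply, e, e]
  rcases (hγ i).2.2 with hi | hi
  · rw [if_pos hi.symm, if_neg (by omega), add_zero]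
  · rw [if_pos hi.symm, if_neg (by omega), zero_add]

theorem IsLevel.cupOp_succ_capOp (h : IsLevel d r k) (i : ℕ) (φ : (ℕ → ℤ) → ℂ) {γ : ℕ → ℤ}
    (hγ : IsWalk k γ) : cupOp d (i + 1) (capOp d i φ) γ = φ γ := by
  have hw := h.weight_ne_zero (hγ i).1 (hγ i).2.1
  have e : ∀ y, weight d y * capOp d i φ (insertAt (i + 1) y γ) =
      if γ i = y then φ γ else 0 := by
    intro y
    rw [capOp_apply, insertAt_succ, insertAt_le (Nat.le_succ i)]
    split_ifs with hy
    · rw [← hy, deleteAt_insertAt_left, mul_inv_cancel_left₀ hw]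
    · rw [mul_zero]
  rw [cupOp_apply, e, e]
  rcases (hγ i).2.2 with hi | hi
  · rw [if_neg (by omega), if_pos (by omega), zero_add]
  · rw [if_pos (by omega), if_neg (by omega), add_zero]

theorem cupOp_cupOp {i j : ℕ} (hij : i ≤ j) (φ : (ℕ → ℤ) → ℂ) (γ : ℕ → ℤ) :
    cupOp d i (cupOp d (j + 2) φ) γ = cupOp d j (cupOp d i φ) γ := by
  simp only [cupOp_apply, insertAt_ge hij, insertAt_le hij, insertAt_insertAt hij]
  ring

theorem capOp_capOp {i j : ℕ} (hij : i ≤ j) (φ : (ℕ → ℤ) → ℂ) (γ : ℕ → ℤ) :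
    capOp d (j + 2) (capOp d i φ) γ = capOp d i (capOp d j φ) γ := by
  simp only [capOp_apply]
  by_cases hγ : γ i = γ (i + 2)
  · rw [deleteAt_ge hij hγ, deleteAt_ge (hij.trans (Nat.le_add_right j 2)) hγ,
      deleteAt_le (by omega : i ≤ j + 2), deleteAt_deleteAt hij]
    by_cases hj : γ (j + 2) = γ (j + 2 + 2)
    · have : deleteAt (j + 2) γ (i + 2) = γ (i + 2) := deleteAt_le (by omega) γ
      rw [if_pos hj, if_pos (by rw [this, hγ]), if_pos hγ, if_pos hj]
      ring
    · rw [if_neg hj, if_neg hj, mul_zero, ite_self]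
  · have e : deleteAt (j + 2) γ (i + 2) = γ (i + 2) := deleteAt_le (by omega) γ
    rw [if_neg hγ, deleteAt_le (by omega : i ≤ j + 2), e, if_neg hγ, mul_zero, ite_self]

theorem cupOp_capOp_ge {i j : ℕ} (hij : i ≤ j) (φ : (ℕ → ℤ) → ℂ) (γ : ℕ → ℤ) :
    cupOp d i (capOp d (j + 2) φ) γ = capOp d j (cupOp d i φ) γ := by
  simp only [cupOp_apply, capOp_apply, insertAt_ge hij,
    insertAt_ge (hij.trans (Nat.le_add_right j 2)), deleteAt_insertAt hij, deleteAt_le hij]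
  split_ifs <;> ring

theorem cupOp_capOp_le {i j : ℕ} (hij : i ≤ j) (φ : (ℕ → ℤ) → ℂ) (γ : ℕ → ℤ) :
    cupOp d (j + 2) (capOp d i φ) γ = capOp d i (cupOp d j φ) γ := by
  by_cases hγ : γ i = γ (i + 2)
  · simp only [cupOp_apply, capOp_apply, insertAt_le (by omega : i ≤ j + 2),
      insertAt_le (by omega : i + 2 ≤ j + 2), if_pos hγ, deleteAt_ge hij hγ,
      deleteAt_insertAt' hij _ hγ]
    ring
  · simp only [cupOp_apply, capOp_apply, insertAt_le (by omega : i ≤ j + 2),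
      insertAt_le (by omega : i + 2 ≤ j + 2), if_neg hγ, mul_zero, add_zero]

/-- The action of a local minimum on functions of walks between `0` and `k`. -/
noncomputable def walkCup (h : IsLevel d r k) (i : ℕ) :
    Module.End ℂ (((ℕ → ℤ) → ℂ) ⧸ vanishing k) :=
  (vanishing k).mapQ (vanishing k) (cupOp d i) fun _ => h.cupOp_mem i

/-- The action of a local maximum on functions of walks between `0` and `k`. -/
noncomputable def walkCap (_ : IsLevel d r k) (i : ℕ) :
    Module.End ℂ (((ℕ → ℤ) → ℂ) ⧸ vanishing k) :=
  (vanishing k).mapQ (vanishing k) (capOp d i) fun _ => capOp_mem i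

theorem walkEnd_ext {S T : Module.End ℂ (((ℕ → ℤ) → ℂ) ⧸ vanishing k)}
    (hST : ∀ φ, S (Submodule.Quotient.mk φ) = T (Submodule.Quotient.mk φ)) : S = T := by
  refine LinearMap.ext fun x => ?_
  obtain ⟨φ, rfl⟩ := Submodule.Quotient.mk_surjective _ x
  exact hST φ

theorem walk_mk_eq {φ ψ : (ℕ → ℤ) → ℂ} (h : ∀ γ, IsWalk k γ → φ γ = ψ γ) :
    (Submodule.Quotient.mk φ : ((ℕ → ℤ) → ℂ) ⧸ vanishing k) = Submodule.Quotient.mk ψ :=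
  (Submodule.Quotient.eq _).2 fun γ hγ => sub_eq_zero.2 (h γ hγ)

section WalkRelations

variable (h : IsLevel d r k)

theorem walkCup_mul_walkCap_self (i : ℕ) : walkCup h i * walkCap h i = d • 1 :=
  walkEnd_ext fun φ => walk_mk_eq (ψ := d • φ) fun _ hγ => h.cupOp_capOp_self i φ hγ

theorem walkCup_mul_walkCap_succ (i : ℕ) : walkCup h i * walkCap h (i + 1) = 1 :=
  walkEnd_ext fun φ => walk_mk_eq fun _ hγ => h.cupOp_capOp_succ i φ hγ

theorem walkCup_succ_mul_walkCap (i : ℕ) : walkCup h (i + 1) * walkCap h i = 1 :=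
  walkEnd_ext fun φ => walk_mk_eq fun _ hγ => h.cupOp_succ_capOp i φ hγ

theorem walkCup_mul_walkCup {i j : ℕ} (hij : i ≤ j) :
    walkCup h i * walkCup h (j + 2) = walkCup h j * walkCup h i :=
  walkEnd_ext fun φ => walk_mk_eq fun γ _ => cupOp_cupOp hij φ γ

theorem walkCap_mul_walkCap {i j : ℕ} (hij : i ≤ j) :
    walkCap h (j + 2) * walkCap h i = walkCap h i * walkCap h j :=
  walkEnd_ext fun φ => walk_mk_eq fun γ _ => capOp_capOp hij φ γ

theorem walkCup_mul_walkCap_ge {i j : ℕ} (hij : i ≤ j) :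
    walkCup h i * walkCap h (j + 2) = walkCap h j * walkCup h i :=
  walkEnd_ext fun φ => walk_mk_eq fun γ _ => cupOp_capOp_ge hij φ γ

theorem walkCup_mul_walkCap_le {i j : ℕ} (hij : i ≤ j) :
    walkCup h (j + 2) * walkCap h i = walkCap h i * walkCup h j :=
  walkEnd_ext fun φ => walk_mk_eq fun γ _ => cupOp_capOp_le hij φ γ

end WalkRelations

theorem walk_relations (h : IsLevel d r k) (N : ℕ) :
    TLRelations d N fun i => walkCap h i * walkCup h i where
  mul_self i _ := by
    rw [mul_assoc, ← mul_assoc (walkCup h i), walkCup_mul_walkCap_self, smul_mul_assoc, one_mul,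
      mul_smul_comm]
  braid i _ := by
    rw [mul_assoc (walkCap h i), ← mul_assoc (walkCup h i), walkCup_mul_walkCap_succ, one_mul,
      mul_assoc, ← mul_assoc (walkCup h (i + 1)), walkCup_succ_mul_walkCap, one_mul]
  braid' i _ := by
    rw [mul_assoc (walkCap h (i + 1)), ← mul_assoc (walkCup h (i + 1)), walkCup_succ_mul_walkCap,
      one_mul, mul_assoc, ← mul_assoc (walkCup h i), walkCup_mul_walkCap_succ, one_mul]
  comm i j hij _ := by
    obtain ⟨j, rfl⟩ : ∃ l, j = l + 2 := ⟨j - 2, by omega⟩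
    have hij : i ≤ j := by omega
    calc walkCap h i * walkCup h i * (walkCap h (j + 2) * walkCup h (j + 2))
        = walkCap h i * (walkCup h i * walkCap h (j + 2)) * walkCup h (j + 2) := by
          simp only [mul_assoc]
      _ = walkCap h i * walkCap h j * (walkCup h i * walkCup h (j + 2)) := by
          rw [walkCup_mul_walkCap_ge h hij]; simp only [mul_assoc]
      _ = walkCap h (j + 2) * (walkCap h i * walkCup h j) * walkCup h i := by
          rw [walkCup_mul_walkCup h hij, ← walkCap_mul_walkCap h hij]; simp only [mul_assoc]
      _ = walkCap h (j + 2) * walkCup h (j + 2) * (walkCap h i * walkCup h i) := by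
          rw [← walkCup_mul_walkCap_le h hij]; simp only [mul_assoc]

theorem walkOp_cup (h : IsLevel d r k) (n i : ℕ) (hi : i ≤ n) :
    walkOp h (cup n i hi) = walkCup h i :=
  walkEnd_ext fun φ => congrArg (fun T : Module.End ℂ _ => Submodule.Quotient.mk (T φ))
    (formalOp_pic (d := d) (.cup i hi rfl .strands))

theorem walkOp_cap (h : IsLevel d r k) (n i : ℕ) (hi : i ≤ n) :
    walkOp h (cap n i hi) = walkCap h i :=
  walkEnd_ext fun φ => congrArg (fun T : Module.End ℂ _ => Submodule.Quotient.mk (T φ))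
    (formalOp_pic (d := d) (.cap i hi rfl .strands))

theorem walkOp_jonesWenzl (h : IsLevel d r k) : ∀ n,
    walkOp h (jonesWenzl d n) = ringJW d (fun i => walkCap h i * walkCup h i) n
  | 0 => walkOp_id h 0
  | 1 => walkOp_id h 1
  | n + 2 => by
    have e : ∀ f g : fpt (n + 2) ⟶ fpt (n + 2), ∀ c : ℂ,
        walkOp h (f - c • g) = walkOp h f - c • walkOp h g := by
      intro f g c
      rw [eq_sub_iff_add_eq, ← walkOp_smul, ← walkOp_add, sub_add_cancel]
    rw [jonesWenzl, e, walkOp_comp, walkOp_comp, walkOp_comp, walkOp_fRight,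
      walkOp_jonesWenzl h (n + 1), walkOp_cup, walkOp_cap, ringJW]
    simp only [mul_assoc]

/-! ### The vanishing of the last projector in the path model -/

/-- A walk without local minima in the interior of its first `n` steps goes up and then down, so
that it reaches the height `(δ 0 + δ n + n) / 2`. The second part of the claim, which serves the
induction, says that a walk of this kind whose last step goes up only goes up. -/
theorem exists_peak {δ : ℕ → ℤ} (hδ : ∀ j, δ (j + 1) = δ j + 1 ∨ δ (j + 1) = δ j - 1) (n : ℕ)
    (hmin : ∀ i, i + 2 ≤ n → ¬ (δ i = δ (i + 2) ∧ δ (i + 1) = δ i - 1)) :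
    (∃ m, 2 * δ m ≥ δ 0 + δ n + n) ∧
      (∀ m, n = m + 1 → δ (m + 1) = δ m + 1 → δ (m + 1) = δ 0 + (m + 1)) := by
  induction n with
  | zero => exact ⟨⟨0, by simp; omega⟩, fun m hm => by omega⟩
  | succ n ih =>
    obtain ⟨⟨m, hm⟩, ih⟩ := ih fun i hi => hmin i (by omega)
    have hup : δ (n + 1) = δ n + 1 → δ (n + 1) = δ 0 + (n + 1) := by
      intro hn
      cases n with
      | zero => simpa using hn
      | succ n =>
        have h₁ := hmin n (by omega)
        have h₂ := hδ n
        have h₃ := ih n rfl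
        rw [show n + 2 = n + 1 + 1 from rfl] at h₁
        push_cast at *
        omega
    refine ⟨?_, fun m hm => by obtain rfl : n = m := by omega
                               exact hup⟩
    rcases hδ n with hn | hn
    · exact ⟨n + 1, by have := hup hn; push_cast; omega⟩
    · exact ⟨m, by push_cast; omega⟩

theorem insertAt_deleteAt {i : ℕ} {γ : ℕ → ℤ} (hγ : γ i = γ (i + 2)) (y : ℤ) :
    insertAt i y (deleteAt i γ) = Function.update γ (i + 1) y := by
  funext l
  simp only [deleteAt, insertAt, Function.update_apply]
  by_cases hl : l = i + 2
  · subst hl; simp [hγ]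
  · split_ifs <;> first | rfl | omega | (congr 1; omega)

/-- If the local minima at interior points of the first `k + 1` steps act on `ψ` by zero, then a
walk with `ψ γ ≠ 0` can be changed by flips into one without interior local minima (`ε = 1`), or
without interior local maxima (`ε = -1`). -/
theorem IsLevel.exists_sorted_walk (h : IsLevel d r k) {ψ : (ℕ → ℤ) → ℂ}
    (hψ : ∀ i, i + 1 ≤ k → cupOp d i ψ ∈ vanishing k) {ε : ℤ} (hε : ε = 1 ∨ ε = -1) (N : ℕ) :
    ∀ γ, IsWalk k γ → ψ γ ≠ 0 → ∑ j ∈ Finset.range (k + 2), (k - ε * γ j) < N →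
      ∃ γ', IsWalk k γ' ∧ γ' 0 = γ 0 ∧ γ' (k + 1) = γ (k + 1) ∧
        ∀ i, i + 2 ≤ k + 1 → ¬ (ε * γ' i = ε * γ' (i + 2) ∧ ε * γ' (i + 1) = ε * γ' i - 1) := by
  induction N with
  | zero =>
    intro γ hγ _ hN
    refine absurd (Finset.sum_nonneg fun j _ => ?_) (not_le.2 hN)
    have := hγ j
    rcases hε with rfl | rfl <;> omega
  | succ N ih =>
    intro γ hγ hne hN
    by_cases hs : ∀ i, i + 2 ≤ k + 1 →
        ¬ (ε * γ i = ε * γ (i + 2) ∧ ε * γ (i + 1) = ε * γ i - 1)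
    · exact ⟨γ, hγ, rfl, rfl, hs⟩
    push Not at hs
    obtain ⟨i, hi, h₁, h₂⟩ := hs
    have hx : γ i = γ (i + 2) := by rcases hε with rfl | rfl <;> omega
    have hy : γ (i + 1) = γ i - ε := by rcases hε with rfl | rfl <;> omega
    have h₀ := hγ i
    have h₁ := hγ (i + 1)
    -- The local minimum with `i` strands to its left annihilates `ψ`; this is the value at the walk
    -- without the two steps around `i + 1`.
    have hflip : weight d (γ i + ε) * ψ (Function.update γ (i + 1) (γ i + ε)) +
        weight d (γ (i + 1)) * ψ γ = 0 := by
      have e := hψ i (by omega) _ (hγ.deleteAt hx)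
      rw [cupOp_apply, deleteAt_le le_rfl, insertAt_deleteAt hx, insertAt_deleteAt hx] at e
      have e' : Function.update γ (i + 1) (γ i - ε) = γ := by rw [← hy, Function.update_eq_self]
      rcases hε with rfl | rfl
      · rwa [e', ← hy] at e
      · rw [sub_neg_eq_add] at e' hy
        rwa [e', ← hy, add_comm] at e
    have hw := mul_ne_zero (h.weight_ne_zero h₁.1 h₁.2.1) hne
    have hw' : weight d (γ i + ε) * ψ (Function.update γ (i + 1) (γ i + ε)) ≠ 0 := by
      intro h0
      rw [h0, zero_add] at hflip
      exact hw hflip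
    have hrange : 0 ≤ γ i + ε ∧ γ i + ε ≤ k := by
      by_contra hcon
      refine left_ne_zero_of_mul hw' (h.weight_eq_zero ?_)
      rcases hε with rfl | rfl <;> omega
    have hwalk : IsWalk k (Function.update γ (i + 1) (γ i + ε)) := by
      rw [← insertAt_deleteAt hx]
      refine (hγ.deleteAt hx).insertAt i hrange.1 hrange.2 ?_
      rw [deleteAt_le le_rfl]
      rcases hε with rfl | rfl <;> omega
    -- The flip decreases the sum which bounds the number of the remaining flips.
    have hsum : ∑ j ∈ Finset.range (k + 2), (k - ε * Function.update γ (i + 1) (γ i + ε) j) =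
        ∑ j ∈ Finset.range (k + 2), (k - ε * γ j) - 2 := by
      have e : ∀ j, (k : ℤ) - ε * Function.update γ (i + 1) (γ i + ε) j =
          (k - ε * γ j) - if i + 1 = j then 2 else 0 := by
        intro j
        by_cases hj : i + 1 = j
        · subst hj
          rw [Function.update_self, if_pos rfl, hy]
          rcases hε with rfl | rfl <;> ring
        · rw [Function.update_of_ne (Ne.symm hj), if_neg hj, sub_zero]
      rw [Finset.sum_congr rfl fun j _ => e j, Finset.sum_sub_distrib, Finset.sum_ite_eq,
        if_pos (Finset.mem_range.2 (by omega))]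
    obtain ⟨γ', hγ', h0, hk, hs⟩ := ih _ hwalk (right_ne_zero_of_mul hw') (by rw [hsum]; omega)
    refine ⟨γ', hγ', ?_, ?_, hs⟩
    · rw [h0, Function.update_of_ne (by omega)]
    · rw [hk, Function.update_of_ne (by omega)]

/-- A function that is annihilated by the local minima at the interior points of the first `k + 1`
steps vanishes: from a walk with a nonzero value, flips lead to a walk without interior local minima
and to one without interior local maxima, and these do not both fit between `0` and `k`. -/
theorem IsLevel.mem_vanishing (h : IsLevel d r k) {ψ : (ℕ → ℤ) → ℂ}
    (hψ : ∀ i, i + 1 ≤ k → cupOp d i ψ ∈ vanishing k) : ψ ∈ vanishing k := by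
  intro γ hγ
  by_contra hne
  have key : ∀ ε : ℤ, ε = 1 ∨ ε = -1 →
      ∃ y : ℤ, 0 ≤ y ∧ y ≤ k ∧ 2 * (ε * y) ≥ ε * γ 0 + ε * γ (k + 1) + (k + 1) := by
    intro ε hε
    obtain ⟨γ', hγ', h0, hk, hs⟩ := h.exists_sorted_walk hψ hε
      (∑ j ∈ Finset.range (k + 2), (k - ε * γ j) + 1).toNat γ hγ hne (by omega)
    obtain ⟨⟨m, hm⟩, -⟩ := exists_peak (δ := fun j => ε * γ' j) (fun j => by
      have := hγ' j
      rcases hε with rfl | rfl <;> omega) (k + 1) hs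
    refine ⟨γ' m, (hγ' m).1, (hγ' m).2.1, ?_⟩
    simp only [h0, hk] at hm
    push_cast at hm
    exact hm
  -- The peak `y` of the first walk and the bottom `z` of the second satisfy `y - z ≥ k + 1`.
  obtain ⟨y, hy⟩ := key 1 (.inl rfl)
  obtain ⟨z, hz⟩ := key (-1) (.inr rfl)
  omega

theorem walkOp_jonesWenzl_last (h : IsLevel d r k) : walkOp h (jonesWenzl d (k + 1)) = 0 := by
  have hkill : ∀ i, i + 1 ≤ k → walkCup h i * walkOp h (jonesWenzl d (k + 1)) = 0 := by
    intro i hi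
    have := (((walk_relations h (k + 1)).ringJW_props (k + 1) le_rfl
      fun j hj => h.ne_zero j (by omega)).2 i (by omega)).1
    rw [← walkOp_jonesWenzl] at this
    have h' := congrArg (walkCup h i * ·) this
    simp only [mul_zero] at h'
    rw [← mul_assoc, ← mul_assoc, walkCup_mul_walkCap_self, smul_mul_assoc, one_mul,
      smul_mul_assoc] at h'
    exact (smul_eq_zero.1 h').resolve_left h.loop_ne_zero
  refine walkEnd_ext fun φ => (Submodule.Quotient.mk_eq_zero _).2 (h.mem_vanishing fun i hi => ?_)
  exact (Submodule.Quotient.mk_eq_zero _).1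
    (LinearMap.congr_fun (hkill i hi) (Submodule.Quotient.mk φ))

/-- The path model is a model of the Temperley–Lieb–Jones category. -/
theorem walkOp_eq_of_skeinRel (h : IsLevel d r k) {m n : ℕ} {f g : fpt m ⟶ fpt n}
    (hfg : SkeinRel d r f g) : walkOp h f = walkOp h g := by
  induction hfg with
  | of hl =>
    cases hl with
    | zigzag_right n i hi =>
      rw [walkOp_comp, walkOp_cup, walkOp_cap, walkOp_id, walkCup_mul_walkCap_succ]
    | zigzag_left n i hi =>
      rw [walkOp_comp, walkOp_cup, walkOp_cap, walkOp_id, walkCup_succ_mul_walkCap]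
    | cup_cup n i j hij hj =>
      simp only [walkOp_comp, walkOp_cup]
      exact walkCup_mul_walkCup h hij
    | cap_cap n i j hij hj =>
      simp only [walkOp_comp, walkOp_cap]
      exact walkCap_mul_walkCap h hij
    | cup_cap n i j hij hj =>
      simp only [walkOp_comp, walkOp_cap, walkOp_cup]
      exact walkCup_mul_walkCap_ge h hij
    | cap_cup n i j hij hj =>
      simp only [walkOp_comp, walkOp_cap, walkOp_cup]
      exact walkCup_mul_walkCap_le h hij
    | loop n i hi =>
      rw [walkOp_comp, walkOp_cup, walkOp_cap, walkOp_smul, walkOp_id, walkCup_mul_walkCap_self]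
    | projector =>
      have hr : r - 1 = k + 1 := by rw [h.eq]; rfl
      have h0 : ∀ n, walkOp h (0 : fpt n ⟶ fpt n) = 0 := fun n => by
        simpa using walkOp_smul h 0 (0 : fpt n ⟶ fpt n)
      rw [h0, hr, walkOp_jonesWenzl_last]
  | refl f => rfl
  | symm _ ih => exact ih.symm
  | trans _ _ ih₁ ih₂ => exact ih₁.trans ih₂
  | add _ _ ih₁ ih₂ => rw [walkOp_add, walkOp_add, ih₁, ih₂]
  | smul c _ ih => rw [walkOp_smul, walkOp_smul, ih]
  | comp_left f _ ih => rw [walkOp_comp, walkOp_comp, ih]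
  | comp_right g _ ih => rw [walkOp_comp, walkOp_comp, ih]
  | left a _ ih =>
    refine (walkOp_eq_iff h _ _).2 fun φ γ hγ => ?_
    rw [formalOp_fLeft, formalOp_fLeft]
    exact (walkOp_eq_iff h _ _).1 ih _ _ fun j => hγ (a + j)
  | right b _ ih => rw [walkOp_fRight, walkOp_fRight, ih]

/-! ### The projectors are not zero -/

/-- A walk between `0` and `k` that starts with the steps `0, 1, …, k`. -/
def risingWalk (k : ℕ) (j : ℕ) : ℤ := if j ≤ k then j else if (j - k) % 2 = 0 then k else k - 1

theorem isWalk_risingWalk (hk : 1 ≤ k) : IsWalk k (risingWalk k) := by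
  intro j
  simp only [risingWalk]
  split_ifs <;> omega

/-- The projectors `p_0, …, p_k` are not zero: `p_i` differs from the identity by terms that start
with a local maximum, and those act by zero at a walk that rises in its first `i` steps. -/
theorem proj_ne_zero (h : IsLevel d r k) {i : ℕ} (hi : i ≤ k) : proj d r i ≠ 0 := by
  intro h0
  have hmem := id_sub_proj_mem_capSpan (d := d) (r := r) i
  rw [h0, sub_zero] at hmem
  have key : ∀ f : pt d r i ⟶ pt d r i, f ∈ capSpan d r i i →
      ∀ g : fpt i ⟶ fpt i, mk g = f → ∀ φ, formalOp d g φ (risingWalk k) = 0 := by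
    have hcongr : ∀ g g' : fpt i ⟶ fpt i, (mk g : pt d r i ⟶ pt d r i) = mk g' → ∀ φ,
        formalOp d g φ (risingWalk k) = formalOp d g' φ (risingWalk k) := fun g g' hg φ =>
      (walkOp_eq_iff h _ _).1 (walkOp_eq_of_skeinRel h ((mk_eq_iff g g').1 hg)) φ _
        (isWalk_risingWalk h.one_le)
    intro f hf
    induction hf using Submodule.span_induction with
    | mem f hf =>
      rintro g rfl φ
      obtain ⟨i', j, hj, hi', x, hx⟩ := hf
      obtain ⟨x, rfl⟩ := mk_surjective x
      rw [← hcongr (pic (.cap j hj hi' .strands) ≫ x) g hx, formalOp_comp, formalOp_pic]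
      refine if_neg ?_
      rw [risingWalk, risingWalk, if_pos (by omega), if_pos (by omega)]
      omega
    | zero => exact fun g hg φ => by rw [hcongr g 0 hg, map_zero]; rfl
    | add f f' _ _ ih ih' =>
      rintro g hg φ
      obtain ⟨f, rfl⟩ := mk_surjective f
      obtain ⟨f', rfl⟩ := mk_surjective f'
      rw [hcongr g (f + f') hg, map_add]
      exact (congrArg₂ (· + ·) (ih f rfl φ) (ih' f' rfl φ)).trans (add_zero 0)
    | smul c f _ ih =>
      rintro g hg φ
      obtain ⟨f, rfl⟩ := mk_surjective f
      rw [hcongr g (c • f) hg, map_smul]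
      exact (congrArg (c • ·) (ih f rfl φ)).trans (smul_zero c)
  have := key _ hmem (𝟙 _) rfl fun _ => 1
  rw [formalOp_id] at this
  exact one_ne_zero this

/-! ### The irreducible representations -/

/-- Functors from the Temperley–Lieb–Jones category to complex vector spaces; linearity and finite
dimensionality are imposed separately. -/
abbrev Rep (d : ℂ) (r : ℕ) : Type 1 := TLJ d r ⥤ ModuleCat.{0} ℂ

theorem IsRep.additive {ρ : Rep d r} (hρ : IsRep ρ) : ρ.Additive :=
  ⟨fun {_ _ f g} => hρ.map_add f g⟩

theorem IsRep.linear {ρ : Rep d r} (hρ : IsRep ρ) :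
    haveI := hρ.additive; ρ.Linear ℂ :=
  haveI := hρ.additive
  ⟨fun f c => hρ.map_smul c f⟩

theorem irrep_map_val {i : ℕ} {s t : TLJ d r} (g : s ⟶ t) (x : (irrep d r i).obj s) :
    ((irrep d r i).map g x : irrepSpace d r i t).1 = (x : irrepSpace d r i s).1 ≫ g := rfl

instance (i : ℕ) : (irrep d r i).Additive where
  map_add {s t f g} := by
    refine ModuleCat.hom_ext (LinearMap.ext fun x => Subtype.ext ?_)
    exact Preadditive.comp_add _ _ _ x.1 f g

instance (i : ℕ) : (irrep d r i).Linear ℂ where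
  map_smul {s t} f c := by
    refine ModuleCat.hom_ext (LinearMap.ext fun x => Subtype.ext ?_)
    exact Linear.comp_smul _ _ _ x.1 c f

/-- The projector `p_i`, as an element of `W_i`. -/
noncomputable def gen (d : ℂ) (r i : ℕ) : irrepSpace d r i (pt d r i) :=
  ⟨proj d r i, 𝟙 _, Category.comp_id (proj d r i)⟩

theorem proj_comp_of_mem (h : IsLevel d r k) {i : ℕ} (hi : i ≤ k) {t : TLJ d r}
    (x : irrepSpace d r i t) : proj d r i ≫ x.1 = x.1 := by
  obtain ⟨_, f, rfl⟩ := x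
  change proj d r i ≫ proj d r i ≫ f = proj d r i ≫ f
  rw [← Category.assoc, proj_comp_proj h (by omega)]

/-- The morphism of representations `W_i ⟶ ρ` given by acting on a vector. -/
noncomputable def vecHom {i : ℕ} (ρ : Rep d r) [ρ.Additive] [ρ.Linear ℂ] (v : ρ.obj (pt d r i)) :
    irrep d r i ⟶ ρ where
  app t := ModuleCat.ofHom
    { toFun := fun x : irrepSpace d r i t => ρ.map x.1 v
      map_add' := fun x y => by
        change ρ.map (x.1 + y.1) v = _
        rw [ρ.map_add]
        rfl
      map_smul' := fun c x => by
        change ρ.map (c • x.1) v = _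
        rw [ρ.map_smul]
        rfl }
  naturality s t g := by
    refine ModuleCat.hom_ext (LinearMap.ext fun x => ?_)
    change ρ.map ((x : irrepSpace d r i s).1 ≫ g) v = _
    rw [ρ.map_comp]
    rfl

theorem irrep_hom_apply (h : IsLevel d r k) {i : ℕ} (hi : i ≤ k) {ρ : Rep d r}
    (φ : irrep d r i ⟶ ρ) {t : TLJ d r} (x : irrepSpace d r i t) :
    φ.app t x = ρ.map x.1 (φ.app _ (gen d r i)) := by
  have e : (irrep d r i).map x.1 (gen d r i) = x := Subtype.ext (proj_comp_of_mem h hi x)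
  have := congrArg (fun u => u.hom (gen d r i)) (φ.naturality x.1)
  refine Eq.trans ?_ this
  exact congrArg (φ.app t) e.symm

/-- The Yoneda lemma: a morphism `W_i ⟶ ρ` is the same as a vector fixed by `p_i`. -/
noncomputable def yonedaEquiv (h : IsLevel d r k) {i : ℕ} (hi : i ≤ k) (ρ : Rep d r) [ρ.Additive]
    [ρ.Linear ℂ] : (irrep d r i ⟶ ρ) ≃ₗ[ℂ] LinearMap.range (ρ.map (proj d r i)).hom where
  toFun φ := ⟨φ.app _ (gen d r i), φ.app _ (gen d r i), (irrep_hom_apply h hi φ (gen d r i)).symm⟩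
  map_add' _ _ := rfl
  map_smul' _ _ := rfl
  invFun v := vecHom ρ v.1
  left_inv φ := by
    ext t x
    exact (irrep_hom_apply h hi φ x).symm
  right_inv v := by
    obtain ⟨_, v, rfl⟩ := v
    refine Subtype.ext ?_
    change ρ.map (proj d r i) (ρ.map (proj d r i) v) = ρ.map (proj d r i) v
    rw [← ModuleCat.comp_apply, ← ρ.map_comp, proj_comp_proj h (by omega)]

/-- A vector is determined by its images in the spaces `ρ(j) p_j`. -/
theorem eq_zero_of_forall_proj (h : IsLevel d r k) (ρ : Rep d r) [ρ.Additive] [ρ.Linear ℂ] {n : ℕ}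
    (v : ρ.obj (pt d r n))
    (hv : ∀ j ≤ k, ∀ a : pt d r n ⟶ pt d r j, ρ.map (a ≫ proj d r j) v = 0) : v = 0 := by
  have key : ∀ e ∈ projSpan d r k n n, ρ.map e v = 0 := by
    intro e he
    induction he using Submodule.span_induction with
    | mem e he =>
      obtain ⟨j, hj, x, y, rfl⟩ := he
      rw [← Category.assoc, ρ.map_comp, ModuleCat.comp_apply, hv j hj, map_zero]
    | zero => rw [ρ.map_zero]; rfl
    | add e e' _ _ ih ih' =>
      rw [ρ.map_add]
      exact (congrArg₂ (· + ·) ih ih').trans (add_zero 0)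
    | smul c e _ ih =>
      rw [ρ.map_smul]
      exact (congrArg (c • ·) ih).trans (smul_zero c)
  simpa using key _ (id_mem_projSpan h n)

/-- The spaces `ρ(j) p_j` generate the representation `ρ`. -/
theorem rep_hom_ext (h : IsLevel d r k) {ρ σ : Rep d r} [ρ.Additive] [ρ.Linear ℂ] {φ ψ : ρ ⟶ σ}
    (hφ : ∀ j ≤ k, ∀ v, φ.app _ (ρ.map (proj d r j) v) = ψ.app _ (ρ.map (proj d r j) v)) :
    φ = ψ := by
  refine NatTrans.ext (funext fun t => ModuleCat.hom_ext (LinearMap.ext fun v => ?_))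
  obtain ⟨n, rfl⟩ := exists_eq_pt t
  have key : ∀ e ∈ projSpan d r k n n, φ.app _ (ρ.map e v) = ψ.app _ (ρ.map e v) := by
    intro e he
    induction he using Submodule.span_induction with
    | mem e he =>
      obtain ⟨j, hj, x, y, rfl⟩ := he
      have nat : ∀ (χ : ρ ⟶ σ) (w : ρ.obj (pt d r j)),
          χ.app _ (ρ.map y w) = σ.map y (χ.app _ w) := fun χ w =>
        congrArg (fun u => u.hom w) (χ.naturality y)
      simp only [ρ.map_comp, ModuleCat.comp_apply]
      rw [nat, nat, hφ j hj]
    | zero =>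
      have : ρ.map (0 : pt d r n ⟶ pt d r n) v = 0 := by rw [ρ.map_zero]; rfl
      rw [this, map_zero, map_zero]
    | add e e' _ _ ih ih' =>
      have : ρ.map (e + e') v = ρ.map e v + ρ.map e' v := by rw [ρ.map_add]; rfl
      rw [this, map_add, map_add, ih, ih']
    | smul c e _ ih =>
      have : ρ.map (c • e) v = c • ρ.map e v := by rw [ρ.map_smul]; rfl
      rw [this, map_smul, map_smul, ih]
  simpa using key _ (id_mem_projSpan h n)

/-- `W_i(n)` is finite dimensional: the identity of `n` points is a combination of morphisms that
factor through some `p_j`, and composition with each of these has rank at most one on `W_i(n)`. -/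
theorem finite_irrepSpace (h : IsLevel d r k) {i : ℕ} (hi : i ≤ k) (t : TLJ d r) :
    FiniteDimensional ℂ (irrepSpace d r i t) := by
  obtain ⟨n, rfl⟩ := exists_eq_pt t
  have key : ∀ e ∈ projSpan d r k n n, ∃ F : Submodule ℂ (pt d r i ⟶ pt d r n),
      FiniteDimensional ℂ F ∧ ∀ x ∈ irrepSpace d r i (pt d r n), x ≫ e ∈ F := by
    intro e he
    induction he using Submodule.span_induction with
    | mem e he =>
      obtain ⟨j, hj, a, b, rfl⟩ := he
      refine ⟨ℂ ∙ (proj d r i ≫ (if hij : i = j then eqToHom (by rw [hij]) else 0) ≫ b),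
        inferInstance, ?_⟩
      rintro _ ⟨f, rfl⟩
      change (proj d r i ≫ f) ≫ a ≫ proj d r j ≫ b ∈ _
      have e : (proj d r i ≫ f) ≫ a ≫ proj d r j ≫ b =
          (proj d r i ≫ (f ≫ a) ≫ proj d r j) ≫ b := by simp only [Category.assoc]
      rw [e]
      by_cases hij : i = j
      · subst hij
        obtain ⟨c, hc⟩ := exists_smul_proj h (by omega : i ≤ k + 1) (f ≫ a)
        rw [hc, Linear.smul_comp, dif_pos rfl, eqToHom_refl, Category.id_comp]
        exact Submodule.smul_mem _ c (Submodule.mem_span_singleton_self _)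
      · rw [proj_comp_comp_proj h (by omega) (by omega) hij, Limits.zero_comp]
        exact zero_mem _
    | zero => exact ⟨⊥, inferInstance, fun x _ => by rw [Limits.comp_zero]; exact zero_mem _⟩
    | add e e' _ _ ih ih' =>
      obtain ⟨F, hF, hx⟩ := ih
      obtain ⟨F', hF', hx'⟩ := ih'
      refine ⟨F ⊔ F', inferInstance, fun x hxm => ?_⟩
      rw [Preadditive.comp_add]
      exact Submodule.add_mem_sup (hx x hxm) (hx' x hxm)
    | smul c e _ ih =>
      obtain ⟨F, hF, hx⟩ := ih
      refine ⟨F, hF, fun x hxm => ?_⟩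
      rw [Linear.comp_smul]
      exact F.smul_mem c (hx x hxm)
  obtain ⟨F, hF, hx⟩ := key _ (id_mem_projSpan h n)
  exact Submodule.finiteDimensional_of_le fun x hxm => by simpa using hx x hxm

theorem isRep_irrep (h : IsLevel d r k) {i : ℕ} (hi : i ≤ k) : IsRep (irrep d r i) where
  map_add _ _ := (irrep d r i).map_add
  map_smul c f := (irrep d r i).map_smul (R := ℂ) c f
  finite t := finite_irrepSpace h hi t

theorem gen_ne_zero (h : IsLevel d r k) {i : ℕ} (hi : i ≤ k) : gen d r i ≠ 0 :=
  fun h0 => proj_ne_zero h hi (congrArg Subtype.val h0)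

theorem irrep_not_isZero (h : IsLevel d r k) {i : ℕ} (hi : i ≤ k) : ¬ IsZero (irrep d r i) := by
  intro h0
  have := (h0.eq_of_src (𝟙 (irrep d r i)) 0)
  have := congrArg (fun φ => φ.app (pt d r i) (gen d r i)) this
  exact gen_ne_zero h hi this

/-- By the Yoneda lemma, `Hom(W_i, W_j)` is the space of the morphisms `p_j ≫ f ≫ p_i`. -/
theorem irrep_hom_eq_zero (h : IsLevel d r k) {i j : ℕ} (hi : i ≤ k) (hj : j ≤ k) (hij : i ≠ j)
    (φ : irrep d r i ⟶ irrep d r j) : φ = 0 := by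
  refine (yonedaEquiv h hi (irrep d r j)).injective ?_
  rw [map_zero]
  generalize yonedaEquiv h hi (irrep d r j) φ = x
  obtain ⟨_, ⟨_, f, rfl⟩, rfl⟩ := x
  refine Subtype.ext (Subtype.ext ?_)
  change (proj d r j ≫ f) ≫ proj d r i = 0
  rw [Category.assoc, proj_comp_comp_proj h (by omega) (by omega) hij.symm]

theorem eq_of_iso (h : IsLevel d r k) {i j : ℕ} (hi : i ≤ k) (hj : j ≤ k)
    (e : irrep d r i ≅ irrep d r j) : i = j := by
  by_contra hij
  refine irrep_not_isZero h hi ((IsZero.iff_id_eq_zero _).2 ?_)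
  rw [← e.hom_inv_id, irrep_hom_eq_zero h hi hj hij e.hom, Limits.zero_comp]

/-- A nonzero vector of an invariant family of subspaces of `W_i` yields, by a further diagram, a
nonzero multiple of `p_i`, which generates `W_i`. -/
theorem simple_irrep (h : IsLevel d r k) {i : ℕ} (hi : i ≤ k) : Simple (irrep d r i) where
  mono_isIso_iff_nonzero {σ} f _ := by
    constructor
    · rintro _ h0
      subst h0
      exact irrep_not_isZero h hi (IsZero.of_epi_eq_zero (0 : σ ⟶ _) rfl)
    · intro hf
      obtain ⟨n, z, hz⟩ : ∃ (n : ℕ) (z : σ.obj (pt d r n)), f.app _ z ≠ 0 := by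
        by_contra hcon
        push Not at hcon
        refine hf (NatTrans.ext (funext fun t => ModuleCat.hom_ext (LinearMap.ext fun z => ?_)))
        obtain ⟨n, rfl⟩ := exists_eq_pt t
        exact hcon n z
      obtain ⟨j, hj, a, ha⟩ : ∃ j ≤ k, ∃ a : pt d r n ⟶ pt d r j,
          (irrep d r i).map (a ≫ proj d r j) (f.app _ z) ≠ 0 := by
        by_contra hcon
        push Not at hcon
        exact hz (eq_zero_of_forall_proj h _ _ hcon)
      have hnat : f.app _ (σ.map (a ≫ proj d r j) z) =
          (irrep d r i).map (a ≫ proj d r j) (f.app _ z) :=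
        congrArg (fun u => u.hom z) (f.naturality (a ≫ proj d r j))
      generalize f.app _ z = x at ha hnat
      obtain ⟨_, g, rfl⟩ := x
      have hval : ∀ y : irrepSpace d r i (pt d r j), y =
          (irrep d r i).map (a ≫ proj d r j) (⟨_, g, rfl⟩ : irrepSpace d r i (pt d r n)) →
            y.1 = proj d r i ≫ (g ≫ a) ≫ proj d r j := by
        rintro _ rfl
        change (proj d r i ≫ g) ≫ a ≫ proj d r j = _
        simp only [Category.assoc]
      by_cases hij : i = j
      · subst hij
        obtain ⟨c, hc⟩ := exists_smul_proj h (by omega : i ≤ k + 1) (g ≫ a)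
        have hval' := (hval _ rfl).trans hc
        have hc0 : c ≠ 0 := by
          rintro rfl
          exact ha (Subtype.ext (hval'.trans (zero_smul ℂ _)))
        have hgen : f.app _ (c⁻¹ • σ.map (a ≫ proj d r i) z) = gen d r i := by
          rw [map_smul, hnat]
          refine Subtype.ext ?_
          change c⁻¹ • _ = proj d r i
          rw [hval', smul_smul, inv_mul_cancel₀ hc0, one_smul]
        have : Epi f := by
          refine ⟨fun {τ} u v huv => rep_hom_ext h fun j hj w => ?_⟩
          have e : ∀ y : irrepSpace d r i (pt d r j), u.app _ y = v.app _ y := by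
            intro y
            rw [irrep_hom_apply h hi u, irrep_hom_apply h hi v, ← hgen]
            have := congrArg (fun φ => φ.app (pt d r i) (c⁻¹ • σ.map (a ≫ proj d r i) z)) huv
            exact congrArg (τ.map y.1) this
          exact e _
        exact isIso_of_mono_of_epi f
      · refine absurd (Subtype.ext ((hval _ rfl).trans ?_)) ha
        exact proj_comp_comp_proj h (by omega) (by omega) hij _

/-- Every representation is a direct sum of the `W_i`, with the dimension of `ρ(i) p_i` as the
multiplicity of `W_i`. -/
theorem exists_decomposition (h : IsLevel d r k) {ρ : Rep d r} (hρ : IsRep ρ) :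
    ∃ m : Fin (k + 1) → ℕ,
      Nonempty (ρ ≅ ⨁ fun x : (Σ i : Fin (k + 1), Fin (m i)) => irrep d r x.1) := by
  have := hρ.additive
  have := hρ.linear
  have hfin := hρ.finite
  let V : ∀ i : Fin (k + 1), Submodule ℂ (ρ.obj (pt d r i)) := fun i =>
    LinearMap.range (ρ.map (proj d r i)).hom
  let m : Fin (k + 1) → ℕ := fun i => Module.finrank ℂ (V i)
  let b : ∀ i, Module.Basis (Fin (m i)) ℂ (V i) := fun i => Module.finBasis ℂ (V i)
  have hb : ∀ (i : Fin (k + 1)) s, ρ.map (proj d r i) (b i s).1 = (b i s).1 := by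
    intro i s
    obtain ⟨v, hv⟩ := (b i s).2
    rw [← hv]
    change ρ.map (proj d r i) (ρ.map (proj d r i) v) = ρ.map (proj d r i) v
    rw [← ModuleCat.comp_apply, ← ρ.map_comp, proj_comp_proj h (by omega)]
  let φ : ∀ x : (Σ i : Fin (k + 1), Fin (m i)), irrep d r x.1 ⟶ ρ := fun x =>
    vecHom ρ (b x.1 x.2).1
  let Φ := biproduct.desc φ
  have hepi : Epi Φ := by
    refine ⟨fun {τ} u v huv => rep_hom_ext h fun j hj w => ?_⟩
    have e : (u.app (pt d r j)).hom ∘ₗ (V ⟨j, by omega⟩).subtype =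
        (v.app (pt d r j)).hom ∘ₗ (V ⟨j, by omega⟩).subtype := by
      refine (b ⟨j, by omega⟩).ext fun s => ?_
      have e₁ : φ ⟨⟨j, by omega⟩, s⟩ ≫ u = φ ⟨⟨j, by omega⟩, s⟩ ≫ v := by
        rw [← biproduct.ι_desc φ, Category.assoc, Category.assoc, huv]
      have e₂ := congrArg (fun χ => χ.app (pt d r j) (gen d r j)) e₁
      have e₃ : (φ ⟨⟨j, by omega⟩, s⟩).app (pt d r j) (gen d r j) = (b ⟨j, by omega⟩ s).1 :=
        hb ⟨j, by omega⟩ s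
      change u.app (pt d r j) ((φ ⟨⟨j, by omega⟩, s⟩).app (pt d r j) (gen d r j)) =
        v.app (pt d r j) ((φ ⟨⟨j, by omega⟩, s⟩).app (pt d r j) (gen d r j)) at e₂
      rw [e₃] at e₂
      exact e₂
    exact LinearMap.congr_fun e ⟨ρ.map (proj d r j) w, w, rfl⟩
  -- A vector of the kernel, composed with a diagram into `p_j`, becomes a linear relation between
  -- the basis vectors of `V j`.
  have hmono : Mono Φ := by
    refine Preadditive.mono_of_cancel_zero _ fun {σ} u hu => biproduct.hom_ext _ _ fun x => ?_
    rw [Limits.zero_comp]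
    have hsum : ∑ y, (u ≫ biproduct.π _ y) ≫ φ y = 0 := by
      rw [← biproduct.lift_desc, ← hu]
      congr 1
      exact biproduct.hom_ext _ _ fun y => by rw [biproduct.lift_π]
    refine NatTrans.ext (funext fun t => ModuleCat.hom_ext (LinearMap.ext fun z => ?_))
    obtain ⟨n, rfl⟩ := exists_eq_pt t
    let w : ∀ y : (Σ i : Fin (k + 1), Fin (m i)), irrepSpace d r y.1 (pt d r n) := fun y =>
      (u ≫ biproduct.π _ y).app (pt d r n) z
    have hw : ∑ y, ρ.map (w y).1 (b y.1 y.2).1 = 0 := by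
      have := congrArg (fun χ => (χ.app (pt d r n)).hom z) hsum
      simp only [NatTrans.app_sum, ModuleCat.hom_sum, LinearMap.sum_apply] at this
      exact this
    change w x = 0
    refine eq_zero_of_forall_proj h (irrep d r x.1) (w x) fun j hj a => Subtype.ext ?_
    change (w x).1 ≫ a ≫ proj d r j = 0
    have hne : ∀ y : (Σ i : Fin (k + 1), Fin (m i)), (y.1 : ℕ) ≠ j →
        (w y).1 ≫ a ≫ proj d r j = 0 := by
      intro y hy
      rw [← proj_comp_of_mem h (by omega) (w y), Category.assoc, ← Category.assoc (w y).1]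
      exact proj_comp_comp_proj h (by omega) (by omega) hy _
    by_cases hij : (x.1 : ℕ) = j
    · subst hij
      have hc : ∀ s, ∃ c : ℂ, (w ⟨x.1, s⟩).1 ≫ a ≫ proj d r x.1 = c • proj d r x.1 := by
        intro s
        obtain ⟨c, hc⟩ := exists_smul_proj h (by omega : (x.1 : ℕ) ≤ k + 1) ((w ⟨x.1, s⟩).1 ≫ a)
        refine ⟨c, ?_⟩
        rw [← hc, Category.assoc, ← Category.assoc (proj d r x.1),
          proj_comp_of_mem h (by omega : (x.1 : ℕ) ≤ k) (w ⟨x.1, s⟩)]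
      choose c hc using hc
      have h₁ : ∑ y, ρ.map ((w y).1 ≫ a ≫ proj d r x.1) (b y.1 y.2).1 = 0 := by
        have := congrArg (ρ.map (a ≫ proj d r x.1)) hw
        rw [map_sum, map_zero] at this
        rw [← this]
        exact Finset.sum_congr rfl fun y _ => by rw [ρ.map_comp, ModuleCat.comp_apply]
      rw [Fintype.sum_sigma, Finset.sum_eq_single x.1] at h₁
      · have h₂ : ∑ s, c s • b x.1 s = 0 := by
          refine Subtype.ext ?_
          rw [Submodule.coe_sum]
          refine Eq.trans ?_ h₁
          refine Finset.sum_congr rfl fun s _ => ?_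
          rw [hc, ρ.map_smul]
          exact (congrArg (c s • ·) (hb x.1 s)).symm
        have h₃ := hc x.2
        rw [Fintype.linearIndependent_iff.1 (b x.1).linearIndependent c h₂, zero_smul] at h₃
        exact h₃
      · intro i _ hi
        refine Finset.sum_eq_zero fun s _ => ?_
        rw [hne ⟨i, s⟩ fun e => hi (Fin.ext e), ρ.map_zero]
        rfl
      · exact fun hx => absurd (Finset.mem_univ _) hx
    · exact hne x hij
  have := isIso_of_mono_of_epi Φ
  exact ⟨m, ⟨(asIso Φ).symm⟩⟩

/-- One of the summands of the decomposition is nonzero, and its complement is then zero. -/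
theorem exists_iso_irrep (h : IsLevel d r k) {ρ : Rep d r} (hρ : IsRep ρ)
    (hind : Indecomposable ρ) : ∃ i : Fin (k + 1), Nonempty (ρ ≅ irrep d r i) := by
  obtain ⟨m, ⟨e⟩⟩ := exists_decomposition h hρ
  by_cases hx : IsEmpty (Σ i : Fin (k + 1), Fin (m i))
  · refine absurd ((IsZero.iff_id_eq_zero _).2 ?_) hind.1
    rw [← cancel_mono e.hom]
    exact biproduct.hom_ext _ _ fun x => hx.elim x
  · obtain ⟨x⟩ := not_isEmpty_iff.1 hx
    let f : irrep d r x.1 ⟶ ρ :=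
      biproduct.ι (fun y : (Σ i : Fin (k + 1), Fin (m i)) => irrep d r y.1) x ≫ e.inv
    have hf : IsSplitMono f := ⟨⟨⟨e.hom ≫ biproduct.π _ x, by simp [f]⟩⟩⟩
    have hb := isBilimitBinaryBiconeOfIsSplitMonoOfCokernel (cokernelIsCokernel f)
    rcases hind.2 _ _ (biprod.uniqueUpToIso _ _ hb) with h0 | h0
    · exact absurd h0 (irrep_not_isZero h (by omega))
    · have : Epi f := Preadditive.epi_of_isZero_cokernel f h0
      have := isIso_of_mono_of_epi f
      exact ⟨x.1, ⟨(asIso f).symm⟩⟩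

/-! ### Nested local minima and maxima -/

/-- `m` nested local minima, with `s` strands to their left. -/
noncomputable def cups (s : ℕ) : (m : ℕ) → {n n' : ℕ} → s ≤ n → n' = n + 2 * m →
    (pt d r n ⟶ pt d r n')
  | 0, _, _, _, hn => eqToHom (congrArg (pt d r) (by omega))
  | m + 1, n, _, hs, hn =>
    cups s m (n' := n + 2 * m) hs rfl ≫ cupM (s + m) (by omega) (by omega)

/-- `m` nested local maxima, with `s` strands to their left. -/
noncomputable def caps (s : ℕ) : (m : ℕ) → {n n' : ℕ} → s ≤ n' → n = n' + 2 * m →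
    (pt d r n ⟶ pt d r n')
  | 0, _, _, _, hn => eqToHom (congrArg (pt d r) (by omega))
  | m + 1, _, n', hs, hn =>
    capM (n' := n' + 2 * m) (s + m) (by omega) (by omega) ≫ caps s m hs rfl

section Nested

variable {n n₁ n₁' n₂ : ℕ}

theorem cupM_congr {i j : ℕ} (hij : i = j) (hi : i ≤ n) (hn : n₁ = n + 2) :
    (cupM i hi hn : pt d r n ⟶ pt d r n₁) = cupM j (by omega) hn := by
  subst hij
  rfl

theorem capM_congr {i j : ℕ} (hij : i = j) (hi : i ≤ n) (hn : n₁ = n + 2) :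
    (capM i hi hn : pt d r n₁ ⟶ pt d r n) = capM j (by omega) hn := by
  subst hij
  rfl

theorem cups_zero {s : ℕ} (hs : s ≤ n) : (cups s 0 hs rfl : pt d r n ⟶ pt d r n) = 𝟙 _ := rfl

theorem caps_zero {s : ℕ} (hs : s ≤ n) : (caps s 0 hs rfl : pt d r n ⟶ pt d r n) = 𝟙 _ := rfl

theorem cups_succ {s m : ℕ} (hs : s ≤ n) (hn₁ : n₁ = n + 2 * m) (hn₂ : n₂ = n + 2 * (m + 1)) :
    (cups s (m + 1) hs hn₂ : pt d r n ⟶ pt d r n₂) =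
      (cups s m hs hn₁ : pt d r n ⟶ pt d r n₁) ≫ cupM (s + m) (by omega) (by omega) := by
  subst hn₁
  rfl

theorem caps_succ {s m : ℕ} (hs : s ≤ n) (hn₁ : n₁ = n + 2 * m) (hn₂ : n₂ = n + 2 * (m + 1)) :
    (caps s (m + 1) hs hn₂ : pt d r n₂ ⟶ pt d r n) =
      capM (s + m) (by omega) (by omega) ≫ (caps s m hs hn₁ : pt d r n₁ ⟶ pt d r n) := by
  subst hn₁
  rfl

theorem addLeft_cups (a : ℕ) {s m : ℕ} (hs : s ≤ n) (hn₁ : n₁ = n + 2 * m) :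
    addLeft a (cups s m hs hn₁ : pt d r n ⟶ pt d r n₁) = cups (a + s) m (by omega) (by omega) := by
  induction m generalizing n₁ with
  | zero =>
    obtain rfl : n₁ = n := by omega
    exact addLeft_id a n₁
  | succ m ih =>
    rw [cups_succ hs rfl hn₁, addLeft_comp, ih rfl, addLeft_cupM,
      cups_succ (n := a + n) (n₁ := a + (n + 2 * m)) (by omega) (by omega),
      cupM_congr (Nat.add_assoc a s m)]

theorem addLeft_caps (a : ℕ) {s m : ℕ} (hs : s ≤ n) (hn₁ : n₁ = n + 2 * m) :
    addLeft a (caps s m hs hn₁ : pt d r n₁ ⟶ pt d r n) = caps (a + s) m (by omega) (by omega) := by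
  induction m generalizing n₁ with
  | zero =>
    obtain rfl : n₁ = n := by omega
    exact addLeft_id a n₁
  | succ m ih =>
    rw [caps_succ hs rfl hn₁, addLeft_comp, ih rfl, addLeft_capM,
      caps_succ (n := a + n) (n₁ := a + (n + 2 * m)) (by omega) (by omega),
      capM_congr (Nat.add_assoc a s m)]

/-- A local maximum which joins the outermost of `m + 1` nested local minima to the strand on its
left straightens it; the other `m` remain. -/
theorem cups_comp_capM {s m : ℕ} (hs : s + 1 ≤ n) (hn₁ : n₁ = n + 2 * m) (hn₂ : n₂ = n₁ + 2) :
    (cups (s + 1) (m + 1) hs (by omega) : pt d r n ⟶ pt d r n₂) ≫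
        (capM s (by omega) hn₂ : _ ⟶ pt d r n₁) = cups s m (by omega) hn₁ := by
  induction m generalizing n₁ n₂ with
  | zero =>
    obtain rfl : n = n₁ := by omega
    rw [cups_succ hs rfl, cups_zero, Category.id_comp]
    exact zigzag (.inr rfl) _ _ _
  | succ m ih =>
    rw [cups_succ (m := m + 1) hs hn₁, Category.assoc,
      cupM_capM' (n := n + 2 * m) (i := s) (j := s + m) (n₁' := n₁) (by omega) (by omega) (by omega)
        (by omega) (by omega) (by omega), ← Category.assoc, ih rfl (by omega),
      ← cups_succ]

theorem cupM_comp_caps {t m : ℕ} (ht : t + 1 ≤ n) (hn₁ : n₁ = n + 2 * m) (hn₂ : n₂ = n₁ + 2) :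
    (cupM t (by omega) hn₂ : pt d r n₁ ⟶ pt d r n₂) ≫
        (caps (t + 1) (m + 1) ht (by omega) : _ ⟶ pt d r n) = caps t m (by omega) hn₁ := by
  induction m generalizing n₁ n₂ with
  | zero =>
    obtain rfl : n = n₁ := by omega
    rw [caps_succ ht rfl, caps_zero, Category.comp_id]
    exact zigzag (.inl rfl) _ _ _
  | succ m ih =>
    rw [caps_succ (m := m + 1) ht hn₁, ← Category.assoc,
      cupM_capM (n := n + 2 * m) (i := t) (j := t + m) (n₁' := n₁) (by omega) (by omega) (by omega)
        (by omega) (by omega) (by omega), Category.assoc, ih rfl (by omega),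
      ← caps_succ]

/-- The zigzag of `m` parallel strands can be straightened. -/
theorem cups_comp_caps {m : ℕ} (hm : m ≤ n) (hn₁ : n₁ = n + 2 * m) :
    (cups m m hm hn₁ : pt d r n ⟶ pt d r n₁) ≫ caps 0 m (Nat.zero_le _) hn₁ = 𝟙 _ := by
  induction m generalizing n₁ with
  | zero =>
    obtain rfl : n = n₁ := by omega
    exact Category.comp_id _
  | succ m ih =>
    rw [caps_succ (s := 0) (Nat.zero_le _) rfl hn₁, ← Category.assoc]
    have := cups_comp_capM (d := d) (r := r) hm rfl (n₂ := n₁) (by omega)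
    simp only [zero_add]
    rw [this, ih (by omega)]

theorem cups_comp_caps' {m : ℕ} (hm : m ≤ n) (hn₁ : n₁ = n + 2 * m) :
    (cups 0 m (Nat.zero_le _) hn₁ : pt d r n ⟶ pt d r n₁) ≫ caps m m hm hn₁ = 𝟙 _ := by
  induction m generalizing n₁ with
  | zero =>
    obtain rfl : n = n₁ := by omega
    exact Category.comp_id _
  | succ m ih =>
    rw [cups_succ (s := 0) (Nat.zero_le _) rfl hn₁, Category.assoc]
    have := cupM_comp_caps (d := d) (r := r) hm rfl (n₂ := n₁) (by omega)
    simp only [zero_add]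
    rw [this, ih (by omega)]

/-- Nested local minima exchange heights with a local minimum to the right of them. -/
theorem cups_comp_cupM {m j l : ℕ} (hj : j ≤ n) (hl : l = 2 * m + j) (hn₁ : n₁ = n + 2 * m)
    (hn₂ : n₂ = n₁ + 2) (hn₁' : n₁' = n + 2) :
    (cups 0 m (Nat.zero_le _) hn₁ : pt d r n ⟶ pt d r n₁) ≫ cupM l (by omega) hn₂ =
      (cupM j hj hn₁' : _ ⟶ pt d r n₁') ≫ cups 0 m (Nat.zero_le _) (by omega) := by
  induction m generalizing n₁ n₂ l with
  | zero =>
    obtain rfl : n = n₁ := by omega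
    obtain rfl : n₂ = n₁' := by omega
    obtain rfl : l = j := by omega
    exact (Category.id_comp _).trans (Category.comp_id _).symm
  | succ m ih =>
    rw [cups_succ (Nat.zero_le _) rfl hn₁, Category.assoc,
      cupM_cupM (n := n + 2 * m) (i := 0 + m) (j := 2 * m + j) (n₁' := n + 2 * m + 2) (by omega)
        (by omega) (by omega) (by omega) (by omega) (by omega), ← Category.assoc,
      ih rfl rfl rfl, Category.assoc, ← cups_succ]

/-- Nested local minima exchange heights with a local maximum to the right of them. -/
theorem cups_comp_capM_ge {m j l : ℕ} (hj : j ≤ n) (hl : l = 2 * m + j) (hn₁ : n₁ = n + 2 * m)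
    (hn₂ : n₂ = n₁ + 2) (hn₁' : n₁' = n + 2) :
    (cups 0 m (Nat.zero_le _) (by omega) : pt d r n₁' ⟶ pt d r n₂) ≫
        (capM l (by omega) hn₂ : _ ⟶ pt d r n₁) =
      capM j hj hn₁' ≫ cups 0 m (Nat.zero_le _) hn₁ := by
  induction m generalizing n₁ n₂ l with
  | zero =>
    obtain rfl : n = n₁ := by omega
    obtain rfl : n₂ = n₁' := by omega
    obtain rfl : l = j := by omega
    exact (Category.id_comp _).trans (Category.comp_id _).symm
  | succ m ih =>
    rw [cups_succ (n := n₁') (n₁ := n + 2 * m + 2) (Nat.zero_le _) (by omega), Category.assoc,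
      cupM_capM (n := n + 2 * m) (i := 0 + m) (j := 2 * m + j) (n₁' := n₁) (by omega)
        (by omega) (by omega) (by omega) (by omega) (by omega), ← Category.assoc,
      ih rfl rfl rfl, Category.assoc, ← cups_succ]

theorem cupM_comp_caps_ge {m j l : ℕ} (hj : j ≤ n) (hl : l = 2 * m + j) (hn₁ : n₁ = n + 2 * m)
    (hn₂ : n₂ = n₁ + 2) (hn₁' : n₁' = n + 2) :
    (cupM l (by omega) hn₂ : pt d r n₁ ⟶ pt d r n₂) ≫
        (caps 0 m (Nat.zero_le _) (by omega) : _ ⟶ pt d r n₁') =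
      caps 0 m (Nat.zero_le _) hn₁ ≫ cupM j hj hn₁' := by
  induction m generalizing n₁ n₂ l with
  | zero =>
    obtain rfl : n = n₁ := by omega
    obtain rfl : n₂ = n₁' := by omega
    obtain rfl : l = j := by omega
    exact (Category.comp_id _).trans (Category.id_comp _).symm
  | succ m ih =>
    rw [caps_succ (n := n₁') (n₁ := n + 2 * m + 2) (Nat.zero_le _) (by omega), ← Category.assoc,
      cupM_capM' (n := n + 2 * m) (i := 0 + m) (j := 2 * m + j) (n₁ := n₁) (by omega)
        (by omega) (by omega) (by omega) (by omega) (by omega), Category.assoc,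
      ih rfl rfl rfl, ← Category.assoc, ← caps_succ]

theorem capM_comp_caps_ge {m j l : ℕ} (hj : j ≤ n) (hl : l = 2 * m + j) (hn₁ : n₁ = n + 2 * m)
    (hn₂ : n₂ = n₁ + 2) (hn₁' : n₁' = n + 2) :
    (capM l (by omega) hn₂ : pt d r n₂ ⟶ pt d r n₁) ≫ caps 0 m (Nat.zero_le _) hn₁ =
      (caps 0 m (Nat.zero_le _) (by omega) : _ ⟶ pt d r n₁') ≫ capM j hj hn₁' := by
  induction m generalizing n₁ n₂ l with
  | zero =>
    obtain rfl : n = n₁ := by omega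
    obtain rfl : n₂ = n₁' := by omega
    obtain rfl : l = j := by omega
    exact (Category.comp_id _).trans (Category.id_comp _).symm
  | succ m ih =>
    rw [caps_succ (Nat.zero_le _) rfl hn₁, ← Category.assoc,
      capM_capM (n := n + 2 * m) (i := 0 + m) (j := 2 * m + j) (n₁' := n + 2 * m + 2) (by omega)
        (by omega) (by omega) (by omega) (by omega) (by omega), Category.assoc,
      ih rfl rfl rfl, ← Category.assoc, ← caps_succ]

/-- A local maximum on the left half of a family of nested local minima can be moved to the right
half. -/
theorem cups_comp_capM_left {m j l : ℕ} (hl : l + j = 2 * m) (hj : j ≤ m) (hn₁ : n₁ = n + 2 * m)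
    (hn₂ : n₂ = n₁ + 2) (hn₁' : n₁' = n₂ + 2) :
    (cups 0 (m + 2) (Nat.zero_le _) (by omega) : pt d r n ⟶ pt d r n₁') ≫
        (capM j (by omega) hn₁' : _ ⟶ pt d r n₂) =
      (cups 0 m (Nat.zero_le _) hn₁ : _ ⟶ pt d r n₁) ≫ cupM l (by omega) hn₂ := by
  induction m generalizing n₁ n₂ n₁' l with
  | zero =>
    obtain rfl : j = 0 := by omega
    obtain rfl : l = 0 := by omega
    rw [cups_succ (m := 1) (n₁ := n₂) (Nat.zero_le _) (by omega), Category.assoc,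
      zigzag (by omega), Category.comp_id, cups_succ (Nat.zero_le _) hn₁]
  | succ m ih =>
    rw [cups_succ (m := m + 2) (n₁ := n₂) (Nat.zero_le _) (by omega), Category.assoc]
    rcases hj.eq_or_lt with rfl | hj
    · rw [zigzag (by omega), Category.comp_id, cups_succ (Nat.zero_le _) hn₁]
      obtain rfl : l = 0 + (m + 1) := by omega
      rfl
    · rw [cupM_capM' (n := n₁) (i := j) (j := 0 + m) (by omega) (by omega) (by omega)
        hn₂ hn₂ (by omega), ← Category.assoc,
        ih (l := l - 2) (n₁ := n + 2 * m) (by omega) (by omega) rfl (by omega), Category.assoc,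
        ← cupM_cupM (n := n + 2 * m) (i := 0 + m) (j := l - 2) (j' := l) (n₁ := n₁) (by omega)
          (by omega) (by omega) (by omega) (by omega) (by omega), ← Category.assoc, ← cups_succ]

/-- A local maximum on the right half of a family of nested local minima can be moved to the left
half. -/
theorem cups_comp_capM_right {m j l : ℕ} (hl : l + j = 2 * m + 2) (hj : m + 2 ≤ j)
    (hj' : j ≤ 2 * m + 2) (hn₁ : n₁ = n + 2 * m) (hn₂ : n₂ = n₁ + 2) (hn₁' : n₁' = n₂ + 2) :
    (cups 0 (m + 2) (Nat.zero_le _) (by omega) : pt d r n ⟶ pt d r n₁') ≫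
        (capM j (by omega) hn₁' : _ ⟶ pt d r n₂) =
      (cups 0 m (Nat.zero_le _) hn₁ : _ ⟶ pt d r n₁) ≫ cupM l (by omega) hn₂ := by
  induction m generalizing n₁ n₂ n₁' l j with
  | zero =>
    obtain rfl : j = 2 := by omega
    obtain rfl : l = 0 := by omega
    rw [cups_succ (m := 1) (n₁ := n₂) (Nat.zero_le _) (by omega), Category.assoc,
      zigzag (by omega), Category.comp_id, cups_succ (Nat.zero_le _) hn₁]
  | succ m ih =>
    rw [cups_succ (m := m + 2) (n₁ := n₂) (Nat.zero_le _) (by omega), Category.assoc]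
    rcases hj.eq_or_lt with rfl | hj
    · rw [zigzag (by omega), Category.comp_id, cups_succ (Nat.zero_le _) hn₁]
      obtain rfl : l = 0 + (m + 1) := by omega
      rfl
    · rw [cupM_capM (n := n₁) (i := 0 + (m + 2)) (j := j - 2) (by omega) (by omega) (by omega)
        hn₂ hn₂ (by omega), ← Category.assoc,
        ih (l := l) (j := j - 2) (n₁ := n + 2 * m) (by omega) (by omega) (by omega) rfl (by omega),
        Category.assoc,
        cupM_cupM (n := n + 2 * m) (i := l) (j := 0 + m) (j' := 0 + (m + 2)) (n₁' := n₁) (by omega)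
          (by omega) (by omega) (by omega) (by omega) (by omega), ← Category.assoc, ← cups_succ]

end Nested

/-! ### Rotating diagrams -/

/-- A local minimum slides past a diagram to its right. -/
theorem cupM_comp_addLeft {b b' j n n' : ℕ} (hj : j ≤ n) (hn : n' = n + 2)
    (g : pt d r b ⟶ pt d r b') :
    (cupM j (by omega) (by omega) : _ ⟶ pt d r (n' + b)) ≫ addLeft n' g =
      addLeft n g ≫ cupM j (by omega) (by omega) := by
  refine hom_induction (motive := fun b' g =>
    (cupM j (by omega) (by omega) : _ ⟶ pt d r (n' + b)) ≫ addLeft n' g =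
      addLeft n g ≫ cupM j (by omega) (by omega)) ?_ ?_ ?_ ?_ ?_ ?_ g
  · rw [addLeft_id, addLeft_id, Category.comp_id, Category.id_comp]
  · intro b₁ b₂ l hl hb g ih
    rw [addLeft_comp, addLeft_comp, ← Category.assoc, ih, Category.assoc, Category.assoc,
      addLeft_cupM, addLeft_cupM,
      cupM_cupM (n := n + b₁) (i := j) (j := n + l) (by omega) (by omega) (by omega)]
  · intro b₁ b₂ l hl hb g ih
    rw [addLeft_comp, addLeft_comp, ← Category.assoc, ih, Category.assoc, Category.assoc,
      addLeft_capM, addLeft_capM,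
      cupM_capM (n := n + b₂) (i := j) (j := n + l) (by omega) (by omega) (by omega)]
  · intro b'
    rw [addLeft_zero, addLeft_zero, Limits.comp_zero, Limits.zero_comp]
  · intro b' f g hf hg
    rw [addLeft_add, addLeft_add, Preadditive.comp_add, Preadditive.add_comp, hf, hg]
  · intro b' c f hf
    rw [addLeft_smul, addLeft_smul, Linear.comp_smul, Linear.smul_comp, hf]

/-- A local maximum slides past a diagram to its right. -/
theorem capM_comp_addLeft {b b' j n n' : ℕ} (hj : j ≤ n) (hn : n' = n + 2)
    (g : pt d r b ⟶ pt d r b') :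
    (capM j (by omega) (by omega) : pt d r (n' + b) ⟶ _) ≫ addLeft n g =
      addLeft n' g ≫ capM j (by omega) (by omega) := by
  refine hom_induction (motive := fun b' g =>
    (capM j (by omega) (by omega) : pt d r (n' + b) ⟶ _) ≫ addLeft n g =
      addLeft n' g ≫ capM j (by omega) (by omega)) ?_ ?_ ?_ ?_ ?_ ?_ g
  · rw [addLeft_id, addLeft_id, Category.comp_id, Category.id_comp]
  · intro b₁ b₂ l hl hb g ih
    rw [addLeft_comp, addLeft_comp, ← Category.assoc, ih, Category.assoc, Category.assoc,
      addLeft_cupM, addLeft_cupM,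
      cupM_capM' (n := n + b₁) (i := j) (j := n + l) (by omega) (by omega) (by omega)]
  · intro b₁ b₂ l hl hb g ih
    rw [addLeft_comp, addLeft_comp, ← Category.assoc, ih, Category.assoc, Category.assoc,
      addLeft_capM, addLeft_capM,
      capM_capM (n := n + b₂) (i := j) (j := n + l) (by omega) (by omega) (by omega)]
  · intro b'
    rw [addLeft_zero, addLeft_zero, Limits.comp_zero, Limits.zero_comp]
  · intro b' f g hf hg
    rw [addLeft_add, addLeft_add, Preadditive.comp_add, Preadditive.add_comp, hf, hg]
  · intro b' c f hf
    rw [addLeft_smul, addLeft_smul, Linear.comp_smul, Linear.smul_comp, hf]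

/-- Juxtaposed diagrams can exchange their heights. -/
theorem addRight_comp_addLeft {a a' b b' : ℕ} (x : pt d r a ⟶ pt d r a')
    (g : pt d r b ⟶ pt d r b') :
    addRight b x ≫ addLeft a' g = addLeft a g ≫ addRight b' x := by
  refine hom_induction (motive := fun a' x =>
    addRight b x ≫ addLeft a' g = addLeft a g ≫ addRight b' x) ?_ ?_ ?_ ?_ ?_ ?_ x
  · rw [addRight_id, addRight_id, Category.comp_id, Category.id_comp]
  · intro n n' i hi hn x ih
    rw [addRight_comp, addRight_comp, ← Category.assoc, ← ih, addRight_cupM, addRight_cupM,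
      Category.assoc, Category.assoc, cupM_comp_addLeft hi hn]
  · intro n n' i hi hn x ih
    rw [addRight_comp, addRight_comp, ← Category.assoc, ← ih, addRight_capM, addRight_capM,
      Category.assoc, Category.assoc, capM_comp_addLeft hi hn]
  · intro a'
    rw [addRight_zero, addRight_zero, Limits.comp_zero, Limits.zero_comp]
  · intro a' f g hf hg
    rw [addRight_add, addRight_add, Preadditive.comp_add, Preadditive.add_comp, hf, hg]
  · intro a' c f hf
    rw [addRight_smul, addRight_smul, Linear.comp_smul, Linear.smul_comp, hf]

/-- Coevaluation: the unit of the adjunction between `1_i ⊗ -` and itself. -/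
noncomputable def coev (d : ℂ) (r i b : ℕ) : pt d r b ⟶ pt d r (i + (i + b)) :=
  cups 0 i (Nat.zero_le _) (by omega)

/-- Evaluation: the counit of the adjunction between `1_i ⊗ -` and itself. -/
noncomputable def ev (d : ℂ) (r i b : ℕ) : pt d r (i + (i + b)) ⟶ pt d r b :=
  caps 0 i (Nat.zero_le _) (by omega)

theorem coev_natural (i : ℕ) {b b' : ℕ} (g : pt d r b ⟶ pt d r b') :
    coev d r i b ≫ addLeft i (addLeft i g) = g ≫ coev d r i b' := by
  refine hom_induction (motive := fun b' g =>
    coev d r i b ≫ addLeft i (addLeft i g) = g ≫ coev d r i b') ?_ ?_ ?_ ?_ ?_ ?_ g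
  · rw [addLeft_id, addLeft_id, Category.comp_id, Category.id_comp]
  · intro b₁ b₂ l hl hb g ih
    rw [addLeft_comp, addLeft_comp, ← Category.assoc, ih, Category.assoc, Category.assoc,
      addLeft_cupM, addLeft_cupM, coev, cups_comp_cupM hl (by omega) _ _ hb]
    rfl
  · intro b₁ b₂ l hl hb g ih
    rw [addLeft_comp, addLeft_comp, ← Category.assoc, ih, Category.assoc, Category.assoc,
      addLeft_capM, addLeft_capM, coev, cups_comp_capM_ge hl (by omega) _ _ hb]
    rfl
  · intro b'
    rw [addLeft_zero, addLeft_zero, Limits.comp_zero, Limits.zero_comp]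
  · intro b' f g hf hg
    rw [addLeft_add, addLeft_add, Preadditive.comp_add, Preadditive.add_comp, hf, hg]
  · intro b' c f hf
    rw [addLeft_smul, addLeft_smul, Linear.comp_smul, Linear.smul_comp, hf]

theorem ev_natural (i : ℕ) {b b' : ℕ} (g : pt d r b ⟶ pt d r b') :
    addLeft i (addLeft i g) ≫ ev d r i b' = ev d r i b ≫ g := by
  refine hom_induction (motive := fun b' g =>
    addLeft i (addLeft i g) ≫ ev d r i b' = ev d r i b ≫ g) ?_ ?_ ?_ ?_ ?_ ?_ g
  · rw [addLeft_id, addLeft_id, Category.comp_id, Category.id_comp]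
  · intro b₁ b₂ l hl hb g ih
    rw [addLeft_comp, addLeft_comp, Category.assoc, ← Category.assoc (ev d r i b), ← ih,
      addLeft_cupM, addLeft_cupM, ev, cupM_comp_caps_ge hl (by omega) (by omega) _ hb,
      Category.assoc]
    rfl
  · intro b₁ b₂ l hl hb g ih
    rw [addLeft_comp, addLeft_comp, Category.assoc, ← Category.assoc (ev d r i b), ← ih,
      addLeft_capM, addLeft_capM, ev, capM_comp_caps_ge hl (by omega) (by omega) _ hb,
      Category.assoc]
    rfl
  · intro b'
    rw [addLeft_zero, addLeft_zero, Limits.comp_zero, Limits.zero_comp]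
  · intro b' f g hf hg
    rw [addLeft_add, addLeft_add, Preadditive.comp_add, Preadditive.add_comp, hf, hg]
  · intro b' c f hf
    rw [addLeft_smul, addLeft_smul, Linear.comp_smul, Linear.smul_comp, hf]

theorem addLeft_coev_comp_ev (i b : ℕ) :
    addLeft i (coev d r i b) ≫ ev d r i (i + b) = 𝟙 (pt d r (i + b)) := by
  rw [coev, addLeft_cups]
  exact cups_comp_caps (by omega) _

theorem coev_comp_addLeft_ev (i b : ℕ) :
    coev d r i (i + b) ≫ addLeft i (ev d r i b) = 𝟙 (pt d r (i + b)) := by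
  rw [ev, addLeft_caps]
  exact cups_comp_caps' (by omega) _

/-- Bend the `i` left strands at the bottom of a diagram to the top. -/
noncomputable def bend {i b c : ℕ} (g : pt d r (i + b) ⟶ pt d r c) : pt d r b ⟶ pt d r (i + c) :=
  coev d r i b ≫ addLeft i g

theorem bend_addLeft_comp {i b b' c : ℕ} (g : pt d r b ⟶ pt d r b')
    (f : pt d r (i + b') ⟶ pt d r c) : bend (addLeft i g ≫ f) = g ≫ bend f := by
  rw [bend, addLeft_comp, ← Category.assoc, coev_natural, Category.assoc, bend]

theorem addLeft_bend_comp_ev {i b c : ℕ} (g : pt d r (i + b) ⟶ pt d r c) :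
    addLeft i (bend g) ≫ ev d r i c = g := by
  rw [bend, addLeft_comp, Category.assoc, ev_natural, ← Category.assoc, addLeft_coev_comp_ev,
    Category.id_comp]

theorem bend_add {i b c : ℕ} (f g : pt d r (i + b) ⟶ pt d r c) :
    bend (f + g) = bend f + bend g := by
  rw [bend, addLeft_add, Preadditive.comp_add]
  rfl

theorem bend_smul {i b c : ℕ} (a : ℂ) (g : pt d r (i + b) ⟶ pt d r c) :
    bend (a • g) = a • bend g := by
  rw [bend, addLeft_smul, Linear.comp_smul]
  rfl

/-- The half turn of a diagram that starts with a local maximum ends with a local minimum, so that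
it is killed by `p_i`. -/
theorem bend_comp_proj (h : IsLevel d r k) {i : ℕ} (hi : i ≤ k) {y : pt d r i ⟶ pt d r i}
    (hy : y ∈ capSpan d r i i) : bend (addRight i y ≫ ev d r i 0) ≫ proj d r i = 0 := by
  induction hy using Submodule.span_induction with
  | mem y hy =>
    obtain ⟨m, j, hj, hm, x, rfl⟩ := hy
    rw [addRight_comp, addRight_capM, Category.assoc, bend, addLeft_comp, addLeft_capM,
      ← Category.assoc]
    subst hm
    rw [coev, cups_comp_capM_right (m := m) (j := m + 2 + j) (l := m - j) (n₁ := m + (m + (m + 2)))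
      (by omega) (by omega) (by omega) (by omega) (n₂ := m + 2 + (m + (m + 2))) (by omega)
      (by omega), Category.assoc, Category.assoc,
      ← Category.assoc (cupM _ _ _), cupM_comp_addLeft (by omega : m - j ≤ m) rfl, Category.assoc,
      cupM_comp_proj h (by omega), Limits.comp_zero, Limits.comp_zero]
  | zero => rw [addRight_zero]; simp [bend, addLeft_zero]
  | add f g _ _ hf hg =>
    rw [addRight_add, Preadditive.add_comp, bend_add, Preadditive.add_comp, hf, hg, add_zero]
  | smul c f _ hf =>
    rw [addRight_smul, Linear.smul_comp, bend_smul, Linear.smul_comp, hf, smul_zero]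

/-- The half turn `q` of the projector `p_i` is `p_i`. Local maxima on top of `q` give zero, so that
`q = q ≫ p_i`. On the other hand, the half turn of `1 - p_i` is killed by `p_i` on top of it, so
that `q ≫ p_i` is the half turn of the identity followed by `p_i`. -/
theorem bend_proj (h : IsLevel d r k) {i : ℕ} (hi : i ≤ k) :
    bend (addRight i (proj d r i) ≫ ev d r i 0) = proj d r i := by
  have hkill : ∀ y ∈ capSpan d r i i, bend (addRight i (proj d r i) ≫ ev d r i 0) ≫ y = 0 := by
    intro y hy
    induction hy using Submodule.span_induction with
    | mem y hy =>
      obtain ⟨m, j, hj, rfl, x, rfl⟩ := hy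
      have e : addLeft m (cupM (n := m + (m + 2)) (n' := m + 2 + (m + 2)) (m - j) (by omega)
          (by omega) : pt d r (m + (m + 2)) ⟶ pt d r (m + 2 + (m + 2))) =
            cupM (m + (m - j)) (by omega) (by omega) := addLeft_cupM m _ _
      have e' : (cupM (n := m + (m + 2)) (n' := m + 2 + (m + 2)) (m - j) (by omega)
          (by omega) : pt d r (m + (m + 2)) ⟶ pt d r (m + 2 + (m + 2))) =
            addRight (m + 2) (cupM (m - j) (by omega) rfl : pt d r m ⟶ pt d r (m + 2)) :=
        (addRight_cupM (m + 2) _ _).symm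
      rw [← Category.assoc, bend, Category.assoc (coev d r (m + 2) (m + 2)),
        ← capM_comp_addLeft (n := m) (b' := 0) hj rfl,
        ← Category.assoc (coev d r (m + 2) (m + 2)), coev,
        cups_comp_capM_left (m := m) (l := m + (m - j)) (n₁ := m + (m + (m + 2))) (by omega) hj
          (by omega) (by omega) (by omega), ← e, Category.assoc (cups _ _ _ _), ← addLeft_comp, e',
        ← Category.assoc, ← addRight_comp, cupM_comp_proj h (by omega), addRight_zero,
        Limits.zero_comp, addLeft_zero, Limits.comp_zero, Limits.zero_comp]
    | zero => exact Limits.comp_zero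
    | add f g _ _ hf hg => rw [Preadditive.comp_add, hf, hg, add_zero]
    | smul c f _ hf => rw [Linear.comp_smul, hf, smul_zero]
  have h₁ := hkill _ (id_sub_proj_mem_capSpan i)
  have h₂ := bend_comp_proj h hi (id_sub_proj_mem_capSpan i)
  have h₃ : bend (ev d r i 0) = 𝟙 (pt d r i) := coev_comp_addLeft_ev i 0
  have e : ev d r i 0 = addRight i (𝟙 (pt d r i) - proj d r i) ≫ ev d r i 0 +
      addRight i (proj d r i) ≫ ev d r i 0 := by
    rw [← Preadditive.add_comp, ← addRight_add, sub_add_cancel, addRight_id, Category.id_comp]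
  rw [Preadditive.comp_sub, sub_eq_zero] at h₁
  have h₄ : bend (addRight i (proj d r i) ≫ ev d r i 0) ≫ 𝟙 (pt d r i) =
      bend (addRight i (proj d r i) ≫ ev d r i 0) := Category.comp_id _
  rw [← h₄, h₁]
  calc bend (addRight i (proj d r i) ≫ ev d r i 0) ≫ proj d r i
      = bend (ev d r i 0) ≫ proj d r i := by
        conv_rhs => rw [e, bend_add, Preadditive.add_comp, h₂, zero_add]
    _ = proj d r i := by rw [h₃]; exact Category.id_comp _

/-! ### Tensor products and duality -/

section Tensor

variable {ρ σ : Rep d r}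

/-- The class of `x ⊗ y ⊗ h` in the tensor product. -/
noncomputable def tensorMk {a b : ℕ} {t : TLJ d r} (x : ρ.obj (pt d r a)) (y : σ.obj (pt d r b))
    (h : pt d r (a + b) ⟶ t) : (tensor ρ σ).obj t :=
  (Submodule.mkQ (tensorRel ρ σ t) (preTmul x y h) : PreTensor ρ σ t ⧸ tensorRel ρ σ t)

theorem tensorMk_map_left {a a' b : ℕ} {t : TLJ d r} (f : pt d r a ⟶ pt d r a')
    (x : ρ.obj (pt d r a)) (y : σ.obj (pt d r b)) (h : pt d r (a' + b) ⟶ t) :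
    tensorMk (ρ.map f x) y h = tensorMk x y (addRight b f ≫ h) :=
  (Submodule.Quotient.eq _).2 (Submodule.subset_span (Or.inl ⟨a, a', b, f, x, y, h, rfl⟩))

theorem tensorMk_map_right {a b b' : ℕ} {t : TLJ d r} (g : pt d r b ⟶ pt d r b')
    (x : ρ.obj (pt d r a)) (y : σ.obj (pt d r b)) (h : pt d r (a + b') ⟶ t) :
    tensorMk x (σ.map g y) h = tensorMk x y (addLeft a g ≫ h) :=
  (Submodule.Quotient.eq _).2 (Submodule.subset_span (Or.inr ⟨a, b, b', g, x, y, h, rfl⟩))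

theorem preTmul_add_right {a b : ℕ} {t : TLJ d r} (x : ρ.obj (pt d r a)) (y : σ.obj (pt d r b))
    (h h' : pt d r (a + b) ⟶ t) : preTmul x y (h + h') = preTmul x y h + preTmul x y h' := by
  simp only [preTmul, TensorProduct.tmul_add, map_add]

theorem preTmul_smul_right {a b : ℕ} {t : TLJ d r} (c : ℂ) (x : ρ.obj (pt d r a))
    (y : σ.obj (pt d r b)) (h : pt d r (a + b) ⟶ t) :
    preTmul x y (c • h) = c • preTmul x y h := by
  simp only [preTmul, TensorProduct.tmul_smul, map_smul]

theorem preTmul_add_middle {a b : ℕ} {t : TLJ d r} (x : ρ.obj (pt d r a)) (y y' : σ.obj (pt d r b))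
    (h : pt d r (a + b) ⟶ t) : preTmul x (y + y') h = preTmul x y h + preTmul x y' h := by
  simp only [preTmul, TensorProduct.add_tmul, TensorProduct.tmul_add, map_add]

theorem preTmul_smul_middle {a b : ℕ} {t : TLJ d r} (c : ℂ) (x : ρ.obj (pt d r a))
    (y : σ.obj (pt d r b)) (h : pt d r (a + b) ⟶ t) :
    preTmul x (c • y) h = c • preTmul x y h := by
  simp only [preTmul, ← TensorProduct.smul_tmul', TensorProduct.tmul_smul, map_smul]

theorem preTensor_ext {t : TLJ d r} {M : Type*} [AddCommGroup M] [Module ℂ M]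
    {f g : PreTensor ρ σ t →ₗ[ℂ] M}
    (hfg : ∀ {a b : ℕ} (x : ρ.obj (pt d r a)) (y : σ.obj (pt d r b)) (h : pt d r (a + b) ⟶ t),
      f (preTmul x y h) = g (preTmul x y h)) : f = g := by
  refine DirectSum.linearMap_ext _ fun ab => TensorProduct.ext' fun x z => ?_
  induction z with
  | zero => simp
  | add z z' h h' => simp only [TensorProduct.tmul_add, map_add, h, h']
  | tmul y h => exact hfg x y h

theorem tensor_ext {t : TLJ d r} {M : Type*} [AddCommGroup M] [Module ℂ M]
    {f g : (tensor ρ σ).obj t →ₗ[ℂ] M}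
    (hfg : ∀ {a b : ℕ} (x : ρ.obj (pt d r a)) (y : σ.obj (pt d r b)) (h : pt d r (a + b) ⟶ t),
      f (tensorMk x y h) = g (tensorMk x y h)) : f = g :=
  Submodule.linearMap_qext _ (preTensor_ext hfg)

theorem tensor_map_tensorMk {a b : ℕ} {s t : TLJ d r} (l : s ⟶ t) (x : ρ.obj (pt d r a))
    (y : σ.obj (pt d r b)) (h : pt d r (a + b) ⟶ s) :
    (tensor ρ σ).map l (tensorMk x y h) = tensorMk x y (h ≫ l) :=
  congrArg (Submodule.mkQ (tensorRel ρ σ t)) (preMap_preTmul ρ (𝟙 σ) l x y h)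

theorem tensorMap_tensorMk {σ' : Rep d r} (φ : σ ⟶ σ') {a b : ℕ} {t : TLJ d r}
    (x : ρ.obj (pt d r a)) (y : σ.obj (pt d r b)) (h : pt d r (a + b) ⟶ t) :
    (tensorMap ρ φ).app t (tensorMk x y h) = tensorMk x (φ.app _ y) h :=
  (congrArg (Submodule.mkQ (tensorRel ρ σ' t)) (preMap_preTmul ρ φ (𝟙 t) x y h)).trans
    (congrArg (tensorMk x (φ.app _ y)) (Category.comp_id h))

instance : (tensor ρ σ).Additive where
  map_add {s t f g} := by
    refine ModuleCat.hom_ext (tensor_ext fun x y h => ?_)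
    change (tensor ρ σ).map (f + g) _ = (tensor ρ σ).map f _ + (tensor ρ σ).map g _
    rw [tensor_map_tensorMk, tensor_map_tensorMk, tensor_map_tensorMk, Preadditive.comp_add]
    exact congrArg (Submodule.mkQ _) (preTmul_add_right x y _ _)

instance : (tensor ρ σ).Linear ℂ where
  map_smul {s t} f c := by
    refine ModuleCat.hom_ext (tensor_ext fun x y h => ?_)
    change (tensor ρ σ).map (c • f) _ = c • (tensor ρ σ).map f _
    rw [tensor_map_tensorMk, tensor_map_tensorMk, Linear.comp_smul]
    exact congrArg (Submodule.mkQ _) (preTmul_smul_right c x y _)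

end Tensor

section Pairing

variable (i : ℕ) (ρ : Rep d r) [ρ.Additive] [ρ.Linear ℂ]

/-- The bilinear map `(x, h) ↦ ρ(bend ((x ⊗ 1) h))`. -/
noncomputable def bendMap (a b : ℕ) : irrepSpace d r i (pt d r a) →ₗ[ℂ]
    (pt d r (a + b) ⟶ pt d r 0) →ₗ[ℂ] ρ.obj (pt d r b) →ₗ[ℂ] ρ.obj (pt d r i) :=
  LinearMap.mk₂ ℂ
    (fun x h => (ρ.map (bend (c := 0) (addRight b x.1 ≫ h) : pt d r b ⟶ pt d r i)).hom)
    (fun x x' h => by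
      rw [Submodule.coe_add, addRight_add, Preadditive.add_comp, bend_add, ρ.map_add]; rfl)
    (fun c x h => by
      rw [Submodule.coe_smul, addRight_smul, Linear.smul_comp, bend_smul, ρ.map_smul]; rfl)
    (fun x h h' => by rw [Preadditive.comp_add, bend_add, ρ.map_add]; rfl)
    (fun c x h => by rw [Linear.comp_smul, bend_smul, ρ.map_smul]; rfl)

/-- The map `x ⊗ y ⊗ h ↦ ρ(bend ((x ⊗ 1) h)) y`. -/
noncomputable def prePairing : PreTensor (irrep d r i) ρ (pt d r 0) →ₗ[ℂ] ρ.obj (pt d r i) :=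
  DirectSum.toModule ℂ (ℕ × ℕ) _ fun ab => TensorProduct.lift
    ((TensorProduct.lift.equiv (RingHom.id ℂ) _ _ _).toLinearMap ∘ₗ
      LinearMap.lflip.toLinearMap ∘ₗ bendMap i ρ ab.1 ab.2)

variable {i} in
theorem prePairing_preTmul {a b : ℕ} (x : (irrep d r i).obj (pt d r a)) (y : ρ.obj (pt d r b))
    (h : pt d r (a + b) ⟶ pt d r 0) :
    prePairing i ρ (preTmul x y h) =
      ρ.map (bend (c := 0) (addRight b (x : irrepSpace d r i _).1 ≫ h) :
        pt d r b ⟶ pt d r i) y := by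
  refine (DirectSum.toModule_lof ℂ (a, b) _).trans ?_
  rfl

theorem tensorRel_le_ker_prePairing :
    tensorRel (irrep d r i) ρ (pt d r 0) ≤ LinearMap.ker (prePairing i ρ) := by
  refine Submodule.span_le.2 ?_
  rintro z (⟨a, a', b, f, x, y, h, rfl⟩ | ⟨a, b, b', g, x, y, h, rfl⟩)
  · rw [SetLike.mem_coe, LinearMap.mem_ker, map_sub, sub_eq_zero, prePairing_preTmul,
      prePairing_preTmul, irrep_map_val, addRight_comp, Category.assoc]
  · rw [SetLike.mem_coe, LinearMap.mem_ker, map_sub, sub_eq_zero, prePairing_preTmul,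
      prePairing_preTmul, ← Category.assoc (addRight b _), addRight_comp_addLeft, Category.assoc,
      bend_addLeft_comp, ← ModuleCat.comp_apply, ← ρ.map_comp]

/-- The map from `(W_i ⊗ ρ)(0)` to `ρ(i)` which sends the class of `x ⊗ y ⊗ h` to
`ρ(bend ((x ⊗ 1) h)) y`. -/
noncomputable def pairing : (tensor (irrep d r i) ρ).obj (pt d r 0) →ₗ[ℂ] ρ.obj (pt d r i) :=
  Submodule.liftQ _ (prePairing i ρ) (tensorRel_le_ker_prePairing i ρ)

variable {i} in
theorem pairing_tensorMk {a b : ℕ} (x : (irrep d r i).obj (pt d r a)) (y : ρ.obj (pt d r b))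
    (h : pt d r (a + b) ⟶ pt d r 0) :
    pairing i ρ (tensorMk x y h) =
      ρ.map (bend (c := 0) (addRight b (x : irrepSpace d r i _).1 ≫ h) :
        pt d r b ⟶ pt d r i) y :=
  prePairing_preTmul ρ x y h

/-- The map `y ↦ p_i ⊗ y ⊗ ev`; it inverts `pairing` up to the projector `p_i`. -/
noncomputable def copairing : ρ.obj (pt d r i) →ₗ[ℂ] (tensor (irrep d r i) ρ).obj (pt d r 0) where
  toFun y := tensorMk (ρ := irrep d r i) (gen d r i) y (ev d r i 0)
  map_add' y y' := congrArg (Submodule.mkQ _) (preTmul_add_middle _ y y' _)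
  map_smul' c y := congrArg (Submodule.mkQ _) (preTmul_smul_middle c _ y _)

theorem copairing_comp_pairing (h : IsLevel d r k) (hi : i ≤ k) :
    copairing i ρ ∘ₗ pairing i ρ = LinearMap.id := by
  refine tensor_ext fun {a b} x y f => ?_
  have e : (irrep d r i).map (x : irrepSpace d r i _).1 (gen d r i) = x :=
    Subtype.ext (proj_comp_of_mem h hi x)
  rw [LinearMap.comp_apply, pairing_tensorMk]
  refine (tensorMk_map_right (ρ := irrep d r i) _ (gen d r i) y (ev d r i 0)).trans ?_
  refine (congrArg (tensorMk (ρ := irrep d r i) (gen d r i) y) (addLeft_bend_comp_ev _)).trans ?_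
  refine
    (tensorMk_map_left (ρ := irrep d r i) (x : irrepSpace d r i _).1 (gen d r i) y f).symm.trans ?_
  exact congrArg (tensorMk (ρ := irrep d r i) · y f) e

theorem pairing_copairing (h : IsLevel d r k) (hi : i ≤ k) (y : ρ.obj (pt d r i)) :
    pairing i ρ (copairing i ρ y) = ρ.map (proj d r i) y := by
  refine (pairing_tensorMk (i := i) ρ (gen d r i) y (ev d r i 0)).trans ?_
  exact congrArg (fun f => ρ.map f y) (bend_proj h hi)

variable {ρ} in
theorem pairing_tensorMap {σ : Rep d r} [σ.Additive] [σ.Linear ℂ] (φ : ρ ⟶ σ)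
    (z : (tensor (irrep d r i) ρ).obj (pt d r 0)) :
    pairing i σ ((tensorMap (irrep d r i) φ).app _ z) = φ.app _ (pairing i ρ z) := by
  suffices pairing i σ ∘ₗ ((tensorMap (irrep d r i) φ).app _).hom =
      (φ.app _).hom ∘ₗ pairing i ρ from LinearMap.congr_fun this z
  refine tensor_ext fun {a b} x y f => ?_
  rw [LinearMap.comp_apply, LinearMap.comp_apply, pairing_tensorMk]
  refine (congrArg (pairing i σ) (tensorMap_tensorMk φ x y f)).trans ?_
  rw [pairing_tensorMk]
  exact (congrArg (fun u => u.hom y) (φ.naturality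
    (bend (c := 0) (addRight b (x : irrepSpace d r i _).1 ≫ f) : pt d r b ⟶ pt d r i))).symm

variable {i} in
/-- The space `(W_i ⊗ ρ)(0)` is isomorphic to `ρ(i) p_i`. -/
noncomputable def pairingEquiv (h : IsLevel d r k) (hi : i ≤ k) :
    (tensor (irrep d r i) ρ).obj (pt d r 0) ≃ₗ[ℂ] LinearMap.range (ρ.map (proj d r i)).hom :=
  have hc (z) : copairing i ρ (pairing i ρ z) = z :=
    LinearMap.congr_fun (copairing_comp_pairing i ρ h hi) z
  { (pairing i ρ).codRestrict (LinearMap.range (ρ.map (proj d r i)).hom) fun z =>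
      LinearMap.mem_range.2 ⟨pairing i ρ z, by
        refine (pairing_copairing i ρ h hi _).symm.trans ?_
        rw [hc]⟩ with
    invFun := fun y => copairing i ρ y.1
    left_inv := hc
    right_inv := fun y => by
      obtain ⟨_, y, rfl⟩ := y
      refine Subtype.ext ((pairing_copairing i ρ h hi _).trans ?_)
      rw [← ModuleCat.comp_apply, ← ρ.map_comp, proj_comp_proj h (by omega)] }

variable {i} in
/-- The isomorphism `Hom(W_0, W_i ⊗ ρ) ≅ Hom(W_i, ρ)`: both sides are the space `ρ(i) p_i`. -/
noncomputable def dualEquiv (h : IsLevel d r k) (hi : i ≤ k) :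
    (irrep d r 0 ⟶ tensor (irrep d r i) ρ) ≃ₗ[ℂ] (irrep d r i ⟶ ρ) :=
  yonedaEquiv h (Nat.zero_le k) _ ≪≫ₗ
    LinearEquiv.ofTop _ (by
      rw [proj_zero, CategoryTheory.Functor.map_id]
      exact LinearMap.range_id) ≪≫ₗ
    pairingEquiv ρ h hi ≪≫ₗ (yonedaEquiv h hi ρ).symm

theorem yonedaEquiv_dualEquiv (h : IsLevel d r k) (hi : i ≤ k)
    (x : irrep d r 0 ⟶ tensor (irrep d r i) ρ) :
    (yonedaEquiv h hi ρ (dualEquiv ρ h hi x)).1 = pairing i ρ (x.app _ (gen d r 0)) := by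
  rw [dualEquiv, LinearEquiv.trans_apply, LinearEquiv.trans_apply, LinearEquiv.trans_apply,
    LinearEquiv.apply_symm_apply]
  rfl

end Pairing

theorem isDual_self (h : IsLevel d r k) {i : ℕ} (hi : i ≤ k) :
    IsDual (irrep d r i) (irrep d r i) := by
  refine ⟨fun W hW => haveI := hW.additive; haveI := hW.linear; dualEquiv W h hi, ?_⟩
  intro W W' hW hW' φ x
  have := hW.additive
  have := hW.linear
  have := hW'.additive
  have := hW'.linear
  refine (yonedaEquiv h hi W').injective (Subtype.ext ?_)
  change (yonedaEquiv h hi W' (dualEquiv W' h hi (x ≫ tensorMap _ φ))).1 =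
    φ.app _ (yonedaEquiv h hi W (dualEquiv W h hi x)).1
  rw [yonedaEquiv_dualEquiv, yonedaEquiv_dualEquiv]
  exact pairing_tensorMap i φ _

theorem isDual_iff (h : IsLevel d r k) {i j : ℕ} (hi : i ≤ k) (hj : j ≤ k) :
    IsDual (irrep d r i) (irrep d r j) ↔ j = i := by
  constructor
  · rintro ⟨e, -⟩
    by_contra hji
    have hW : IsRep (irrep d r i) := isRep_irrep h hi
    -- `Hom(W_i, W_i) ≅ Hom(W_0, W_i ⊗ W_i) ≅ Hom(W_j, W_i) = 0`
    let f := (dualEquiv (irrep d r i) h hi).symm ≪≫ₗ e _ hW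
    have h1 : f (𝟙 _) = f 0 := by
      rw [irrep_hom_eq_zero h hj hi hji (f (𝟙 _)), map_zero]
    exact irrep_not_isZero h hi ((IsZero.iff_id_eq_zero _).2 (f.injective h1))
  · rintro rfl
    exact isDual_self h hj

end RectTLJ

theorem mainTheorem5 (r k : ℕ) (hr : 3 ≤ r) (hk : k + 2 = r) (A d : ℂ)
    (hA : IsPrimitiveRoot A (4 * r)) (hd : d = -A ^ 2 - (A⁻¹) ^ 2) :
    -- each `W_i` is an irreducible representation, even in the strong sense: it is nonzero and has no
    -- proper nonzero invariant family of subspaces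
    (∀ i : Fin (k + 1), RectTLJ.IsRep (RectTLJ.irrep d r i) ∧ Simple (RectTLJ.irrep d r i)) ∧
    -- they are pairwise non-isomorphic
    (∀ i j : Fin (k + 1), Nonempty (RectTLJ.irrep d r i ≅ RectTLJ.irrep d r j) → i = j) ∧
    -- every irreducible representation (nonzero, not a direct sum of two nonzero ones) is
    -- isomorphic to one of them
    (∀ ρ : RectTLJ.TLJ d r ⥤ ModuleCat.{0} ℂ, RectTLJ.IsRep ρ → Indecomposable ρ →
      ∃ i : Fin (k + 1), Nonempty (ρ ≅ RectTLJ.irrep d r i)) ∧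
    -- every representation is a direct sum of them
    (∀ ρ : RectTLJ.TLJ d r ⥤ ModuleCat.{0} ℂ, RectTLJ.IsRep ρ →
      ∃ m : Fin (k + 1) → ℕ,
        Nonempty (ρ ≅ ⨁ fun x : (Σ i : Fin (k + 1), Fin (m i)) => RectTLJ.irrep d r x.1)) ∧
    -- the duality involution on the labels is the identity
    (∀ i j : Fin (k + 1),
      RectTLJ.IsDual (RectTLJ.irrep d r i) (RectTLJ.irrep d r j) ↔ j = i) := by
  have h : RectTLJ.IsLevel d r k := RectTLJ.isLevel_of_isPrimitiveRoot hr hk hA hd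
  have hle (i : Fin (k + 1)) : (i : ℕ) ≤ k := Nat.lt_succ_iff.1 i.2
  refine ⟨fun i => ⟨RectTLJ.isRep_irrep h (hle i), RectTLJ.simple_irrep h (hle i)⟩,
    fun i j ⟨e⟩ => Fin.ext (RectTLJ.eq_of_iso h (hle i) (hle j) e),
    fun ρ hρ hind => RectTLJ.exists_iso_irrep h hρ hind,
    fun ρ hρ => RectTLJ.exists_decomposition h hρ,
    fun i j => (RectTLJ.isDual_iff h (hle i) (hle j)).trans Fin.ext_iff.symm⟩
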